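/- **Definitions.** Let $X\in\mathbb{R}^{m\times n}$ be a dataset ($m$ data objects, $n$ features). A subgroup is given by bounds $lb,ub\in(\mathbb{R}\cup\{-\infty,+\infty\})^n$. Its membership vector $b\in\{0,1\}^m$ has $b_i=1$ iff $lb_j\le X_{ij}\le ub_j$ for all $j$. Its feature-selection vector $s\in\{0,1\}^n$ has $s_j=1$ (feature $j$ is selected) iff $X_{ij}<lb_j$ or $X_{ij}>ub_j$ for some $i$. Let $\mathrm{sim}$ and $\mathrm{dis}$ be real-valued functions of pairs of binary vectors of equal length. *Alternative-subgroup-description discovery* (for $\mathrm{sim}$, $\mathrm{dis}$): given $X$, $a\ge 1$ existing subgroups with membership vectors $b^{(l)}\in\{0,1\}^m$ and feature-selection vectors $s^{(l)}\in\{0,1\}^n$ ($0\le l<a$), and a threshold $\tau\ge 0$, find a subgroup whose membership vector $b$ and feature-selection vector $s$ maximize $\mathrm{sim}(b,b^{(0)})$ subject to $\mathrm{dis}(s,s^{(l)})\ge\tau$ for all $l$, the maximum being taken over all $lb,ub\in(\mathbb{R}\cup\{-\infty,+\infty\})^n$, or report that no subgroup satisfies the constraints. *With a feature-cardinality constraint*,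 a number $k\in\mathbb{N}$ is also given, and the subgroup must have at most $k$ selected features. Inputs are encoded as strings over a finite alphabet; the entries of $X$ and $\tau$ are rational numbers, written as fractions in binary. A search problem with parameter $p$ lies in $\mathrm{XP}$ if there are polynomials $f,g$ and a Turing machine that on every instance of encoding length $N$ and parameter $p$ outputs a correct answer within $f(p)\cdot N^{g(p)}$ steps. **Proposition.** Assume that it can be decided in polynomial time whether $\mathrm{sim}(b,b^{(0)})\le\mathrm{sim}(b',b^{(0)})$ (given binary vectors $b,b',b^{(0)}$ of equal length) and whether $\mathrm{dis}(s,s')\ge\tau$ (given binary vectors $s,s'$ of equal length and a rational $\tau\ge 0$); this holds for instance if both measures have rational values computable in polynomial time. Then 1. alternative-subgroup-description discovery lies in $\mathrm{XP}$ with parameter $n$; 2. alternative-subgroup-description discovery with a feature-cardinality constraint lies in $\mathrm{XP}$ with parameter $k$. -/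

import Mathlib

namespace SubgroupDiscovery

/-! ### Subgroups, feature selection and alternative descriptions over real-valued data -/

/-- Data object `i` is a member of the subgroup with bounds `lb`, `ub`. The bounds are extended
reals and are not required to satisfy `lb j ≤ ub j`. -/
def IsMember {m n : ℕ} (X : Matrix (Fin m) (Fin n) ℝ) (lb ub : Fin n → EReal) (i : Fin m) : Prop :=
  ∀ j, lb j ≤ (X i j : EReal) ∧ (X i j : EReal) ≤ ub j

/-- Feature `j` is selected if its bounds exclude at least one data object. -/
def IsSelected {m n : ℕ} (X : Matrix (Fin m) (Fin n) ℝ) (lb ub : Fin n → EReal) (j : Fin n) :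
    Prop :=
  ∃ i, (X i j : EReal) < lb j ∨ ub j < (X i j : EReal)

open Classical in
/-- The membership vector of a subgroup, an element of `{0,1}^m`. -/
noncomputable def membership {m n : ℕ} (X : Matrix (Fin m) (Fin n) ℝ) (lb ub : Fin n → EReal) :
    Fin m → Bool :=
  fun i => decide (IsMember X lb ub i)

open Classical in
/-- The feature-selection vector of a subgroup, an element of `{0,1}^n`. -/
noncomputable def selection {m n : ℕ} (X : Matrix (Fin m) (Fin n) ℝ) (lb ub : Fin n → EReal) :
    Fin n → Bool :=
  fun j => decide (IsSelected X lb ub j)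

/-- The number of selected features. -/
noncomputable def featureCardinality {m n : ℕ} (X : Matrix (Fin m) (Fin n) ℝ)
    (lb ub : Fin n → EReal) : ℕ :=
  (Finset.univ.filter fun j => selection X lb ub j = true).card

/-- A real-valued measure on pairs of binary vectors of equal length, for every length. -/
abbrev VectorMeasure : Type := ∀ d : ℕ, (Fin d → Bool) → (Fin d → Bool) → ℝ

/-- The subgroup is dissimilar to all existing subgroups. -/
def IsDissimilar (dis : VectorMeasure) {m n a : ℕ} (X : Matrix (Fin m) (Fin n) ℝ)
    (s : Fin a → Fin n → Bool) (τ : ℝ) (lb ub : Fin n → EReal) : Prop :=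
  ∀ l, τ ≤ dis n (selection X lb ub) (s l)

/-- The objective: similarity of the subgroup's membership vector to the original one. -/
noncomputable def similarity (sim : VectorMeasure) {m n : ℕ} (X : Matrix (Fin m) (Fin n) ℝ)
    (b₀ : Fin m → Bool) (lb ub : Fin n → EReal) : ℝ :=
  sim m (membership X lb ub) b₀

/-! ### Instances and answers as finite objects -/

/-- An instance of alternative-subgroup-description discovery (for given measures `sim`, `dis`).
As inputs of a Turing machine, the data and the threshold are rational numbers. The existing
subgroups are given by membership and selection vectors; number `0` is the original subgroup. -/
structure Instance where
  m : ℕ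
  n : ℕ
  X : Matrix (Fin m) (Fin n) ℚ
  a : ℕ
  a_pos : 0 < a
  b : Fin a → Fin m → Bool
  s : Fin a → Fin n → Bool
  τ : ℚ
  τ_nonneg : 0 ≤ τ

/-- An instance together with a feature-cardinality threshold. -/
structure CardInstance extends Instance where
  k : ℕ

/-- The dataset, as a real matrix. -/
def Instance.data (I : Instance) : Matrix (Fin I.m) (Fin I.n) ℝ := I.X.map (fun q => (q : ℝ))

/-- The membership vector of the original subgroup. -/
def Instance.original (I : Instance) : Fin I.m → Bool := I.b ⟨0, I.a_pos⟩

/-- Bounds that can be printed by a machine: rational or infinite. -/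
inductive Bound where
  | negInf
  | rat (q : ℚ)
  | posInf

/-- The extended real number denoted by a bound. -/
noncomputable def Bound.toEReal : Bound → EReal
  | .negInf => ⊥
  | .rat q => ((q : ℝ) : EReal)
  | .posInf => ⊤

/-- An answer: lower and upper bounds for every feature, or `none` for "there is no solution". -/
abbrev Answer (n : ℕ) : Type := Option ((Fin n → Bound) × (Fin n → Bound))

/-- `some (lb, ub)` is correct if it is feasible and has the largest objective value among all
feasible pairs of extended-real bounds; `none` is correct if no extended-real bounds are
feasible. -/
def IsOptimal {n : ℕ} (feasible : (Fin n → EReal) → (Fin n → EReal) → Prop)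
    (objective : (Fin n → EReal) → (Fin n → EReal) → ℝ) : Answer n → Prop
  | none => ∀ lb ub, ¬ feasible lb ub
  | some (lb, ub) =>
      feasible (fun j => (lb j).toEReal) (fun j => (ub j).toEReal) ∧
      ∀ lb' ub', feasible lb' ub' →
        objective lb' ub' ≤ objective (fun j => (lb j).toEReal) (fun j => (ub j).toEReal)

/-! ### Encoding by strings over a finite alphabet -/

/-- The alphabet of the encodings. -/
inductive Symb where
  | bit (b : Bool)
  | minus
  | infty
  | slash
  | comma
  | semicolon
  | bar
  deriving DecidableEq, Fintype

/-- A natural number in binary. -/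
def encNat (k : ℕ) : List Symb := (Computability.encodeNat k).map Symb.bit

/-- A rational number as a reduced fraction with numerator and denominator in binary. -/
def encRat (q : ℚ) : List Symb :=
  (if q < 0 then [Symb.minus] else []) ++ encNat q.num.natAbs ++ [Symb.slash] ++ encNat q.den

/-- A binary vector. -/
def encVec {d : ℕ} (v : Fin d → Bool) : List Symb := (List.ofFn v).map Symb.bit

/-- A rational matrix, row by row. -/
def encMatrix {m n : ℕ} (X : Matrix (Fin m) (Fin n) ℚ) : List Symb :=
  (List.ofFn fun i =>
    (List.ofFn fun j => encRat (X i j) ++ [Symb.comma]).flatten ++ [Symb.semicolon]).flatten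

/-- An instance: the dataset, the existing subgroups, the threshold. -/
def encInstance (I : Instance) : List Symb :=
  encMatrix I.X ++ [Symb.bar] ++
  (List.ofFn fun l => encVec (I.b l) ++ [Symb.comma] ++ encVec (I.s l) ++ [Symb.semicolon]).flatten ++
  [Symb.bar] ++ encRat I.τ

/-- An instance with a cardinality threshold, the latter in binary. -/
def encCardInstance (I : CardInstance) : List Symb :=
  encInstance I.toInstance ++ [Symb.bar] ++ encNat I.k

/-- A bound. -/
def encBound : Bound → List Symb
  | .negInf => [Symb.minus, Symb.infty]
  | .rat q => encRat q
  | .posInf => [Symb.infty]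

/-- An answer, feature by feature; `none` is a single reserved symbol. -/
def encAnswer {n : ℕ} : Answer n → List Symb
  | none => [Symb.bar]
  | some (lb, ub) =>
      (List.ofFn fun j =>
        encBound (lb j) ++ [Symb.comma] ++ encBound (ub j) ++ [Symb.semicolon]).flatten

/-! ### Measures that can be handled in polynomial time -/

/-- A question to a similarity measure: is `b` at most as similar to `b₀` as `b'` is? -/
structure SimQuery where
  d : ℕ
  b : Fin d → Bool
  b' : Fin d → Bool
  b₀ : Fin d → Bool

/-- The encoding of a question to a similarity measure. -/
def encSimQuery (Q : SimQuery) : List Symb :=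
  encVec Q.b ++ [Symb.comma] ++ encVec Q.b' ++ [Symb.comma] ++ encVec Q.b₀

/-- A question to a dissimilarity measure: is the dissimilarity of `s` to `s'` at least `τ`? -/
structure DisQuery where
  d : ℕ
  s : Fin d → Bool
  s' : Fin d → Bool
  τ : ℚ
  τ_nonneg : 0 ≤ τ

/-- The encoding of a question to a dissimilarity measure. -/
def encDisQuery (Q : DisQuery) : List Symb :=
  encVec Q.s ++ [Symb.comma] ++ encVec Q.s' ++ [Symb.comma] ++ encRat Q.τ

open Classical in
/-- Values of the measure with the same second argument can be compared by a Turing machine in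
polynomial time (weaker than: rational values can be computed in polynomial time). -/
def PolyTimeComparable (sim : VectorMeasure) : Prop :=
  Nonempty (Turing.TM2ComputableInPolyTime encSimQuery Computability.encodeBool
    fun Q => decide (sim Q.d Q.b Q.b₀ ≤ sim Q.d Q.b' Q.b₀))

open Classical in
/-- Values of the measure can be compared with rational thresholds by a Turing machine in
polynomial time (weaker than: rational values can be computed in polynomial time). -/
def PolyTimeThreshold (dis : VectorMeasure) : Prop :=
  Nonempty (Turing.TM2ComputableInPolyTime encDisQuery Computability.encodeBool
    fun Q => decide ((Q.τ : ℝ) ≤ dis Q.d Q.s Q.s'))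

/-! ### Parameterized search problems and the class XP -/

/-- A parameterized search problem, with encodings of instances and answers as strings. -/
structure ParamSearchProblem where
  Inst : Type
  Ans : Inst → Type
  Correct : ∀ I, Ans I → Prop
  encInst : Inst → List Symb
  encAns : ∀ I, Ans I → List Symb
  param : Inst → ℕ

/-- Membership in XP: one Turing machine outputs, on every instance `I` with parameter `p` and
encoding length `N`, a correct answer within `f(p) * N ^ g(p)` steps, with polynomials `f`, `g`
(in particular, `f` and `g` are computable). -/
def ParamSearchProblem.InXP (P : ParamSearchProblem) : Prop :=
  ∃ (M : Turing.TM2ComputableAux Symb Symb) (f g : Polynomial ℕ), ∀ I : P.Inst,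
    ∃ A : P.Ans I, P.Correct I A ∧
      Nonempty (Turing.TM2OutputsInTime M.tm
        ((P.encInst I).map M.inputAlphabet.symm)
        (some ((P.encAns I A).map M.outputAlphabet.symm))
        (f.eval (P.param I) * (P.encInst I).length ^ (g.eval (P.param I))))

/-- Alternative-subgroup-description discovery, with parameter `n`. -/
noncomputable def alternativeDiscovery (sim dis : VectorMeasure) : ParamSearchProblem where
  Inst := Instance
  Ans I := Answer I.n
  Correct I := IsOptimal (IsDissimilar dis I.data I.s I.τ) (similarity sim I.data I.original)
  encInst := encInstance
  encAns _ := encAnswer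
  param I := I.n

/-- Alternative-subgroup-description discovery with a feature-cardinality constraint, with
parameter `k`. -/
noncomputable def alternativeDiscoveryCard (sim dis : VectorMeasure) : ParamSearchProblem where
  Inst := CardInstance
  Ans I := Answer I.n
  Correct I :=
    IsOptimal
      (fun lb ub => IsDissimilar dis I.data I.s I.τ lb ub ∧ featureCardinality I.data lb ub ≤ I.k)
      (similarity sim I.data I.original)
  encInst := encCardInstance
  encAns _ := encAnswer
  param I := I.k

end SubgroupDiscovery

/-!
# Alternative subgroup descriptions can be found by an XP algorithm

A subgroup matters only through its membership and feature-selection vectors, and these depend on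
the bounds of a feature only through the set of data objects that the bounds admit. Every such set
is obtained from bounds that are infinite or occur in the column of the feature (`exists_entry`), so
that there are polynomially many relevant pairs of bounds per feature. With at most `k` selected
features, exhaustive search has to look at no more than `(1 + n * T) ^ k` candidates, where `T`
bounds the number of pairs per feature (`length_candidates_le`); without a cardinality constraint
one may take `k = n`, and a threshold `k > n` may be replaced by `n`. The candidates are generated
feature by feature. A candidate records how many features may still be selected, and a column
multiplies the candidates accordingly (`extend`); nontrivial entries of a column are only tried as
long as this budget is not used up. `exists_isOptimal` shows that a best feasible candidate is a
correct answer.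

The larger part of the work is to run this search on a Turing machine of the required kind, with
many stacks and finitely many control states.

* `Prog` is a small structured programming language for stacks, with a cost semantics `Runs`.
  Programs are compiled to machines, and the cost bounds the number of steps
  (`Runs.outputsInTime`).
* The machines that answer questions about the measures are embedded as subroutines: their stacks
  become additional stacks, and their control state is kept on a stack of its own between steps
  (`runsIn_callOracle`).
* Data are binary trees with symbols at the leaves, and a program works on the topmost tree of the
  main stack. `PolyF O f` says that `f` is computed by such a program in polynomial time. These
  functions are closed under composition, pairing, case distinction and left folds with polynomially
  bounded states, which suffices for parsing, for the comparison of fractions by multiplication of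
  binary numbers, and for the evaluation of candidates.
* The generation of the candidates is the only fold whose states are not polynomially bounded. Their
  sizes are at most `N ^ (c * (k + 1))` (`sz_candidates_le`), and this gives the XP bound
  (`exists_machine`).
-/

namespace SubgroupDiscovery

open Turing

/-! ### A structured programming language for stack machines -/

section Language

variable {K : Type} {Γ : K → Type} {B : Type}

/-- Structured programs over stacks with alphabets `Γ k`. All branching is on values in a type `B`,
which is finite in the applications, so that programs become finite control even if some stack
alphabet is infinite. -/
inductive Prog (Γ : K → Type) (B : Type) : Type
  /-- Do nothing. -/
  | skip
  /-- Push the symbol `a` on stack `k`. -/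
  | push (k : K) (a : Γ k)
  /-- Branch on what `g` reads off the top of stack `k`, without changing the stack. -/
  | peek (k : K) (g : Option (Γ k) → B) (f : B → Prog Γ B)
  /-- Pop stack `k` and branch on what `g` reads off the result. -/
  | pop (k : K) (g : Option (Γ k) → B) (f : B → Prog Γ B)
  /-- Sequential composition. -/
  | seq (p q : Prog Γ B)
  /-- Pop stack `k`; stop if `g` says `none`, otherwise run the body and repeat. -/
  | loop (k : K) (g : Option (Γ k) → Option B) (f : B → Prog Γ B)

variable [DecidableEq K]

/-- Big-step semantics: `Runs p S t S'` if `p` turns the stacks `S` into `S'` with cost `t`. -/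
inductive Runs : Prog Γ B → (∀ k, List (Γ k)) → ℕ → (∀ k, List (Γ k)) → Prop
  | skip (S) : Runs .skip S 0 S
  | push (k a S) : Runs (.push k a) S 1 (Function.update S k (a :: S k))
  | peek (k g f S t S') : Runs (f (g (S k).head?)) S t S' → Runs (.peek k g f) S (t + 1) S'
  | pop (k g f S t S') :
      Runs (f (g (S k).head?)) (Function.update S k (S k).tail) t S' →
      Runs (.pop k g f) S (t + 1) S'
  | seq (p q S t S₁ t' S₂) : Runs p S t S₁ → Runs q S₁ t' S₂ → Runs (.seq p q) S (t + t') S₂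
  | loop_exit (k g f S) : g (S k).head? = none →
      Runs (.loop k g f) S 2 (Function.update S k (S k).tail)
  | loop_step (k g f S b t S₁ t' S₂) : g (S k).head? = some b →
      Runs (f b) (Function.update S k (S k).tail) t S₁ → Runs (.loop k g f) S₁ t' S₂ →
      Runs (.loop k g f) S (t + t' + 2) S₂

theorem Runs.length_le {p : Prog Γ B} {S S' : ∀ k, List (Γ k)} {t : ℕ} (h : Runs p S t S')
    (k : K) : (S' k).length ≤ (S k).length + t := by
  have upd : ∀ (S : ∀ k, List (Γ k)) (k' : K),
      (Function.update S k' (S k').tail k).length ≤ (S k).length := by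
    intro S k'
    by_cases hk : k = k'
    · subst hk; simp
    · simp [hk]
  induction h with
  | skip S => simp
  | push k' a S =>
    by_cases hk : k = k'
    · subst hk; simp
    · simp [hk]
  | peek k' g f S t S' _ ih => omega
  | pop k' g f S t S' _ ih => have := upd S k'; omega
  | seq p q S t S₁ t' S₂ _ _ ih₁ ih₂ => omega
  | loop_exit k' g f S _ => have := upd S k'; omega
  | loop_step k' g f S b t S₁ t' S₂ _ _ _ ih₁ ih₂ => have := upd S k'; omega

/-! ### Translation of structured programs into machines -/

/-- The labels needed for the translation of a program. A loop has an entry label `inl false` and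
an exit label `inl true`; the body of each branch has an entry label `⟨b, none⟩`. -/
def Prog.Lab : Prog Γ B → Type
  | .skip => Empty
  | .push _ _ => Empty
  | .peek _ _ f => Σ b, Option (f b).Lab
  | .pop _ _ f => Σ b, Option (f b).Lab
  | .seq p q => p.Lab ⊕ q.Lab
  | .loop _ _ f => Bool ⊕ Σ b, Option (f b).Lab

instance Prog.finite_lab [Finite B] (p : Prog Γ B) : Finite p.Lab := by
  induction p with
  | skip => exact inferInstanceAs (Finite Empty)
  | push => exact inferInstanceAs (Finite Empty)
  | peek k g f ih => exact inferInstanceAs (Finite (Σ b, Option (f b).Lab))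
  | pop k g f ih => exact inferInstanceAs (Finite (Σ b, Option (f b).Lab))
  | seq p q ihp ihq => exact inferInstanceAs (Finite (p.Lab ⊕ q.Lab))
  | loop k g f ih => exact inferInstanceAs (Finite (Bool ⊕ Σ b, Option (f b).Lab))

variable [Inhabited B] {Λ : Type}

/-- The statement that starts the execution of `p` and continues with `q`. The labels of `p` are
renamed by `e`. The local variable of the machine holds the last value read from a stack. -/
def Prog.comp : (p : Prog Γ B) → (p.Lab → Λ) → TM2.Stmt Γ Λ (Option B) → TM2.Stmt Γ Λ (Option B)
  | .skip, _, q => q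
  | .push k a, _, q => .push k (fun _ => a) q
  | .peek k g _, e, _ => .peek k (fun _ x => some (g x)) (.goto fun v => e ⟨v.getD default, none⟩)
  | .pop k g _, e, _ => .pop k (fun _ x => some (g x)) (.goto fun v => e ⟨v.getD default, none⟩)
  | .seq p r, e, q => p.comp (fun l => e (.inl l)) (r.comp (fun l => e (.inr l)) q)
  | .loop _ _ _, e, _ => .goto fun _ => e (.inl false)

/-- The statements at the labels of `p`, if `p` is to be followed by `q`. -/
def Prog.code : (p : Prog Γ B) → (p.Lab → Λ) → TM2.Stmt Γ Λ (Option B) → p.Lab →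
    TM2.Stmt Γ Λ (Option B)
  | .skip, _, _, l => nomatch l
  | .push _ _, _, _, l => nomatch l
  | .peek _ _ f, e, q, ⟨b, none⟩ => (f b).comp (fun l => e ⟨b, some l⟩) q
  | .peek _ _ f, e, q, ⟨b, some l⟩ => (f b).code (fun l => e ⟨b, some l⟩) q l
  | .pop _ _ f, e, q, ⟨b, none⟩ => (f b).comp (fun l => e ⟨b, some l⟩) q
  | .pop _ _ f, e, q, ⟨b, some l⟩ => (f b).code (fun l => e ⟨b, some l⟩) q l
  | .seq p r, e, q, .inl l => p.code (fun l => e (.inl l)) (r.comp (fun l => e (.inr l)) q) l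
  | .seq _ r, e, q, .inr l => r.code (fun l => e (.inr l)) q l
  | .loop k g _, e, _, .inl false =>
      .pop k (fun _ x => g x)
        (.goto fun v => v.elim (e (.inl true)) fun b => e (.inr ⟨b, none⟩))
  | .loop _ _ _, _, q, .inl true => q
  | .loop _ _ f, e, _, .inr ⟨b, none⟩ =>
      (f b).comp (fun l => e (.inr ⟨b, some l⟩)) (.goto fun _ => e (.inl false))
  | .loop _ _ f, e, _, .inr ⟨b, some l⟩ =>
      (f b).code (fun l => e (.inr ⟨b, some l⟩)) (.goto fun _ => e (.inl false)) l

/-- The machine with program `M` gets from `c` to `c'` in at most `t` steps. -/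
def ReachesIn {σ : Type} (M : Λ → TM2.Stmt Γ Λ σ) (t : ℕ) (c c' : TM2.Cfg Γ Λ σ) : Prop :=
  ∃ n ≤ t, (flip bind (TM2.step M))^[n] (some c) = some c'

theorem ReachesIn.refl {σ : Type} (M : Λ → TM2.Stmt Γ Λ σ) (t : ℕ) (c : TM2.Cfg Γ Λ σ) :
    ReachesIn M t c c := ⟨0, Nat.zero_le _, rfl⟩

theorem ReachesIn.trans {σ : Type} {M : Λ → TM2.Stmt Γ Λ σ} {t t' : ℕ} {c c' c'' : TM2.Cfg Γ Λ σ}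
    (h : ReachesIn M t c c') (h' : ReachesIn M t' c' c'') : ReachesIn M (t + t') c c'' := by
  obtain ⟨n, hn, h⟩ := h
  obtain ⟨n', hn', h'⟩ := h'
  exact ⟨n' + n, by omega, by rw [Function.iterate_add_apply, h, h']⟩

theorem ReachesIn.step {σ : Type} {M : Λ → TM2.Stmt Γ Λ σ} {l : Λ} {s : TM2.Stmt Γ Λ σ}
    (h : M l = s) (v : σ) (S) : ReachesIn M 1 ⟨some l, v, S⟩ (TM2.stepAux s v S) :=
  ⟨1, le_rfl, h ▸ rfl⟩

theorem ReachesIn.mono {σ : Type} {M : Λ → TM2.Stmt Γ Λ σ} {t t' : ℕ} {c c' : TM2.Cfg Γ Λ σ}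
    (h : ReachesIn M t c c') (ht : t ≤ t') : ReachesIn M t' c c' := by
  obtain ⟨n, hn, h⟩ := h
  exact ⟨n, hn.trans ht, h⟩

/-- Correctness of the translation: if `M` has the code of `p` at the labels of `p`, then it
simulates `p` with at most as many steps as the cost of `p`. -/
theorem Runs.reachesIn {p : Prog Γ B} {S S' : ∀ k, List (Γ k)} {t : ℕ} (h : Runs p S t S')
    {M : Λ → TM2.Stmt Γ Λ (Option B)} (e : p.Lab → Λ) (q : TM2.Stmt Γ Λ (Option B))
    (hM : ∀ l, M (e l) = p.code e q l) (v : Option B) :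
    ∃ v', ReachesIn M t (TM2.stepAux (p.comp e q) v S) (TM2.stepAux q v' S') := by
  induction h generalizing q v with
  | skip S => exact ⟨v, .refl _ _ _⟩
  | push k a S => exact ⟨v, .refl _ _ _⟩
  | peek k g f S t S' _ ih =>
    obtain ⟨v', hv'⟩ := ih (fun l => e ⟨_, some l⟩) q (fun l => hM ⟨_, some l⟩)
      (some (g (S k).head?))
    exact ⟨v', ReachesIn.mono (ReachesIn.trans (t := 1)
      (ReachesIn.step (hM ⟨g (S k).head?, none⟩) _ _) hv') (by omega)⟩
  | pop k g f S t S' _ ih =>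
    obtain ⟨v', hv'⟩ := ih (fun l => e ⟨_, some l⟩) q (fun l => hM ⟨_, some l⟩)
      (some (g (S k).head?))
    exact ⟨v', ReachesIn.mono (ReachesIn.trans (t := 1)
      (ReachesIn.step (hM ⟨g (S k).head?, none⟩) _ _) hv') (by omega)⟩
  | seq p r S t S₁ t' S₂ _ _ ih₁ ih₂ =>
    obtain ⟨v₁, h₁⟩ := ih₁ (fun l => e (.inl l)) (r.comp (fun l => e (.inr l)) q)
      (fun l => hM (.inl l)) v
    obtain ⟨v₂, h₂⟩ := ih₂ (fun l => e (.inr l)) q (fun l => hM (.inr l)) v₁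
    exact ⟨v₂, h₁.trans h₂⟩
  | loop_exit k g f S hg =>
    refine ⟨none, ReachesIn.trans (t := 1) (t' := 1)
      (c' := ⟨some (e (.inl true)), none, Function.update S k (S k).tail⟩) ?_
      (ReachesIn.step (hM (.inl true)) _ _)⟩
    have := ReachesIn.step (hM (.inl false)) v S
    simp only [Prog.code, TM2.stepAux, hg, Option.elim] at this
    exact this
  | loop_step k g f S b t S₁ t' S₂ hg _ _ ih₁ ih₂ =>
    obtain ⟨v₁, h₁⟩ := ih₁ (fun l => e (.inr ⟨b, some l⟩)) (.goto fun _ => e (.inl false))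
      (fun l => hM (.inr ⟨b, some l⟩)) (some b)
    obtain ⟨v₂, h₂⟩ := ih₂ e q hM v₁
    refine ⟨v₂, ReachesIn.mono (t := 1 + (1 + (t + t'))) (ReachesIn.trans
      (c' := ⟨some (e (.inr ⟨b, none⟩)), some b, Function.update S k (S k).tail⟩) ?_
      (ReachesIn.trans (ReachesIn.step (hM (.inr ⟨b, none⟩)) _ _) (h₁.trans h₂))) (by omega)⟩
    have := ReachesIn.step (hM (.inl false)) v S
    simp only [Prog.code, TM2.stepAux, hg, Option.elim] at this
    exact this

/-- The machine that executes a program; both input and output are on stack `k₀`. -/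
noncomputable def Prog.toFinTM2 [Fintype K] [Fintype B] (p : Prog Γ B) (k₀ : K)
    [Fintype (Γ k₀)] : FinTM2 :=
  letI : Fintype p.Lab := Fintype.ofFinite _
  { K := K
    k₀ := k₀
    k₁ := k₀
    Γ := Γ
    Λ := Option p.Lab
    main := none
    σ := Option B
    initialState := none
    m := fun
      | none => p.comp some (.load (fun _ => none) .halt)
      | some l => p.code some (.load (fun _ => none) .halt) l }

theorem Runs.outputsInTime [Fintype K] [Fintype B] {p : Prog Γ B} {k₀ : K}
    [Fintype (Γ k₀)] {x y : List (Γ k₀)} {t T : ℕ}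
    (h : Runs p (Function.update (fun _ => []) k₀ x) t (Function.update (fun _ => []) k₀ y))
    (hT : t + 1 ≤ T) :
    Nonempty (TM2OutputsInTime (p.toFinTM2 k₀) x (some y) T) := by
  obtain ⟨v, n, hn, hv⟩ := h.reachesIn (M := (p.toFinTM2 k₀).m) some
    (.load (fun _ => none) .halt) (fun l => rfl) none
  have key : ∀ z : List (Γ k₀), (fun k => @dite (List (Γ k)) (k = k₀) (inferInstance)
      (fun h => by rw [h]; exact z) fun _ => []) = Function.update (fun _ => []) k₀ z := by
    intro z
    funext k
    by_cases hk : k = k₀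
    · subst hk; simp
    · simp [hk]
  refine ⟨⟨⟨n + 1, ?_⟩, (show n + 1 ≤ T by omega)⟩⟩
  have h0 : initList (p.toFinTM2 k₀) x =
      ⟨some none, none, Function.update (fun _ => []) k₀ x⟩ :=
    congrArg (TM2.Cfg.mk (some none) none) (key x)
  have h1 : haltList (p.toFinTM2 k₀) y = ⟨none, none, Function.update (fun _ => []) k₀ y⟩ :=
    congrArg (TM2.Cfg.mk none none) (key y)
  change (flip bind (TM2.step (p.toFinTM2 k₀).m))^[n + 1] (some (initList (p.toFinTM2 k₀) x)) =
    some (haltList (p.toFinTM2 k₀) y)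
  rw [Function.iterate_succ_apply]
  refine Eq.trans (congrArg (fun c => (flip bind (TM2.step (p.toFinTM2 k₀).m))^[n]
    (flip bind (TM2.step (p.toFinTM2 k₀).m) (some c))) h0) (hv.trans (congrArg some h1.symm))

end Language

/-! ### Trees on stacks -/

/-- Binary trees with symbols at the leaves: the data type of the computations below. -/
inductive Tree where
  | leaf (s : Symb)
  | node (l r : Tree)

/-- A token of a serialized tree: `none` starts an inner node, `some s` is a leaf. -/
abbrev Tok : Type := Option Symb

/-- The serialization of a tree in prefix notation. -/
def Tree.code : Tree → List Tok
  | .leaf s => [some s]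
  | .node l r => none :: (l.code ++ r.code)

/-- The number of vertices of a tree. -/
def Tree.size : Tree → ℕ
  | .leaf _ => 1
  | .node l r => l.size + r.size + 1

@[simp] theorem Tree.length_code (x : Tree) : x.code.length = x.size := by
  induction x with
  | leaf s => rfl
  | node l r ihl ihr => simp [Tree.code, Tree.size, ihl, ihr]

theorem Tree.size_pos (x : Tree) : 0 < x.size := by cases x <;> simp [Tree.size]

/-- A string as a tree. -/
def strTree : List Symb → Tree
  | [] => .leaf .semicolon
  | s :: l => .node (.leaf s) (strTree l)

theorem size_strTree (l : List Symb) : (strTree l).size = 2 * l.length + 1 := by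
  induction l with
  | nil => rfl
  | cons s l ih => simp [strTree, Tree.size, ih]; omega

/-- The work stacks. -/
inductive Work where
  | main
  | a
  | b
  | c
  deriving DecidableEq

instance : Fintype Work := ⟨{.main, .a, .b, .c}, fun k => by cases k <;> simp⟩

/-- Two machines that answer yes/no questions, to be used as subroutines. -/
structure Oracles where
  /-- The machines. -/
  ask : Bool → TM2ComputableAux Symb Bool

section Machine

variable (O : Oracles)

/-- The stacks of a machine with two oracle machines as subroutines: the work stacks, the
input/output stack, a stack for the control state of each oracle machine, and the stacks of the
oracle machines. -/
abbrev Stack : Type := Work ⊕ (Unit ⊕ (Bool ⊕ Σ o, (O.ask o).tm.K))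

/-- The stack alphabets. -/
abbrev Alphabet : Stack O → Type
  | .inl _ => Tok
  | .inr (.inl _) => Symb
  | .inr (.inr (.inl o)) => (O.ask o).tm.Λ × (O.ask o).tm.σ
  | .inr (.inr (.inr ⟨o, k⟩)) => (O.ask o).tm.Γ k

/-- The values on which a program can branch: a token (if the stack is not empty), or the control
state of an oracle machine. -/
abbrev Branch : Type := Option Tok ⊕ Σ o, Option (O.ask o).tm.Λ × (O.ask o).tm.σ

/-- Programs with oracles. -/
abbrev OProg : Type := Prog (Alphabet O) (Branch O)

noncomputable instance : Fintype (Stack O) :=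
  haveI : ∀ o, Fintype (O.ask o).tm.K := fun o => (O.ask o).tm.kFin
  inferInstance

noncomputable instance : Fintype (Branch O) :=
  haveI : ∀ o, Fintype (O.ask o).tm.Λ := fun o => (O.ask o).tm.ΛFin
  haveI : ∀ o, Fintype (O.ask o).tm.σ := fun o => (O.ask o).tm.σFin
  inferInstance

instance : Inhabited (Branch O) := ⟨.inl none⟩

instance : Fintype (Alphabet O (.inr (.inl ()))) := inferInstanceAs (Fintype Symb)

variable {O}

/-- The contents of all stacks, given by kind of stack. -/
def st (w : Work → List Tok) (i : List Symb) (C : ∀ o, List ((O.ask o).tm.Λ × (O.ask o).tm.σ))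
    (S : ∀ o k, List ((O.ask o).tm.Γ k)) : ∀ k : Stack O, List (Alphabet O k)
  | .inl k => w k
  | .inr (.inl _) => i
  | .inr (.inr (.inl o)) => C o
  | .inr (.inr (.inr ⟨o, k⟩)) => S o k

section Update

variable (w : Work → List Tok) (i : List Symb) (C : ∀ o, List ((O.ask o).tm.Λ × (O.ask o).tm.σ))
    (S : ∀ o k, List ((O.ask o).tm.Γ k))

theorem update_st_work (k : Work) (x : List Tok) :
    Function.update (st w i C S) (.inl k) x = st (Function.update w k x) i C S := by
  funext k'
  rcases k' with k' | k' | k' | ⟨o, k'⟩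
  · by_cases h : k' = k
    · subst h; simp [st]
    · simp [st, h]
  all_goals simp [st]

theorem update_st_io (x : List Symb) :
    Function.update (st w i C S) (.inr (.inl ())) x = st w x C S := by
  funext k'
  rcases k' with k' | k' | k' | ⟨o, k'⟩ <;> simp [st]

theorem update_st_ctl (o : Bool) (x : List ((O.ask o).tm.Λ × (O.ask o).tm.σ)) :
    Function.update (st w i C S) (.inr (.inr (.inl o))) x =
      st w i (Function.update C o x) S := by
  funext k'
  rcases k' with k' | k' | k' | ⟨o, k'⟩
  · simp [st]
  · simp [st]
  · by_cases h : k' = o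
    · subst h; simp [st]
    · simp [st, h]
  · simp [st]

theorem update_st_oracle (o : Bool) (k : (O.ask o).tm.K) (x : List ((O.ask o).tm.Γ k)) :
    Function.update (st w i C S) (.inr (.inr (.inr ⟨o, k⟩))) x =
      st w i C (Function.update S o (Function.update (S o) k x)) := by
  funext k'
  rcases k' with k' | k' | k' | ⟨o', k'⟩
  · simp [st]
  · simp [st]
  · simp [st]
  · by_cases h : o' = o
    · subst h
      by_cases h' : k' = k
      · subst h'; simp [st]
      · simp [st, h']
    · have : (⟨o', k'⟩ : Σ o, (O.ask o).tm.K) ≠ ⟨o, k⟩ := fun hh => h (congrArg Sigma.fst hh)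
      simp [st, h, this]

end Update

/-- The contents of the work stacks, as a list of lists. -/
def wk (m a b c : List Tok) : Work → List Tok
  | .main => m
  | .a => a
  | .b => b
  | .c => c

@[simp] theorem update_wk_main (m a b c x) :
    Function.update (wk m a b c) .main x = wk x a b c := by
  funext k; cases k <;> simp [wk]
@[simp] theorem update_wk_a (m a b c x) :
    Function.update (wk m a b c) .a x = wk m x b c := by
  funext k; cases k <;> simp [wk]
@[simp] theorem update_wk_b (m a b c x) :
    Function.update (wk m a b c) .b x = wk m a x c := by
  funext k; cases k <;> simp [wk]
@[simp] theorem update_wk_c (m a b c x) :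
    Function.update (wk m a b c) .c x = wk m a b x := by
  funext k; cases k <;> simp [wk]

/-- `p` leads from `S` to `S'` with cost at most `T`. -/
def RunsIn (p : OProg O) (S : ∀ k, List (Alphabet O k)) (T : ℕ)
    (S' : ∀ k, List (Alphabet O k)) : Prop :=
  ∃ t ≤ T, Runs p S t S'

theorem RunsIn.mono {p : OProg O} {S S' : ∀ k, List (Alphabet O k)} {T T' : ℕ}
    (h : RunsIn p S T S') (hT : T ≤ T') : RunsIn p S T' S' :=
  let ⟨t, ht, h⟩ := h; ⟨t, ht.trans hT, h⟩

theorem RunsIn.seq {p q : OProg O} {S S' S'' : ∀ k, List (Alphabet O k)} {T T' : ℕ}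
    (h : RunsIn p S T S') (h' : RunsIn q S' T' S'') : RunsIn (.seq p q) S (T + T') S'' :=
  let ⟨_, ht, h⟩ := h
  let ⟨_, ht', h'⟩ := h'
  ⟨_, Nat.add_le_add ht ht', .seq _ _ _ _ _ _ _ h h'⟩

theorem RunsIn.skip (S : ∀ k, List (Alphabet O k)) : RunsIn .skip S 0 S := ⟨0, le_rfl, .skip _⟩

/-- Push on a work stack. -/
def pushW (k : Work) (x : Tok) : OProg O := .push (.inl k) x

/-- Pop a work stack and branch on the token. -/
def popW (k : Work) (f : Option Tok → OProg O) : OProg O :=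
  .pop (.inl k) (fun x => .inl x) fun
    | .inl x => f x
    | .inr _ => .skip

/-- Pop a work stack and repeat as long as the token satisfies `p`. -/
def loopW (k : Work) (p : Tok → Bool) (f : Tok → OProg O) : OProg O :=
  .loop (.inl k) (fun x => x.bind fun y => if p y then some (.inl (some y)) else none) fun
    | .inl (some x) => f x
    | _ => .skip

section Commands

variable {w : Work → List Tok} {i : List Symb} {C : ∀ o, List ((O.ask o).tm.Λ × (O.ask o).tm.σ)}
    {S : ∀ o k, List ((O.ask o).tm.Γ k)} {S' S'' : ∀ k, List (Alphabet O k)} {T T' : ℕ}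

theorem runsIn_pushW (k : Work) (x : Tok) :
    RunsIn (pushW k x) (st w i C S) 1 (st (Function.update w k (x :: w k)) i C S) :=
  ⟨1, le_rfl, by rw [← update_st_work]; exact .push _ _ _⟩

theorem runsIn_popW {k : Work} {f : Option Tok → OProg O}
    (h : RunsIn (f (w k).head?) (st (Function.update w k (w k).tail) i C S) T S') :
    RunsIn (popW k f) (st w i C S) (T + 1) S' := by
  obtain ⟨t, ht, h⟩ := h
  rw [← update_st_work] at h
  exact ⟨t + 1, by omega, .pop _ _ _ _ _ _ h⟩

theorem runsIn_loopW_nil {k : Work} {p : Tok → Bool} {f : Tok → OProg O} (hk : w k = []) :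
    RunsIn (loopW k p f) (st w i C S) 2 (st w i C S) := by
  refine ⟨2, le_rfl, ?_⟩
  have : Runs (loopW k p f) (st w i C S) 2 _ :=
    .loop_exit _ _ _ _ (by simp [st, hk])
  rw [update_st_work] at this
  convert this using 2
  simp only [st, hk, List.tail_nil]
  rw [← hk, Function.update_eq_self]

theorem runsIn_loopW_exit {k : Work} {p : Tok → Bool} {f : Tok → OProg O} {x : Tok} {l : List Tok}
    (hk : w k = x :: l) (hx : p x = false) :
    RunsIn (loopW k p f) (st w i C S) 2 (st (Function.update w k l) i C S) := by
  refine ⟨2, le_rfl, ?_⟩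
  have : Runs (loopW k p f) (st w i C S) 2 _ :=
    .loop_exit _ _ _ _ (by simp [st, hk, hx])
  rw [update_st_work] at this
  convert this using 3
  simp [st, hk]

theorem runsIn_loopW_step {k : Work} {p : Tok → Bool} {f : Tok → OProg O} {x : Tok} {l : List Tok}
    (hk : w k = x :: l) (hx : p x = true)
    (h : RunsIn (f x) (st (Function.update w k l) i C S) T S')
    (h' : RunsIn (loopW k p f) S' T' S'') :
    RunsIn (loopW k p f) (st w i C S) (T + T' + 2) S'' := by
  obtain ⟨t, ht, h⟩ := h
  obtain ⟨t', ht', h'⟩ := h'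
  refine ⟨t + t' + 2, by omega, ?_⟩
  refine Runs.loop_step (Sum.inl k) _ _ (st w i C S) (.inl (some x)) t S' t' S'' ?_ ?_ h'
  · simp [st, hk, hx]
  · rw [update_st_work]
    convert h using 3
    simp [st, hk]

end Commands

end Machine

/-! ### Basic operations on trees -/

section TreeOps

variable {O : Oracles}

/-- The stacks if the oracle machines are idle: work stacks `w` and input/output stack `x`. -/
abbrev ws (O : Oracles) (w : Work → List Tok) (x : List Symb) :
    ∀ k, List (Alphabet O k) :=
  st w x (fun _ => []) (fun _ _ => [])

/-- The stacks between two operations on trees: everything is empty except for the main stack. -/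
def ms (O : Oracles) (l : List Tok) : ∀ k, List (Alphabet O k) :=
  ws O (wk l [] [] []) []

/-- Move everything from stack `k` to stack `k'`, reversing the order. -/
def moveW (k k' : Work) : OProg O := loopW k (fun _ => true) fun x => pushW k' x

theorem runsIn_moveW {k k' : Work} (hk : k ≠ k') (l : List Tok) {w : Work → List Tok}
    (hw : w k = l) (i : List Symb) (C : ∀ o, List ((O.ask o).tm.Λ × (O.ask o).tm.σ))
    (S : ∀ o k, List ((O.ask o).tm.Γ k)) :
    RunsIn (moveW k k') (st w i C S) (3 * l.length + 2)
      (st (Function.update (Function.update w k []) k' (l.reverse ++ w k')) i C S) := by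
  induction l generalizing w with
  | nil =>
    have h : RunsIn (moveW k k') _ _ _ :=
      runsIn_loopW_nil (O := O) (w := w) (i := i) (C := C) (S := S) hw
    refine RunsIn.mono (T := 2) ?_ (by simp)
    convert h using 2
    funext j
    by_cases h1 : j = k'
    · subst h1; simp
    · by_cases h2 : j = k
      · subst h2; simp [h1, hw]
      · simp [h1, h2]
  | cons x l ih =>
    have h1 := ih (w := Function.update (Function.update w k l) k' (x :: w k')) (by simp [hk])
    have h2 := runsIn_pushW (O := O) (w := Function.update w k l) (i := i) (C := C) (S := S) k' x
    rw [Function.update_of_ne hk.symm] at h2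
    have h : RunsIn (moveW k k') _ _ _ := runsIn_loopW_step hw rfl h2 h1
    refine RunsIn.mono (T := 1 + (3 * l.length + 2) + 2) ?_ (by simp; omega)
    convert h using 2
    funext j
    by_cases h1 : j = k'
    · subst h1; simp
    · by_cases h2 : j = k
      · subst h2; simp [hk]
      · simp [h1, h2]

/-- The body of the loop that moves a tree from the main stack to stack `a`, one token at a time.
Stack `c` counts the subtrees that are still to be moved. -/
def takeLoop : OProg O := loopW .c (fun _ => true) fun _ => popW .main fun
  | some none => .seq (pushW .a none) (.seq (pushW .c none) (pushW .c none))
  | some (some s) => pushW .a (some s)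
  | none => .skip

/-- Move a tree from the main stack to stack `a`. -/
def takeTree : OProg O := .seq (pushW .c none) takeLoop

variable (i : List Symb) (C : ∀ o, List ((O.ask o).tm.Λ × (O.ask o).tm.σ))
  (S : ∀ o k, List ((O.ask o).tm.Γ k))

/-- With a `none` on the counter stack, the loop moves one complete tree and goes on with the rest
of the counter. -/
theorem takeLoop_tree (x : Tree) {m a b c : List Tok} {T : ℕ} {S' : ∀ k, List (Alphabet O k)}
    (h : RunsIn takeLoop (st (wk m (x.code.reverse ++ a) b c) i C S) T S') :
    RunsIn takeLoop (st (wk (x.code ++ m) a b (none :: c)) i C S) (T + 6 * x.size) S' := by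
  induction x generalizing m a c T with
  | leaf s =>
    refine RunsIn.mono (runsIn_loopW_step (l := c) rfl rfl (T := 2) ?_ h)
      (by simp [Tree.size]; omega)
    rw [update_wk_c]
    refine runsIn_popW (T := 1) ?_
    have := runsIn_pushW (O := O) (w := wk m a b c) (i := i) (C := C) (S := S) .a (some s)
    simpa [wk, Tree.code] using this
  | node l r ihl ihr =>
    have h1 : RunsIn takeLoop (st (wk (r.code ++ m) (l.code.reverse ++ (none :: a)) b (none :: c))
        i C S) (T + 6 * r.size) S' := by
      refine ihr ?_
      simpa [Tree.code] using h
    have h2 := ihl h1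
    refine RunsIn.mono (runsIn_loopW_step (l := c) rfl rfl (T := 4) ?_ h2)
      (by simp [Tree.size]; omega)
    rw [update_wk_c]
    refine runsIn_popW (T := 3) ?_
    refine RunsIn.mono (RunsIn.seq (T := 1) (runsIn_pushW _ _)
      (RunsIn.seq (T := 1) (T' := 1) (runsIn_pushW _ _) ?_)) le_rfl
    have := runsIn_pushW (O := O) (w := wk (l.code ++ (r.code ++ m)) (none :: a) b (none :: c))
      (i := i) (C := C) (S := S) .c none
    simpa [wk, Tree.code] using this

theorem runsIn_takeTree (x : Tree) (m a b : List Tok) :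
    RunsIn takeTree (st (wk (x.code ++ m) a b []) i C S) (6 * x.size + 3)
      (st (wk m (x.code.reverse ++ a) b []) i C S) := by
  refine RunsIn.mono (RunsIn.seq (runsIn_pushW _ _) (T' := 2 + 6 * x.size) ?_) (by omega)
  rw [update_wk_c]
  exact takeLoop_tree i C S x (runsIn_loopW_nil rfl)

/-- Remove a tree from the main stack. -/
def dropTree : OProg O := .seq takeTree (loopW .a (fun _ => true) fun _ => .skip)

theorem runsIn_dropTree (x : Tree) (m : List Tok) :
    RunsIn dropTree (ms O (x.code ++ m)) (10 * x.size + 10) (ms O m) := by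
  have key : ∀ l : List Tok, RunsIn (loopW .a (fun _ => true) fun _ => .skip)
      (ws O (wk m l [] []) []) (2 * l.length + 2) (ms O m) := by
    intro l
    induction l with
    | nil => exact runsIn_loopW_nil rfl
    | cons y l ih =>
      refine RunsIn.mono (runsIn_loopW_step (l := l) rfl rfl (RunsIn.skip _) ?_
        (T' := 2 * l.length + 2)) (by simp; omega)
      rw [update_wk_a]
      exact ih
  refine RunsIn.mono (RunsIn.seq (runsIn_takeTree _ _ _ x m [] []) (key _)) ?_
  simp; omega

/-- Exchange the two topmost trees on the main stack. -/
def swapTrees : OProg O :=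
  .seq takeTree (.seq (moveW .a .b) (.seq takeTree (.seq (moveW .b .c)
    (.seq (moveW .c .main) (moveW .a .main)))))

theorem runsIn_swapTrees (x y : Tree) (m : List Tok) :
    RunsIn swapTrees (ms O (x.code ++ (y.code ++ m))) (20 * x.size + 20 * y.size + 20)
      (ms O (y.code ++ (x.code ++ m))) := by
  refine RunsIn.mono (RunsIn.seq (runsIn_takeTree _ _ _ x _ [] []) (RunsIn.seq
    (runsIn_moveW (by decide) _ rfl _ _ _) (RunsIn.seq (T := 6 * y.size + 3)
      (S' := ws O (wk m y.code.reverse x.code []) []) ?_ (RunsIn.seq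
    (runsIn_moveW (by decide) _ rfl _ _ _) (RunsIn.seq
    (S' := ws O (wk (x.code ++ m) y.code.reverse [] []) []) (T := 3 * x.size + 2) ?_
    (T' := 3 * y.size + 2) ?_))))) ?_
  · have := runsIn_takeTree (O := O) [] (fun _ => []) (fun _ _ => []) y m [] x.code
    simpa [wk] using this
  · have := runsIn_moveW (O := O) (k := .c) (k' := .main) (by decide) x.code.reverse
      (w := wk m y.code.reverse [] x.code.reverse) rfl [] (fun _ => []) (fun _ _ => [])
    simpa [wk] using this
  · have := runsIn_moveW (O := O) (k := .a) (k' := .main) (by decide) y.code.reverse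
      (w := wk (x.code ++ m) y.code.reverse [] []) rfl [] (fun _ => []) (fun _ _ => [])
    simpa [wk, ms] using this
  · simp [wk]; omega

/-- Duplicate the topmost tree on the main stack. -/
def dupTree : OProg O :=
  .seq takeTree (.seq (loopW .a (fun _ => true) fun x => .seq (pushW .main x) (pushW .b x))
    (.seq (moveW .b .a) (moveW .a .main)))

theorem runsIn_dupTree (x : Tree) (m : List Tok) :
    RunsIn dupTree (ms O (x.code ++ m)) (20 * x.size + 20)
      (ms O (x.code ++ (x.code ++ m))) := by
  have key : ∀ l m b : List Tok, RunsIn (loopW .a (fun _ => true)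
      fun x => .seq (pushW .main x) (pushW .b x))
      (ws O (wk m l b []) []) (4 * l.length + 2)
      (ws O (wk (l.reverse ++ m) [] (l.reverse ++ b) []) []) := by
    intro l
    induction l with
    | nil => intro m b; exact runsIn_loopW_nil rfl
    | cons y l ih =>
      intro m b
      refine RunsIn.mono (runsIn_loopW_step (l := l) rfl rfl
        (RunsIn.seq (runsIn_pushW _ _) (runsIn_pushW _ _)) (T' := 4 * l.length + 2) ?_)
        (by simp; omega)
      have := ih (y :: m) (y :: b)
      simpa [wk] using this
  refine RunsIn.mono (RunsIn.seq (runsIn_takeTree _ _ _ x _ [] []) (RunsIn.seq (key _ _ _)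
    (RunsIn.seq (runsIn_moveW (by decide) x.code (by simp [wk]) _ _ _)
      (T' := 3 * x.size + 2) ?_))) ?_
  · have := runsIn_moveW (O := O) (k := .a) (k' := .main) (by decide) x.code.reverse
      (w := wk (x.code ++ m) x.code.reverse [] []) rfl [] (fun _ => []) (fun _ _ => [])
    simpa [wk, ms] using this
  · simp; omega

/-- Push a fixed list of tokens on the main stack. -/
def pushAll : List Tok → OProg O
  | [] => .skip
  | x :: l => .seq (pushAll l) (pushW .main x)

theorem runsIn_pushAll (l m : List Tok) :
    RunsIn (pushAll l) (ms O m) l.length (ms O (l ++ m)) := by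
  induction l with
  | nil => exact RunsIn.skip _
  | cons x l ih =>
    refine RunsIn.seq ih ?_
    have := runsIn_pushW (O := O) (w := wk (l ++ m) [] [] []) (i := []) (C := (fun _ => []))
      (S := (fun _ _ => [])) .main x
    simpa [wk, ms] using this

theorem runsIn_pushMain (x : Tok) (m : List Tok) :
    RunsIn (pushW .main x) (ms O m) 1 (ms O (x :: m)) := by
  have := runsIn_pushW (O := O) (w := wk m [] [] []) (i := []) (C := (fun _ => []))
    (S := (fun _ _ => [])) .main x
  simpa [wk, ms] using this

theorem runsIn_popMain {f : Option Tok → OProg O} {x : Tok} {m : List Tok} {T : ℕ}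
    {S' : ∀ k, List (Alphabet O k)} (h : RunsIn (f (some x)) (ms O m) T S') :
    RunsIn (popW .main f) (ms O (x :: m)) (T + 1) S' :=
  runsIn_popW (by simpa [wk, ms] using h)

/-! ### Strings on stacks -/

/-- Move the string at the top of the main stack to stack `a`, reversing the order. -/
def unpackStr : OProg O := loopW .main (fun x => x.isNone) fun _ => popW .main fun
  | some x => pushW .a x
  | none => .skip

theorem runsIn_unpackStr (l : List Symb) (m a : List Tok) :
    RunsIn unpackStr (st (wk ((strTree l).code ++ m) a [] []) i C S) (4 * l.length + 2)
      (st (wk m ((l.map some).reverse ++ a) [] []) i C S) := by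
  induction l generalizing a with
  | nil =>
    have := runsIn_loopW_exit (O := O) (w := wk ((strTree []).code ++ m) a [] []) (i := i) (C := C)
      (S := S) (k := .main) (p := fun x => x.isNone) (x := some .semicolon) (l := m)
      (f := fun _ => popW .main fun
        | some x => pushW .a x
        | none => .skip) rfl rfl
    simpa [unpackStr] using this
  | cons s l ih =>
    refine RunsIn.mono (runsIn_loopW_step (x := none) (l := some s :: ((strTree l).code ++ m))
      (by simp [wk, strTree, Tree.code]) rfl
      (T := 2) (S' := st (wk ((strTree l).code ++ m) (some s :: a) [] []) i C S)
      (T' := 4 * l.length + 2) ?_ ?_) (by simp; omega)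
    · refine runsIn_popW (T := 1) ?_
      have := runsIn_pushW (O := O) (w := wk ((strTree l).code ++ m) a [] []) (i := i) (C := C)
        (S := S) .a (some s)
      simpa [wk] using this
    · have := ih (some s :: a)
      change RunsIn unpackStr _ _ _
      simpa using this

/-- Convert the string on the input/output stack into a tree on the main stack. -/
def readInput : OProg O :=
  .seq (.loop (.inr (.inl ())) (fun x => x.map fun s => .inl (some (some s))) fun
      | .inl (some x) => pushW .a x
      | _ => .skip)
    (.seq (pushW .main (some .semicolon))
      (loopW .a (fun _ => true) fun x => .seq (pushW .main x) (pushW .main none)))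

theorem runsIn_readInput (x : List Symb) :
    RunsIn (O := O) readInput (ws O (wk [] [] [] []) x)
      (8 * x.length + 5) (ms O (strTree x).code) := by
  have h1 : ∀ (x : List Symb) (a : List Tok), RunsIn (O := O)
      (.loop (.inr (.inl ())) (fun x => x.map fun s => .inl (some (some s))) fun
        | .inl (some x) => pushW .a x
        | _ => .skip) (ws O (wk [] a [] []) x) (3 * x.length + 2)
      (st (wk [] ((x.map some).reverse ++ a) [] []) [] (fun _ => []) (fun _ _ => [])) := by
    intro x
    induction x with
    | nil =>
      intro a
      refine ⟨2, by simp, ?_⟩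
      have := Runs.loop_exit (Γ := Alphabet O) (B := Branch O) (.inr (.inl ()))
        (fun x : Option Symb => x.map fun s => .inl (some (some s))) (fun
        | .inl (some x) => pushW .a x
        | _ => .skip) (ws O (wk [] a [] []) []) (by simp [st])
      rw [update_st_io] at this
      simpa [st] using this
    | cons s x ih =>
      intro a
      obtain ⟨t', ht', h'⟩ := ih (some s :: a)
      obtain ⟨t, ht, h⟩ := runsIn_pushW (O := O) (w := wk [] a [] []) (i := x) (C := (fun _ => []))
        (S := (fun _ _ => [])) .a (some s)
      refine ⟨t + t' + 2, by simp; omega, ?_⟩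
      refine Runs.loop_step _ _ _ _ (.inl (some (some s))) t (ws O (wk [] (some s :: a) [] []) x)
        t' _ ?_ ?_ ?_
      · simp [st]
      · rw [update_st_io]
        simpa [wk, st] using h
      · simpa using h'
  have h2 : ∀ (y z : List Symb), RunsIn (O := O)
      (loopW .a (fun _ => true) fun x => .seq (pushW .main x) (pushW .main none))
      (ws O (wk (strTree z).code (y.map some) [] []) [])
      (4 * y.length + 2) (ms O (strTree (y.reverse ++ z)).code) := by
    intro y
    induction y with
    | nil => intro z; exact runsIn_loopW_nil rfl
    | cons s y ih =>
      intro z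
      refine RunsIn.mono (runsIn_loopW_step (x := some s) (l := y.map some) rfl rfl
        (T := 2) (S' := ws O (wk (strTree (s :: z)).code (y.map some) [] []) [])
        (T' := 4 * y.length + 2) ?_ ?_) (by simp; omega)
      · refine RunsIn.seq (T := 1) (T' := 1) (runsIn_pushW _ _) ?_
        have := runsIn_pushW (O := O) (w := wk (some s :: (strTree z).code) (y.map some) [] [])
          (i := []) (C := (fun _ => [])) (S := (fun _ _ => [])) .main none
        simpa [wk, strTree, Tree.code] using this
      · simpa using ih (s :: z)
  refine RunsIn.mono (RunsIn.seq (h1 x []) (RunsIn.seq (runsIn_pushW _ _)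
    (T' := 4 * x.length + 2) ?_)) (by omega)
  have := h2 x.reverse []
  simpa [wk, strTree, Tree.code] using this

/-- Convert the string at the top of the main stack into a string on the input/output stack. -/
def writeOutput : OProg O :=
  .seq unpackStr (loopW .a (fun _ => true) fun
    | some s => .push (.inr (.inl ())) s
    | none => .skip)

theorem runsIn_writeOutput (x : List Symb) :
    RunsIn (O := O) writeOutput (ms O (strTree x).code) (8 * x.length + 5)
      (st (wk [] [] [] []) x (fun _ => []) (fun _ _ => [])) := by
  have h1 : ∀ (y z : List Symb), RunsIn (O := O)
      (loopW .a (fun _ => true) fun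
        | some s => .push (.inr (.inl ())) s
        | none => .skip)
      (ws O (wk [] (y.map some) [] []) z)
      (3 * y.length + 2) (st (wk [] [] [] []) (y.reverse ++ z) (fun _ => []) (fun _ _ => [])) := by
    intro y
    induction y with
    | nil => intro z; exact runsIn_loopW_nil rfl
    | cons s y ih =>
      intro z
      refine RunsIn.mono (runsIn_loopW_step (x := some s) (l := y.map some) rfl rfl
        (T := 1) (S' := ws O (wk [] (y.map some) [] []) (s :: z))
        (T' := 3 * y.length + 2) ?_ ?_) (by simp; omega)
      · refine ⟨1, le_rfl, ?_⟩
        have := Runs.push (B := Branch O) (.inr (.inl ())) s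
          (ws O (wk [] (y.map some) [] []) z)
        rw [update_st_io] at this
        simpa [st] using this
      · simpa using ih (s :: z)
  have h2 := runsIn_unpackStr (O := O) [] (fun _ => []) (fun _ _ => []) x [] []
  refine RunsIn.mono (RunsIn.seq (S' := ws O (wk [] ((x.map some).reverse) [] []) [])
    (by simpa [ms] using h2) (T' := 3 * x.length + 2) ?_) (by omega)
  have := h1 x.reverse []
  simpa using this

end TreeOps

/-! ### Oracle machines as subroutines -/

section OracleCall

variable {O : Oracles}

/-- The cost of executing a statement of an oracle machine. -/
def stmtCost {K : Type} {Γ : K → Type} {Λ σ : Type} : TM2.Stmt Γ Λ σ → ℕ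
  | .push _ _ q => stmtCost q + 1
  | .peek _ _ q => stmtCost q + 1
  | .pop _ _ q => stmtCost q + 1
  | .load _ q => stmtCost q
  | .branch _ q q' => stmtCost q + stmtCost q'
  | .goto _ => 1
  | .halt => 0

/-- The internal state in a value on which a program can branch. -/
noncomputable def branchState (o : Bool) : Branch O → (O.ask o).tm.σ
  | .inl _ => (O.ask o).tm.initialState
  | .inr ⟨o', _, v⟩ => if h : o' = o then h ▸ v else (O.ask o).tm.initialState

/-- The program that executes a statement of oracle machine `o` in internal state `v` and stores
the resulting label and state, unless the machine halts. -/
noncomputable def stmtProg (o : Bool) :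
    TM2.Stmt (O.ask o).tm.Γ (O.ask o).tm.Λ (O.ask o).tm.σ → (O.ask o).tm.σ → OProg O
  | .push k f q, v => .seq (.push (.inr (.inr (.inr ⟨o, k⟩))) (f v)) (stmtProg o q v)
  | .peek k f q, v => .peek (.inr (.inr (.inr ⟨o, k⟩))) (fun x => .inr ⟨o, none, f v x⟩)
      fun b => stmtProg o q (branchState o b)
  | .pop k f q, v => .pop (.inr (.inr (.inr ⟨o, k⟩))) (fun x => .inr ⟨o, none, f v x⟩)
      fun b => stmtProg o q (branchState o b)
  | .load f q, v => stmtProg o q (f v)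
  | .branch f q q', v => if f v then stmtProg o q v else stmtProg o q' v
  | .goto f, v => .push (.inr (.inr (.inl o))) (f v, v)
  | .halt, _ => .skip

/-- The stacks while oracle machine `o` is in configuration `c` and main stack `m` is frozen. -/
noncomputable def ocfg (o : Bool) (m : List Tok) (l : Option (O.ask o).tm.Λ) (v : (O.ask o).tm.σ)
    (S : ∀ k, List ((O.ask o).tm.Γ k)) : ∀ k, List (Alphabet O k) :=
  st (wk m [] [] []) [] (Function.update (fun _ => []) o (l.elim [] fun l => [(l, v)]))
    (Function.update (fun _ _ => []) o S)

/-- The program for a statement has the same effect on the stacks as the statement. -/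
theorem runsIn_stmtProg (o : Bool) (m : List Tok)
    (q : TM2.Stmt (O.ask o).tm.Γ (O.ask o).tm.Λ (O.ask o).tm.σ)
    (v v₀ : (O.ask o).tm.σ) (S : ∀ k, List ((O.ask o).tm.Γ k)) :
    RunsIn (stmtProg o q v) (ocfg o m none v₀ S) (stmtCost q)
      (ocfg o m (TM2.stepAux q v S).l (TM2.stepAux q v S).var (TM2.stepAux q v S).stk) := by
  induction q generalizing v S with
  | push k f q ih =>
    obtain ⟨t, ht, h⟩ := ih v (Function.update S k (f v :: S k))
    refine ⟨1 + t, by simp [stmtCost]; omega, .seq _ _ _ _ _ _ _ (.push _ _ _) ?_⟩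
    rw [ocfg, update_st_oracle]
    simpa [st, ocfg] using h
  | peek k f q ih =>
    obtain ⟨t, ht, h⟩ := ih (f v (S k).head?) S
    refine ⟨t + 1, by simp [stmtCost]; omega, .peek _ _ _ _ _ _ ?_⟩
    simpa [st, ocfg, branchState] using h
  | pop k f q ih =>
    obtain ⟨t, ht, h⟩ := ih (f v (S k).head?) (Function.update S k (S k).tail)
    refine ⟨t + 1, by simp [stmtCost]; omega, .pop _ _ _ _ _ _ ?_⟩
    rw [ocfg, update_st_oracle]
    simpa [st, ocfg, branchState] using h
  | load f q ih => exact ih (f v) S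
  | branch f q q' ih ih' =>
    cases hf : f v
    · simpa [stmtProg, hf] using (ih' v S).mono (by simp [stmtCost])
    · simpa [stmtProg, hf] using (ih v S).mono (by simp [stmtCost])
  | goto f =>
    have := Runs.push (B := Branch O) (.inr (.inr (.inl o))) (f v, v) (ocfg o m none v₀ S)
    rw [ocfg, update_st_ctl] at this
    refine ⟨1, le_rfl, ?_⟩
    simpa [st, ocfg, stmtProg] using this
  | halt => exact RunsIn.skip _

/-- Run oracle machine `o` until it halts. -/
noncomputable def oracleLoop (o : Bool) : OProg O :=
  .loop (.inr (.inr (.inl o))) (fun x => x.map fun y => .inr ⟨o, some y.1, y.2⟩) fun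
    | .inr ⟨o', some l, v⟩ => stmtProg o' ((O.ask o').tm.m l) v
    | _ => .skip

/-- A bound on the cost of one step of an oracle machine. -/
noncomputable def maxCost (O : Oracles) (o : Bool) : ℕ :=
  letI := (O.ask o).tm.ΛFin
  Finset.univ.sup fun l => stmtCost ((O.ask o).tm.m l)

theorem stmtCost_le (o : Bool) (l : (O.ask o).tm.Λ) : stmtCost ((O.ask o).tm.m l) ≤ maxCost O o :=
  letI := (O.ask o).tm.ΛFin
  Finset.le_sup (f := fun l => stmtCost ((O.ask o).tm.m l)) (Finset.mem_univ l)

/-- A halting run of the oracle machine is reproduced by the loop, with constant overhead per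
step. -/
theorem runsIn_oracleLoop (o : Bool) (m : List Tok) (n : ℕ) (c : (O.ask o).tm.Cfg) (v')
    (S' : ∀ k, List ((O.ask o).tm.Γ k))
    (h : (flip bind (O.ask o).tm.step)^[n] (some c) = some ⟨none, v', S'⟩) :
    RunsIn (oracleLoop o) (ocfg o m c.l c.var c.stk) (n * (maxCost O o + 2) + 2)
      (ocfg o m none v' S') := by
  induction n generalizing c with
  | zero =>
    obtain rfl : c = ⟨none, v', S'⟩ := Option.some.inj h
    refine ⟨2, by omega, ?_⟩
    have := Runs.loop_exit (Γ := Alphabet O) (B := Branch O) (.inr (.inr (.inl o)))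
      (fun x : Option ((O.ask o).tm.Λ × (O.ask o).tm.σ) => x.map fun y =>
        .inr ⟨o, some y.1, y.2⟩) (fun
      | .inr ⟨o', some l, v⟩ => stmtProg o' ((O.ask o').tm.m l) v
      | _ => .skip) (ocfg o m none v' S') (by simp [st, ocfg])
    rw [ocfg, update_st_ctl] at this
    simpa [st, ocfg, oracleLoop] using this
  | succ n ih =>
    rw [Function.iterate_succ_apply] at h
    obtain ⟨l, v, S⟩ := c
    cases l with
    | none =>
      exfalso
      have key : ∀ n, (flip bind (O.ask o).tm.step)^[n] none = none := by
        intro n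
        induction n with
        | zero => rfl
        | succ n ih => rw [Function.iterate_succ_apply]; exact ih
      have : flip bind (O.ask o).tm.step (some ⟨none, v, S⟩) = none := rfl
      rw [this, key] at h
      cases h
    | some l =>
      obtain ⟨t', ht', h'⟩ := ih (TM2.stepAux ((O.ask o).tm.m l) v S) h
      obtain ⟨t, ht, h1⟩ := runsIn_stmtProg o m ((O.ask o).tm.m l) v v S
      have hc := stmtCost_le (O := O) o l
      refine ⟨t + t' + 2, ?_, ?_⟩
      · rw [Nat.succ_mul]; omega
      · refine Runs.loop_step _ _ _ _ (.inr ⟨o, some l, v⟩) t _ t' _ ?_ ?_ h'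
        · simp [st, ocfg]
        · rw [ocfg, update_st_ctl]
          simpa [st, ocfg] using h1

/-- Ask oracle machine `o` about the string at the top of the main stack: copy the string to the
input stack of the machine, run the machine and fetch the answer. -/
noncomputable def callOracle (o : Bool) : OProg O :=
  .seq unpackStr (.seq (loopW .a (fun _ => true) fun
    | some s => .push (.inr (.inr (.inr ⟨o, (O.ask o).tm.k₀⟩))) ((O.ask o).inputAlphabet.symm s)
    | none => .skip)
  (.seq (.push (.inr (.inr (.inl o))) ((O.ask o).tm.main, (O.ask o).tm.initialState))
  (.seq (oracleLoop o)
    (.pop (.inr (.inr (.inr ⟨o, (O.ask o).tm.k₁⟩)))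
      (fun x => .inl (x.map fun s => some (.bit ((O.ask o).outputAlphabet s)))) fun
        | .inl (some t) => pushW .main t
        | _ => .skip))))

theorem initList_stk (tm : FinTM2) (s : List (tm.Γ tm.k₀)) :
    (initList tm s).stk = Function.update (fun _ => []) tm.k₀ s := by
  funext k
  by_cases hk : k = tm.k₀
  · subst hk; simp [initList]
  · simp [initList, hk]

theorem haltList_stk (tm : FinTM2) (s : List (tm.Γ tm.k₁)) :
    (haltList tm s).stk = Function.update (fun _ => []) tm.k₁ s := by
  funext k
  by_cases hk : k = tm.k₁
  · subst hk; simp [haltList]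
  · simp [haltList, hk]

theorem runsIn_callOracle (o : Bool) (m : List Tok) (x : List Symb) (y : Bool) (T : ℕ)
    (h : Nonempty (TM2OutputsInTime (O.ask o).tm (x.map (O.ask o).inputAlphabet.symm)
      (some ([y].map (O.ask o).outputAlphabet.symm)) T)) :
    RunsIn (callOracle o) (ms O ((strTree x).code ++ m))
      (8 * x.length + T * (maxCost O o + 2) + 10) (ms O (some (.bit y) :: m)) := by
  obtain ⟨⟨⟨n, hn⟩, hnT⟩⟩ := h
  have h1 : ∀ (z : List Symb) (i : List ((O.ask o).tm.Γ (O.ask o).tm.k₀)), RunsIn (O := O)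
      (loopW .a (fun _ => true) fun
        | some s => .push (.inr (.inr (.inr ⟨o, (O.ask o).tm.k₀⟩))) ((O.ask o).inputAlphabet.symm s)
        | none => .skip)
      (st (wk m (z.map some) [] []) [] (fun _ => [])
        (Function.update (fun _ _ => []) o (Function.update (fun _ => []) (O.ask o).tm.k₀ i)))
      (3 * z.length + 2)
      (ocfg o m none (O.ask o).tm.initialState (Function.update (fun _ => []) (O.ask o).tm.k₀
        ((z.map (O.ask o).inputAlphabet.symm).reverse ++ i))) := by
    intro z
    induction z with
    | nil =>
      intro i
      have := runsIn_loopW_nil (O := O) (w := wk m [] [] []) (k := .a) (i := [])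
        (C := fun _ => []) (S := Function.update (fun _ _ => []) o
          (Function.update (fun _ => []) (O.ask o).tm.k₀ i)) (p := fun _ => true) (f := fun
        | some s => .push (.inr (.inr (.inr ⟨o, (O.ask o).tm.k₀⟩))) ((O.ask o).inputAlphabet.symm s)
        | none => .skip) rfl
      simpa [ocfg] using this
    | cons s z ih =>
      intro i
      refine RunsIn.mono (runsIn_loopW_step (x := some s) (l := z.map some) rfl rfl
        (T := 1) (T' := 3 * z.length + 2) (S' := st (wk m (z.map some) [] []) [] (fun _ => [])
        (Function.update (fun _ _ => []) o (Function.update (fun _ => []) (O.ask o).tm.k₀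
          ((O.ask o).inputAlphabet.symm s :: i)))) ?_ ?_) (by simp; omega)
      · refine ⟨1, le_rfl, ?_⟩
        have := Runs.push (B := Branch O) (.inr (.inr (.inr ⟨o, (O.ask o).tm.k₀⟩)))
          ((O.ask o).inputAlphabet.symm s) (st (wk m (z.map some) [] []) [] (fun _ => [])
          (Function.update (fun _ _ => []) o (Function.update (fun _ => []) (O.ask o).tm.k₀ i)))
        rw [update_st_oracle] at this
        simpa [st] using this
      · simpa using ih ((O.ask o).inputAlphabet.symm s :: i)
  have h2 := runsIn_unpackStr (O := O) [] (fun _ => []) (fun _ _ => []) x m []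
  have h3 := h1 (x.reverse) []
  have h4 := runsIn_oracleLoop (O := O) o m n _ (haltList (O.ask o).tm
    ([y].map (O.ask o).outputAlphabet.symm)).var
    (haltList (O.ask o).tm ([y].map (O.ask o).outputAlphabet.symm)).stk hn
  rw [initList_stk, haltList_stk] at h4
  refine RunsIn.mono (RunsIn.seq h2 (RunsIn.seq (T := 3 * x.length + 2) (S' := ocfg o m none
      (O.ask o).tm.initialState (Function.update (fun _ => []) (O.ask o).tm.k₀
        (x.map (O.ask o).inputAlphabet.symm))) ?_
    (RunsIn.seq (T := 1) (S' := ocfg o m (some (O.ask o).tm.main)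
      (O.ask o).tm.initialState (Function.update (fun _ => []) (O.ask o).tm.k₀
        (x.map (O.ask o).inputAlphabet.symm))) ?_ (RunsIn.seq h4 (T' := 2) ?_)))) ?_
  · have e : (Function.update (fun _ _ => []) o (Function.update (fun _ => []) (O.ask o).tm.k₀ []) :
        ∀ o k, List ((O.ask o).tm.Γ k)) = fun _ _ => [] := by
      have : (Function.update (fun _ => []) (O.ask o).tm.k₀ [] : ∀ k, List ((O.ask o).tm.Γ k)) =
        fun _ => [] := Function.update_eq_self _ _
      rw [this]
      exact Function.update_eq_self o (fun _ _ => [])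
    rw [e] at h3
    simpa using h3
  · refine ⟨1, le_rfl, ?_⟩
    have := Runs.push (B := Branch O) (.inr (.inr (.inl o))) ((O.ask o).tm.main,
      (O.ask o).tm.initialState) (ocfg o m none (O.ask o).tm.initialState
      (Function.update (fun _ => []) (O.ask o).tm.k₀ (x.map (O.ask o).inputAlphabet.symm)))
    rw [ocfg, update_st_ctl] at this
    simpa [st, ocfg] using this
  · obtain ⟨t, ht, h⟩ := runsIn_pushMain (O := O) (some (.bit y)) m
    refine ⟨t + 1, by omega, .pop _ _ _ _ _ _ ?_⟩
    rw [ocfg, update_st_oracle]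
    have e : (Function.update (fun _ _ => []) o (fun _ => []) :
        ∀ o k, List ((O.ask o).tm.Γ k)) = fun _ _ => [] := Function.update_eq_self o (fun _ _ => [])
    have e' : (Function.update (fun _ => []) (O.ask o).tm.k₁ [] : ∀ k, List ((O.ask o).tm.Γ k)) =
        fun _ => [] := Function.update_eq_self _ _
    have e'' : (Function.update (fun _ => []) o [] : ∀ o, List ((O.ask o).tm.Λ × (O.ask o).tm.σ)) =
        fun _ => [] := Function.update_eq_self _ _
    simpa [st, e, e', e'', ms] using h
  · have : n * (maxCost O o + 2) ≤ T * (maxCost O o + 2) := Nat.mul_le_mul_right _ hnT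
    omega

end OracleCall

/-! ### Functions computable in polynomial time -/

/-- Types whose elements are represented by trees. -/
class TreeEnc (α : Type) where
  /-- The tree that represents an element. -/
  enc : α → Tree

open TreeEnc (enc)

/-- The size of the representation of an element. -/
def sz {α : Type} [TreeEnc α] (x : α) : ℕ := (TreeEnc.enc x).size

instance : TreeEnc Symb := ⟨.leaf⟩

instance : TreeEnc Bool := ⟨fun b => .leaf (.bit b)⟩

/-- The representation of a list; the empty list is represented by a semicolon. -/
def encList {α : Type} [TreeEnc α] : List α → Tree
  | [] => .leaf .semicolon
  | a :: l => .node (TreeEnc.enc a) (encList l)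

instance {α : Type} [TreeEnc α] : TreeEnc (List α) := ⟨encList⟩

instance {α β : Type} [TreeEnc α] [TreeEnc β] : TreeEnc (α × β) :=
  ⟨fun x => .node (TreeEnc.enc x.1) (TreeEnc.enc x.2)⟩

section
variable {α β γ δ ε σ : Type} [TreeEnc α] [TreeEnc β] [TreeEnc γ] [TreeEnc δ] [TreeEnc ε]
  [TreeEnc σ]

theorem enc_list_symb (l : List Symb) : TreeEnc.enc l = strTree l := by
  induction l with
  | nil => rfl
  | cons s l ih => exact congrArg _ ih

@[simp] theorem sz_symb (s : Symb) : sz s = 1 := rfl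
@[simp] theorem sz_bool (b : Bool) : sz b = 1 := rfl
@[simp] theorem sz_nil : sz ([] : List α) = 1 := rfl
@[simp] theorem sz_cons (a : α) (l : List α) : sz (a :: l) = sz a + sz l + 1 := rfl
@[simp] theorem sz_pair (x : α × β) : sz x = sz x.1 + sz x.2 + 1 := rfl

theorem sz_pos (x : α) : 0 < sz x := Tree.size_pos _

theorem sz_append (l l' : List α) : sz (l ++ l') + 1 = sz l + sz l' := by
  induction l with
  | nil => simp; omega
  | cons a l ih => simp only [List.cons_append, sz_cons]; omega

theorem sz_le_of_mem {a : α} {l : List α} (h : a ∈ l) : sz a < sz l := by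
  induction l with
  | nil => simp at h
  | cons b l ih =>
    rw [sz_cons]
    rcases List.mem_cons.1 h with rfl | h
    · omega
    · have := ih h; omega

theorem length_lt_sz (l : List α) : l.length < sz l := by
  induction l with
  | nil => simp
  | cons b l ih => rw [sz_cons, List.length_cons]; omega

/-- `T` is bounded by a polynomial. -/
def PolyB (T : ℕ → ℕ) : Prop := ∃ c, ∀ n, T n ≤ (n + 2) ^ c

theorem PolyB.mono {T U : ℕ → ℕ} (h : PolyB U) (hT : ∀ n, T n ≤ U n) : PolyB T :=
  let ⟨c, hc⟩ := h; ⟨c, fun n => (hT n).trans (hc n)⟩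

theorem PolyB.pow (c : ℕ) : PolyB fun n => (n + 2) ^ c := ⟨c, fun _ => le_rfl⟩

theorem PolyB.const (k : ℕ) : PolyB fun _ => k :=
  ⟨k, fun n => (Nat.lt_pow_self (by omega : 1 < n + 2)).le⟩

theorem PolyB.id : PolyB fun n => n := ⟨1, fun n => by simp⟩

theorem PolyB.add {T U : ℕ → ℕ} (hT : PolyB T) (hU : PolyB U) : PolyB fun n => T n + U n := by
  obtain ⟨c, hc⟩ := hT
  obtain ⟨d, hd⟩ := hU
  refine ⟨max c d + 1, fun n => ?_⟩
  have h1 : (n + 2) ^ c ≤ (n + 2) ^ max c d := Nat.pow_le_pow_right (by omega) (le_max_left _ _)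
  have h2 : (n + 2) ^ d ≤ (n + 2) ^ max c d := Nat.pow_le_pow_right (by omega) (le_max_right _ _)
  have h3 : (n + 2) ^ max c d * 2 ≤ (n + 2) ^ (max c d + 1) := by
    rw [pow_succ]; exact Nat.mul_le_mul_left _ (by omega)
  have := hc n
  have := hd n
  change T n + U n ≤ _
  omega

theorem PolyB.mul {T U : ℕ → ℕ} (hT : PolyB T) (hU : PolyB U) : PolyB fun n => T n * U n := by
  obtain ⟨c, hc⟩ := hT
  obtain ⟨d, hd⟩ := hU
  exact ⟨c + d, fun n => by rw [pow_add]; exact Nat.mul_le_mul (hc n) (hd n)⟩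

theorem PolyB.powAdd {T : ℕ → ℕ} (hT : PolyB T) (c : ℕ) : PolyB fun n => (T n + 2) ^ c := by
  obtain ⟨d, hd⟩ := hT.add (.const 2)
  exact ⟨d * c, fun n => by rw [pow_mul]; exact Nat.pow_le_pow_left (hd n) c⟩

/-- `f` is computed in polynomial time by a program that replaces `x` by `f x` at the top of the
main stack. The program may use the oracle machines `O`. -/
@[fun_prop]
def PolyF (O : Oracles) (f : α → β) : Prop :=
  ∃ (p : OProg O) (c : ℕ), ∀ x m,
    RunsIn p (ms O ((enc x).code ++ m)) ((sz x + 2) ^ c) (ms O ((enc (f x)).code ++ m))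

variable {O : Oracles}

theorem PolyF.intro {f : α → β} (p : OProg O) (T : ℕ → ℕ) (hT : PolyB T)
    (h : ∀ x m, RunsIn p (ms O ((enc x).code ++ m)) (T (sz x)) (ms O ((enc (f x)).code ++ m))) :
    PolyF O f :=
  let ⟨c, hc⟩ := hT
  ⟨p, c, fun x m => (h x m).mono (hc _)⟩

/-- The output of a program is not longer than the input and the time together. -/
theorem sz_le_of_runsIn {p : OProg O} {x : α} {y : β} {T : ℕ}
    (h : RunsIn p (ms O ((enc x).code ++ [])) T (ms O ((enc y).code ++ []))) :
    sz y ≤ sz x + T := by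
  obtain ⟨t, ht, h⟩ := h
  have := h.length_le (.inl .main)
  simp only [ms, ws, st, wk, List.length_append, Tree.length_code, List.length_nil] at this
  simp only [sz]; omega

theorem PolyF.sz_le {f : α → β} (hf : PolyF O f) :
    ∃ c, ∀ x, sz (f x) ≤ (sz x + 2) ^ c := by
  obtain ⟨p, c, h⟩ := hf
  obtain ⟨d, hd⟩ := PolyB.id.add (PolyB.pow c)
  exact ⟨d, fun x => (sz_le_of_runsIn (h x [])).trans (hd _)⟩

/-- Only the representation of the values of a function matters. -/
theorem PolyF.congr_enc {f : α → β} {g : α → γ} (hf : PolyF O f) (h : ∀ x, enc (g x) = enc (f x)) :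
    PolyF O g := by
  obtain ⟨p, c, hp⟩ := hf
  exact ⟨p, c, fun x m => by rw [h]; exact hp x m⟩

@[fun_prop]
theorem PolyF.id : PolyF O (fun x : α => x) :=
  .intro .skip (fun _ => 0) (.const 0) fun _ _ => RunsIn.skip _

@[fun_prop]
theorem PolyF.comp {g : β → γ} {f : α → β} (hg : PolyF O g) (hf : PolyF O f) :
    PolyF O (fun x => g (f x)) := by
  obtain ⟨d, hd⟩ := hf.sz_le
  obtain ⟨p, c, hf⟩ := hf
  obtain ⟨p', c', hg⟩ := hg
  refine .intro (.seq p p') (fun n => (n + 2) ^ c + ((n + 2) ^ d + 2) ^ c')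
    ((PolyB.pow c).add ((PolyB.pow d).powAdd c')) fun x m => ?_
  refine ((hf x m).seq (hg (f x) m)).mono (Nat.add_le_add_left ?_ _)
  exact Nat.pow_le_pow_left (by have := hd x; omega) _

theorem PolyB.linear (a b : ℕ) : PolyB fun n => a * n + b :=
  ((PolyB.const a).mul PolyB.id).add (.const b)

@[fun_prop]
theorem PolyF.const (y : β) : PolyF O (fun _ : α => y) := by
  refine .intro (.seq dropTree (pushAll (enc y).code)) (fun n => 10 * n + (10 + sz y))
    (PolyB.linear _ _) fun x m => ?_
  exact ((runsIn_dropTree (enc x) m).seq (runsIn_pushAll (enc y).code m)).mono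
    (by simp [sz]; omega)

theorem PolyF.fst_aux : PolyF O (fun x : α × β => x.1) := by
  refine .intro (popW .main fun _ => .seq swapTrees dropTree) (fun n => 40 * n + 40)
    (PolyB.linear _ _) fun x m => ?_
  have h := (runsIn_swapTrees (O := O) (enc x.1) (enc x.2) m).seq (runsIn_dropTree (enc x.2) _)
  have : (enc x).code ++ m = none :: ((enc x.1).code ++ ((enc x.2).code ++ m)) := by
    simp [enc, Tree.code]
  rw [this]
  exact (runsIn_popMain h).mono (by have := sz_pair x; simp only [sz] at this ⊢; omega)

theorem PolyF.snd_aux : PolyF O (fun x : α × β => x.2) := by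
  refine .intro (popW .main fun _ => dropTree) (fun n => 40 * n + 40)
    (PolyB.linear _ _) fun x m => ?_
  have : (enc x).code ++ m = none :: ((enc x.1).code ++ ((enc x.2).code ++ m)) := by
    simp [enc, Tree.code]
  rw [this]
  exact (runsIn_popMain (runsIn_dropTree (enc x.1) _)).mono
    (by have := sz_pair x; simp only [sz] at this ⊢; omega)

@[fun_prop]
theorem PolyF.fst {f : α → β × γ} (hf : PolyF O f) : PolyF O (fun x => (f x).1) :=
  PolyF.fst_aux.comp hf

@[fun_prop]
theorem PolyF.snd {f : α → β × γ} (hf : PolyF O f) : PolyF O (fun x => (f x).2) :=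
  PolyF.snd_aux.comp hf

@[fun_prop]
theorem PolyF.pair {f : α → β} {g : α → γ} (hf : PolyF O f) (hg : PolyF O g) :
    PolyF O (fun x => (f x, g x)) := by
  obtain ⟨d, hd⟩ := hg.sz_le
  obtain ⟨p, c, hf⟩ := hf
  obtain ⟨p', c', hg⟩ := hg
  refine .intro (.seq dupTree (.seq p' (.seq swapTrees (.seq p (pushW .main none)))))
    (fun n => (20 * n + 20) + ((n + 2) ^ c' + ((20 * n + 20) + 20 * (n + 2) ^ d
      + ((n + 2) ^ c + 1))))
    ((PolyB.linear _ _).add ((PolyB.pow _).add (((PolyB.linear _ _).add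
      ((PolyB.const _).mul (.pow _))).add ((PolyB.pow _).add (.const _))))) fun x m => ?_
  have h1 := runsIn_dupTree (O := O) (enc x) m
  have h2 := hg x ((enc x).code ++ m)
  have h3 := runsIn_swapTrees (O := O) (enc (g x)) (enc x) m
  have h4 := hf x ((enc (g x)).code ++ m)
  have h5 := runsIn_pushMain (O := O) none ((enc (f x)).code ++ ((enc (g x)).code ++ m))
  have h := h1.seq (h2.seq (h3.seq (h4.seq h5)))
  have e : (enc (f x, g x)).code ++ m =
      none :: ((enc (f x)).code ++ ((enc (g x)).code ++ m)) := by simp [enc, Tree.code]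
  rw [e]
  refine h.mono ?_
  have := hd x
  simp only [sz] at this ⊢
  omega

theorem PolyF.comp₂ {h : β × γ → δ} {f : α → β} {g : α → γ} (hh : PolyF O h) (hf : PolyF O f)
    (hg : PolyF O g) : PolyF O (fun x => h (f x, g x)) := hh.comp (hf.pair hg)

/-- Arbitrary functions of a symbol are computable. -/
theorem PolyF.ofSymb (f : Symb → β) : PolyF O f := by
  refine .intro (popW .main fun
    | some (some s) => pushAll (enc (f s)).code
    | _ => .skip) (fun _ => Finset.univ.sup (fun s => sz (f s)) + 1) (.const _) fun s m => ?_
  have h := runsIn_pushAll (O := O) (enc (f s)).code m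
  refine (runsIn_popMain (x := some s) h).mono ?_
  have : sz (f s) ≤ Finset.univ.sup (fun s => sz (f s)) :=
    Finset.le_sup (f := fun s => sz (f s)) (Finset.mem_univ s)
  simpa [sz] using this

@[fun_prop]
theorem PolyF.cond {c : α → Bool} {f g : α → β} (hc : PolyF O c) (hf : PolyF O f)
    (hg : PolyF O g) : PolyF O (fun x => if c x then f x else g x) := by
  obtain ⟨p, d, hp⟩ := hc.pair (PolyF.id (α := α))
  obtain ⟨p₁, d₁, hp₁⟩ := hf
  obtain ⟨p₂, d₂, hp₂⟩ := hg
  refine .intro (.seq p (popW .main fun _ => popW .main fun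
    | some (some (.bit true)) => p₁
    | _ => p₂)) (fun n => (n + 2) ^ d + ((n + 2) ^ d₁ + (n + 2) ^ d₂ + 2))
    ((PolyB.pow _).add (((PolyB.pow _).add (.pow _)).add (.const _))) fun x m => ?_
  have h1 := hp x m
  have e : (enc (c x, x)).code ++ m = none :: some (.bit (c x)) :: ((enc x).code ++ m) := by
    simp [enc, Tree.code]
  rw [e] at h1
  refine h1.seq (runsIn_popMain (T := (sz x + 2) ^ d₁ + (sz x + 2) ^ d₂ + 1) (runsIn_popMain ?_))
  cases hcx : c x
  · simpa using (hp₂ x m).mono (by omega)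
  · simpa using (hp₁ x m).mono (by omega)

@[fun_prop]
theorem PolyF.cons {f : α → β} {g : α → List β} (hf : PolyF O f) (hg : PolyF O g) :
    PolyF O (fun x => f x :: g x) := (hf.pair hg).congr_enc fun _ => rfl

/-- Case distinction on a list. -/
theorem PolyF.listCases {l : α → List β} {f : α → γ} {g : α → β → List β → γ} (hl : PolyF O l)
    (hf : PolyF O f) (hg : PolyF O fun x : α × (β × List β) => g x.1 x.2.1 x.2.2) :
    PolyF O (fun x => match l x with
      | [] => f x
      | b :: l' => g x b l') := by
  obtain ⟨s, hs⟩ := hl.sz_le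
  obtain ⟨p, d, hp⟩ := hl.pair (PolyF.id (α := α))
  obtain ⟨p₁, d₁, hp₁⟩ := hf
  obtain ⟨p₂, d₂, hp₂⟩ := hg
  refine .intro (.seq p (popW .main fun _ => popW .main fun
    | some none => .seq (pushW .main none) (.seq swapTrees (.seq (pushW .main none) p₂))
    | _ => p₁)) (fun n => (n + 2) ^ d + ((n + 2) ^ d₁ + ((20 * n + 25) + 20 * (n + 2) ^ s
      + ((n + (n + 2) ^ s + 1) + 2) ^ d₂)))
    ((PolyB.pow _).add ((PolyB.pow _).add (((PolyB.linear _ _).add ((PolyB.const _).mul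
      (.pow _))).add (((PolyB.id.add (.pow s)).add (.const 1)).powAdd _)))) fun x m => ?_
  have h1 := hp x m
  have e : (enc (l x, x)).code ++ m = none :: ((enc (l x)).code ++ ((enc x).code ++ m)) := by
    simp [enc, Tree.code]
  rw [e] at h1
  have hsx := hs x
  refine h1.seq ?_
  cases hlx : l x with
  | nil =>
    exact (runsIn_popMain (runsIn_popMain (x := some .semicolon) (hp₁ x m))).mono (by omega)
  | cons b l' =>
    rw [hlx] at hsx
    have e' : (enc (b :: l')).code ++ ((enc x).code ++ m) =
        none :: ((enc b).code ++ ((enc l').code ++ ((enc x).code ++ m))) := by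
      change (Tree.node (enc b) (enc l')).code ++ _ = _
      simp [Tree.code]
    rw [e']
    have h2 := runsIn_pushMain (O := O) none
      ((enc b).code ++ ((enc l').code ++ ((enc x).code ++ m)))
    rw [← e'] at h2
    have h3 := runsIn_swapTrees (O := O) (enc (b :: l')) (enc x) m
    have h4 := runsIn_pushMain (O := O) none ((enc x).code ++ ((enc (b :: l')).code ++ m))
    have h5 := hp₂ (x, (b, l')) m
    have e'' : (enc (x, (b, l'))).code ++ m =
        none :: ((enc x).code ++ ((enc (b :: l')).code ++ m)) := by
      change (Tree.node (enc x) (enc (b :: l'))).code ++ _ = _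
      simp [Tree.code]
    rw [e''] at h5
    refine (runsIn_popMain (runsIn_popMain (h2.seq (h3.seq (h4.seq h5))))).mono ?_
    have h6 : (sz (x, (b, l')) + 2) ^ d₂ ≤ (sz x + (sz x + 2) ^ s + 1 + 2) ^ d₂ := by
      refine Nat.pow_le_pow_left ?_ _
      simp only [sz_pair, sz_cons] at hsx ⊢
      omega
    change sz (b :: l') ≤ _ at hsx
    change 1 + (20 * sz (b :: l') + 20 * sz x + 20 + _) + 1 + 1 ≤ _
    omega

/-! ### Recursion on lists -/

/-- The program for a left fold, where `p` is a program for one step. -/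
def foldProg (p : OProg O) : OProg O :=
  .seq (loopW .main (fun t => t.isNone) fun _ => popW .main fun
    | some none => .seq (pushW .main none) (.seq (pushW .main none) p)
    | some (some s) => pushW .main (some s)
    | none => .skip) (popW .main fun _ => dropTree)

/-- The cost of a left fold, if the sizes of all intermediate states are at most `M`. -/
theorem runsIn_foldProg {f : ε → σ → α → σ} {p : OProg O} {c : ℕ}
    (hp : ∀ (x : (α × List α) × (ε × σ)) m, RunsIn p (ms O ((enc x).code ++ m)) ((sz x + 2) ^ c)
      (ms O ((enc (x.1.2, (x.2.1, f x.2.1 x.2.2 x.1.1))).code ++ m)))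
    (l : List α) (e : ε) (s : σ) (M : ℕ)
    (hM : ∀ l₁ l₂, l = l₁ ++ l₂ → sz (l₂, (e, l₁.foldl (f e) s)) ≤ M) (m : List Tok) :
    RunsIn (foldProg p) (ms O ((enc (l, (e, s))).code ++ m))
      (l.length * ((M + 2) ^ c + 5) + 10 * M + 20) (ms O ((enc (l.foldl (f e) s)).code ++ m)) := by
  have key : RunsIn (loopW .main (fun t => t.isNone) fun _ => popW .main fun
      | some none => .seq (pushW .main none) (.seq (pushW .main none) p)
      | some (some s) => pushW .main (some s)
      | none => .skip) (ms O ((enc (l, (e, s))).code ++ m))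
      (l.length * ((M + 2) ^ c + 5) + 6) (ms O ((enc (e, l.foldl (f e) s)).code ++ m)) := by
    induction l generalizing s with
    | nil =>
      have e1 : (enc (([] : List α), (e, s))).code ++ m =
          none :: some .semicolon :: ((enc (e, s)).code ++ m) := by
        change (Tree.node (.leaf .semicolon) (enc (e, s))).code ++ m = _
        simp [Tree.code]
      rw [e1]
      refine RunsIn.mono (runsIn_loopW_step (x := none) (T := 2)
        (l := some .semicolon :: ((enc (e, s)).code ++ m)) (T' := 2)
        (S' := ms O (some .semicolon :: ((enc (e, s)).code ++ m))) rfl rfl ?_ ?_) (by omega)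
      · have := runsIn_popMain (O := O) (x := some .semicolon) (f := fun
          | some none => .seq (pushW .main none) (.seq (pushW .main none) p)
          | some (some s) => pushW .main (some s)
          | none => .skip) (runsIn_pushMain _ ((enc (e, s)).code ++ m))
        simpa [ms] using this
      · have := runsIn_loopW_exit (O := O) (k := .main) (p := fun t => t.isNone) (i := [])
          (C := fun _ => []) (S := fun _ _ => []) (x := some .semicolon)
          (w := wk (some .semicolon :: ((enc (e, s)).code ++ m)) [] [] [])
          (l := ((enc (e, s)).code ++ m)) (f := fun _ => popW .main fun
          | some none => .seq (pushW .main none) (.seq (pushW .main none) p)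
          | some (some s) => pushW .main (some s)
          | none => .skip) rfl rfl
        simpa [ms] using this
    | cons a l ih =>
      have h1 := ih (f e s a) fun l₁ l₂ h => hM (a :: l₁) l₂ (by rw [h]; rfl)
      have h2 := hp ((a, l), (e, s)) m
      have h3 : (sz ((a, l), (e, s)) + 2) ^ c ≤ (M + 2) ^ c := by
        refine Nat.pow_le_pow_left ?_ _
        have := hM [] (a :: l) rfl
        simp only [sz_pair, sz_cons, List.foldl_nil] at this ⊢
        omega
      have e1 : (enc (a :: l, (e, s))).code ++ m = none :: none ::
          ((enc a).code ++ ((enc l).code ++ ((enc (e, s)).code ++ m))) := by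
        change (Tree.node (Tree.node (enc a) (enc l)) (enc (e, s))).code ++ m = _
        simp [Tree.code]
      have e2 : (enc ((a, l), (e, s))).code ++ m = none :: none ::
          ((enc a).code ++ ((enc l).code ++ ((enc (e, s)).code ++ m))) := e1
      rw [e1]
      rw [e2] at h2
      refine RunsIn.mono (runsIn_loopW_step (x := none) (l := none ::
          ((enc a).code ++ ((enc l).code ++ ((enc (e, s)).code ++ m)))) (T := (M + 2) ^ c + 3)
        rfl rfl ?_ h1) (by rw [List.length_cons, Nat.succ_mul]; omega)
      have := runsIn_popMain (O := O) (x := none) (f := fun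
          | some none => .seq (pushW .main none) (.seq (pushW .main none) p)
          | some (some s) => pushW .main (some s)
          | none => .skip) (m := (enc a).code ++ ((enc l).code ++ ((enc (e, s)).code ++ m)))
          (T := 1 + (1 + (M + 2) ^ c)) ((runsIn_pushMain none _).seq ((runsIn_pushMain none _).seq
            (h2.mono h3)))
      have h5 := this.mono (T' := (M + 2) ^ c + 3) (by omega)
      simpa [ms] using h5
  have e1 : (enc (e, l.foldl (f e) s)).code ++ m =
      none :: ((enc e).code ++ ((enc (l.foldl (f e) s)).code ++ m)) := by
    change (Tree.node (enc e) (enc (l.foldl (f e) s))).code ++ m = _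
    simp [Tree.code]
  rw [e1] at key
  refine (key.seq (runsIn_popMain (f := fun _ => dropTree) (runsIn_dropTree (enc e) _))).mono ?_
  have := hM [] l rfl
  simp only [sz_pair] at this
  change (l.length * ((M + 2) ^ c + 5) + 6) + (10 * sz e + 10 + 1) ≤ _
  omega

theorem PolyF.foldStep {f : ε → σ → α → σ}
    (hf : PolyF O fun x : (ε × σ) × α => f x.1.1 x.1.2 x.2) :
    PolyF O fun x : (α × List α) × (ε × σ) => (x.1.2, (x.2.1, f x.2.1 x.2.2 x.1.1)) := by
  have : PolyF O fun x : (α × List α) × (ε × σ) => f x.2.1 x.2.2 x.1.1 :=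
    hf.comp (f := fun x : (α × List α) × (ε × σ) => ((x.2.1, x.2.2), x.1.1)) (by fun_prop)
  exact PolyF.pair (by fun_prop) (PolyF.pair (by fun_prop) this)

/-- A left fold is computable if the sizes of all intermediate states are polynomially bounded. -/
theorem PolyF.foldl_of_sz {f : ε → σ → α → σ} {l : ε → List α} {s : ε → σ}
    (hf : PolyF O fun x : (ε × σ) × α => f x.1.1 x.1.2 x.2) (hl : PolyF O l) (hs : PolyF O s)
    (hsz : ∃ c, ∀ e l₁ l₂, l e = l₁ ++ l₂ → sz (l₁.foldl (f e) (s e)) ≤ (sz e + 2) ^ c) :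
    PolyF O fun e => (l e).foldl (f e) (s e) := by
  obtain ⟨a, ha⟩ := hl.sz_le
  obtain ⟨b, hb⟩ := hsz
  obtain ⟨p, c, hp⟩ := hf.foldStep
  obtain ⟨p', c', hp'⟩ := hl.pair ((PolyF.id (α := ε)).pair hs)
  refine .intro (.seq p' (foldProg p)) (fun n => (n + 2) ^ c' +
    ((n + 2) ^ a * (((n + 2) ^ a + n + (n + 2) ^ b + 2 + 2) ^ c + 5) +
      10 * ((n + 2) ^ a + n + (n + 2) ^ b + 2) + 20)) ?_ fun e m => ?_
  · have h := (((PolyB.pow a).add .id).add (.pow b)).add (.const 2)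
    exact (PolyB.pow _).add ((((PolyB.pow _).mul ((h.powAdd c).add (.const 5))).add
      ((PolyB.const 10).mul h)).add (.const _))
  · refine (hp' e m).seq ((runsIn_foldProg hp (l e) e (s e)
      ((sz e + 2) ^ a + sz e + (sz e + 2) ^ b + 2) (fun l₁ l₂ h => ?_) m).mono ?_)
    · have h1 := hb e l₁ l₂ h
      have h2 := ha e
      have h3 := sz_append l₁ l₂
      have h4 := sz_pos l₁
      rw [h] at h2
      simp only [sz_pair]
      omega
    · have h2 := ha e
      have h3 := length_lt_sz (l e)
      gcongr
      omega

omit [TreeEnc α] in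
theorem sz_foldl_le {g : σ → α → σ} {q : ℕ} {l : List α} {s : σ}
    (h : ∀ s, ∀ a ∈ l, sz (g s a) ≤ sz s + q) : sz (l.foldl g s) ≤ sz s + l.length * q := by
  induction l generalizing s with
  | nil => simp
  | cons a l ih =>
    have h1 := ih (s := g s a) fun s b hb => h s b (List.mem_cons_of_mem _ hb)
    have h2 := h s a List.mem_cons_self
    rw [List.foldl_cons, List.length_cons, Nat.succ_mul]
    omega

/-- A left fold is computable if each step increases the size of the state by at most a polynomial
in the sizes of the environment and the list entry. -/
theorem PolyF.foldl {f : ε → σ → α → σ} {l : ε → List α} {s : ε → σ}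
    (hf : PolyF O fun x : (ε × σ) × α => f x.1.1 x.1.2 x.2) (hl : PolyF O l) (hs : PolyF O s)
    {T : ℕ → ℕ} (hT : PolyB T) (hsz : ∀ e s a, sz (f e s a) ≤ sz s + T (sz e + sz a)) :
    PolyF O fun e => (l e).foldl (f e) (s e) := by
  obtain ⟨a, ha⟩ := hl.sz_le
  obtain ⟨b, hb⟩ := hs.sz_le
  obtain ⟨c, hc⟩ := hT
  obtain ⟨d, hd⟩ := (PolyB.pow b).add ((PolyB.pow a).mul ((PolyB.id.add (.pow a)).powAdd c))
  refine hf.foldl_of_sz hl hs ⟨d, fun e l₁ l₂ h => ?_⟩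
  refine le_trans ?_ (hd (sz e))
  have h1 : ∀ x ∈ l₁, sz x ≤ (sz e + 2) ^ a := fun x hx =>
    ((sz_le_of_mem (show x ∈ l e by rw [h]; exact List.mem_append_left _ hx)).le.trans (ha e))
  refine (sz_foldl_le (q := (sz e + (sz e + 2) ^ a + 2) ^ c) fun s x hx => ?_).trans ?_
  · refine (hsz e s x).trans (Nat.add_le_add_left ((hc _).trans ?_) _)
    exact Nat.pow_le_pow_left (by have := h1 x hx; omega) _
  · refine Nat.add_le_add (hb e) (Nat.mul_le_mul_right _ ?_)
    have h2 := length_lt_sz (l e)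
    have h3 := ha e
    rw [h] at h2 h3
    rw [List.length_append] at h2
    omega

end

/-! ### List operations in polynomial time -/

section
variable {α β γ δ ε σ : Type} [TreeEnc α] [TreeEnc β] [TreeEnc γ] [TreeEnc δ] [TreeEnc ε]
  [TreeEnc σ] {O : Oracles}

@[fun_prop]
theorem PolyF.reverse {l : ε → List α} (hl : PolyF O l) : PolyF O fun e => (l e).reverse := by
  have : PolyF O fun e => (l e).foldl (fun acc a => a :: acc) [] :=
    PolyF.foldl (T := fun n => n + 1) (by fun_prop) hl (by fun_prop) (PolyB.id.add (.const 1))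
      fun e s a => by rw [sz_cons]; omega
  simpa using this

@[fun_prop]
theorem PolyF.append {l l' : ε → List α} (hl : PolyF O l) (hl' : PolyF O l') :
    PolyF O fun e => l e ++ l' e := by
  have : PolyF O fun e => (l e).reverse.foldl (fun acc a => a :: acc) (l' e) :=
    PolyF.foldl (T := fun n => n + 1) (by fun_prop) (by fun_prop) hl' (PolyB.id.add (.const 1))
      fun e s a => by rw [sz_cons]; omega
  simpa using this

/-- A right fold is computable if each step increases the size of the state by at most a polynomial
in the sizes of the environment and the list entry. -/
theorem PolyF.foldr {f : ε → α → σ → σ} {l : ε → List α} {s : ε → σ}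
    (hf : PolyF O fun x : (ε × σ) × α => f x.1.1 x.2 x.1.2) (hl : PolyF O l) (hs : PolyF O s)
    {T : ℕ → ℕ} (hT : PolyB T) (hsz : ∀ e s a, sz (f e a s) ≤ sz s + T (sz e + sz a)) :
    PolyF O fun e => (l e).foldr (f e) (s e) := by
  have := PolyF.foldl (f := fun e s a => f e a s) hf hl.reverse hs hT hsz
  simpa using this

theorem PolyF.map {f : ε → α → β} {l : ε → List α}
    (hf : PolyF O fun x : ε × α => f x.1 x.2) (hl : PolyF O l) :
    PolyF O fun e => (l e).map (f e) := by
  obtain ⟨c, hc⟩ := hf.sz_le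
  have h1 : PolyF O fun x : (ε × List β) × α => f x.1.1 x.2 :=
    hf.comp (f := fun x : (ε × List β) × α => (x.1.1, x.2)) (by fun_prop)
  have : PolyF O fun e => (l e).foldr (fun a acc => f e a :: acc) [] := by
    refine PolyF.foldr (f := fun e a acc => f e a :: acc) (T := fun n => (n + 1 + 2) ^ c + 1)
      (h1.cons (by fun_prop)) hl (by fun_prop)
      (((PolyB.id.add (.const 1)).powAdd c).add (.const 1)) fun e s a => ?_
    have := hc (e, a)
    simp only [sz_pair, sz_cons] at this ⊢
    omega
  refine this.congr_enc fun e => ?_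
  congr 1
  induction l e with
  | nil => rfl
  | cons a l ih => rw [List.map_cons, List.foldr_cons, ih]

@[fun_prop]
theorem PolyF.flatten {l : ε → List (List α)} (hl : PolyF O l) :
    PolyF O fun e => (l e).flatten := by
  have : PolyF O fun e => (l e).foldr (fun a acc => a ++ acc) [] := by
    refine PolyF.foldr (f := fun e a acc => a ++ acc) (T := fun n => n) (by fun_prop) hl
      (by fun_prop) PolyB.id fun e s a => ?_
    have := sz_append a s
    omega
  refine this.congr_enc fun e => ?_
  congr 1
  induction l e with
  | nil => rfl
  | cons a l ih => simp [ih]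

theorem PolyF.flatMap {f : ε → α → List β} {l : ε → List α}
    (hf : PolyF O fun x : ε × α => f x.1 x.2) (hl : PolyF O l) :
    PolyF O fun e => (l e).flatMap (f e) := by
  simpa [List.flatMap_def] using (PolyF.map hf hl).flatten

theorem PolyF.filter {f : ε → α → Bool} {l : ε → List α}
    (hf : PolyF O fun x : ε × α => f x.1 x.2) (hl : PolyF O l) :
    PolyF O fun e => (l e).filter (f e) := by
  have : PolyF O fun e => (l e).flatMap fun a => if f e a then [a] else [] :=
    PolyF.flatMap (f := fun e a => if f e a then [a] else [])
      (hf.cond (by fun_prop) (by fun_prop)) hl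
  refine this.congr_enc fun e => ?_
  congr 1
  induction l e with
  | nil => rfl
  | cons a l ih => by_cases h : f e a <;> simp [ih, h]

@[fun_prop]
theorem PolyF.and {f g : ε → Bool} (hf : PolyF O f) (hg : PolyF O g) :
    PolyF O fun e => f e && g e :=
  (hf.cond hg (.const false)).congr_enc fun e => by cases f e <;> simp

@[fun_prop]
theorem PolyF.not {f : ε → Bool} (hf : PolyF O f) : PolyF O fun e => !f e :=
  (hf.cond (.const false) (.const true)).congr_enc fun e => by cases f e <;> simp

@[fun_prop]
theorem PolyF.or {f g : ε → Bool} (hf : PolyF O f) (hg : PolyF O g) :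
    PolyF O fun e => f e || g e :=
  (hf.cond (.const true) hg).congr_enc fun e => by cases f e <;> simp

@[fun_prop]
theorem PolyF.xor {f g : ε → Bool} (hf : PolyF O f) (hg : PolyF O g) :
    PolyF O fun e => f e ^^ g e :=
  (hf.cond hg.not hg).congr_enc fun e => by cases f e <;> simp

theorem PolyF.all {f : ε → α → Bool} {l : ε → List α}
    (hf : PolyF O fun x : ε × α => f x.1 x.2) (hl : PolyF O l) :
    PolyF O fun e => (l e).all (f e) := by
  have h1 : PolyF O fun x : (ε × Bool) × α => f x.1.1 x.2 :=
    hf.comp (f := fun x : (ε × Bool) × α => (x.1.1, x.2)) (by fun_prop)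
  have : PolyF O fun e => (l e).foldr (fun a acc => f e a && acc) true :=
    PolyF.foldr (f := fun e a acc => f e a && acc) (T := fun n => 0)
      (h1.and (by fun_prop)) hl (by fun_prop) (.const 0) fun e s a => by simp
  refine this.congr_enc fun e => ?_
  congr 1
  induction l e with
  | nil => rfl
  | cons a l ih => simp [ih]

@[fun_prop]
theorem PolyF.tail {l : ε → List α} (hl : PolyF O l) : PolyF O fun e => (l e).tail :=
  (PolyF.listCases hl (f := fun _ => []) (g := fun _ _ l' => l') (by fun_prop)
    (by fun_prop)).congr_enc fun e => by cases l e <;> rfl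

@[fun_prop]
theorem PolyF.headD {l : ε → List α} {d : ε → α} (hl : PolyF O l) (hd : PolyF O d) :
    PolyF O fun e => (l e).headD (d e) :=
  (PolyF.listCases hl (f := d) (g := fun _ b _ => b) (by fun_prop)
    (by fun_prop)).congr_enc fun e => by cases l e <;> rfl

@[fun_prop]
theorem PolyF.zip {l : ε → List α} {l' : ε → List β} (hl : PolyF O l) (hl' : PolyF O l') :
    PolyF O fun e => (l e).zip (l' e) := by
  let step : ε → List β × List (α × β) → α → List β × List (α × β) := fun _ s a =>
    match s.1 with
    | [] => s
    | b :: t => (t, (a, b) :: s.2)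
  have h1 : PolyF O fun x : (ε × (List β × List (α × β))) × α => step x.1.1 x.1.2 x.2 :=
    PolyF.listCases (l := fun x : (ε × (List β × List (α × β))) × α => x.1.2.1)
      (f := fun x => x.1.2) (g := fun x b t => (t, (x.2, b) :: x.1.2.2))
      (by fun_prop) (by fun_prop) (by fun_prop)
  have h2 : PolyF O fun e => (l e).foldl (step e) (l' e, []) := by
    refine PolyF.foldl (T := fun n => n + 1) h1 hl (by fun_prop) (PolyB.id.add (.const 1))
      fun e s a => ?_
    obtain ⟨t, acc⟩ := s
    cases t with
    | nil => simp only [step]; omega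
    | cons b t => simp only [step, sz_pair, sz_cons]; omega
  have h3 : PolyF O fun e => ((l e).foldl (step e) (l' e, [])).2.reverse := by fun_prop
  refine h3.congr_enc fun e => ?_
  congr 1
  have key : ∀ (l : List α) (l' : List β) (acc : List (α × β)),
      (l.foldl (step e) (l', acc)).2.reverse = acc.reverse ++ l.zip l' := by
    intro l
    induction l with
    | nil => intro l' acc; simp
    | cons a l ih =>
      intro l' acc
      cases l' with
      | nil =>
        have := ih [] acc
        simpa [step] using this
      | cons b l' =>
        have := ih l' ((a, b) :: acc)
        simpa [step] using this
  rw [key]; rfl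

theorem PolyF.map_symb (f : Symb → β) {l : ε → List Symb} (hl : PolyF O l) :
    PolyF O fun e => (l e).map f :=
  PolyF.map (f := fun _ => f) ((PolyF.ofSymb f).comp (by fun_prop)) hl

theorem PolyF.zipWith {f : ε → α → β → γ} {l : ε → List α} {l' : ε → List β}
    (hf : PolyF O fun x : ε × (α × β) => f x.1 x.2.1 x.2.2) (hl : PolyF O l) (hl' : PolyF O l') :
    PolyF O fun e => List.zipWith (f e) (l e) (l' e) := by
  have := PolyF.map (f := fun e (x : α × β) => f e x.1 x.2) hf (hl.zip hl')
  refine this.congr_enc fun e => ?_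
  rw [List.map_zip_eq_zipWith]
  rfl

end

/-! ### Binary arithmetic -/

/-- The value of a list of binary digits, least significant digit first. -/
def val (l : List Bool) : ℕ := l.foldr (fun b n => b.toNat + 2 * n) 0

@[simp] theorem val_nil : val [] = 0 := rfl
@[simp] theorem val_cons (b : Bool) (l : List Bool) : val (b :: l) = b.toNat + 2 * val l := rfl

theorem val_append (l l' : List Bool) : val (l ++ l') = val l + 2 ^ l.length * val l' := by
  induction l with
  | nil => simp
  | cons b l ih => simp only [List.cons_append, val_cons, ih, List.length_cons]; ring

theorem val_encodeNat (n : ℕ) : val (Computability.encodeNat n) = n := by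
  have h1 : ∀ p : PosNum, val (Computability.encodePosNum p) = (p : ℕ) := by
    intro p
    induction p with
    | one => rfl
    | bit0 p ih => simp [Computability.encodePosNum, ih]; omega
    | bit1 p ih => simp [Computability.encodePosNum, ih]; omega
  have h2 : ∀ m : Num, val (Computability.encodeNum m) = (m : ℕ) := by
    intro m
    cases m with
    | zero => rfl
    | pos p => exact h1 p
  rw [Computability.encodeNat, h2, Num.to_of_nat]

/-- A list of zeros. -/
def zeros {α : Type} (l : List α) : List Bool := l.map fun _ => false

@[simp] theorem val_zeros {α : Type} (l : List α) : val (zeros l) = 0 := by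
  induction l with
  | nil => rfl
  | cons a l ih => simpa [zeros] using ih

/-- Pairs of digits of two numbers, padded with leading zeros. -/
def zipPad (a b : List Bool) : List (Bool × Bool) := (a ++ zeros b).zip (b ++ zeros a)

theorem length_zipPad (a b : List Bool) : (zipPad a b).length = a.length + b.length := by
  simp [zipPad, zeros]; omega

theorem val_zipPad_fst (a b : List Bool) : val ((zipPad a b).map Prod.fst) = val a := by
  rw [zipPad, List.map_fst_zip (by simp [zeros]; omega), val_append]; simp

theorem val_zipPad_snd (a b : List Bool) : val ((zipPad a b).map Prod.snd) = val b := by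
  rw [zipPad, List.map_snd_zip (by simp [zeros]; omega), val_append]; simp

/-- One step of addition: the state consists of the digits so far and the carry. -/
def addStep (s : List Bool × Bool) (x : Bool × Bool) : List Bool × Bool :=
  ((x.1 ^^ x.2 ^^ s.2) :: s.1, (x.1 && x.2) || (s.2 && (x.1 ^^ x.2)))

/-- Addition of binary numbers. -/
def addBits (a b : List Bool) : List Bool :=
  (((zipPad a b).foldl addStep ([], false)).2 :: ((zipPad a b).foldl addStep ([], false)).1).reverse

/-- Invariant of the addition: digits so far, plus carry and remaining summands at the current
place. -/
theorem val_foldl_addStep (l : List (Bool × Bool)) (acc : List Bool) (c : Bool) :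
    val ((l.foldl addStep (acc, c)).2 :: (l.foldl addStep (acc, c)).1).reverse =
      val acc.reverse + 2 ^ acc.length *
        (c.toNat + val (l.map Prod.fst) + val (l.map Prod.snd)) := by
  induction l generalizing acc c with
  | nil => simp [val_append]
  | cons x l ih =>
    obtain ⟨x, y⟩ := x
    rw [List.foldl_cons, addStep, ih]
    simp only [List.reverse_cons, val_append, List.length_reverse, List.length_cons, List.map_cons,
      val_cons, val_nil]
    cases x <;> cases y <;> cases c <;> simp <;> ring

theorem val_addBits (a b : List Bool) : val (addBits a b) = val a + val b := by
  rw [addBits, val_foldl_addStep, val_zipPad_fst, val_zipPad_snd]; simp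

theorem length_addBits (a b : List Bool) : (addBits a b).length = a.length + b.length + 1 := by
  have : ∀ (l : List (Bool × Bool)) s, (l.foldl addStep s).1.length = s.1.length + l.length := by
    intro l
    induction l with
    | nil => simp
    | cons x l ih => intro s; rw [List.foldl_cons, ih, addStep]; simp; omega
  simp [addBits, this, length_zipPad]

/-- Multiplication of binary numbers. -/
def mulBits (a b : List Bool) : List Bool :=
  a.foldr (fun x acc => if x then addBits b (false :: acc) else false :: acc) []

theorem val_mulBits (a b : List Bool) : val (mulBits a b) = val a * val b := by
  induction a with
  | nil => simp [mulBits]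
  | cons x a ih =>
    rw [mulBits, List.foldr_cons, ← mulBits]
    cases x
    · simp [ih]; ring
    · simp [ih, val_addBits]; ring

/-- Comparison of binary numbers. -/
def leBits (a b : List Bool) : Bool :=
  (zipPad a b).foldl (fun s x => if x.1 ^^ x.2 then x.2 else s) true

theorem leBits_eq (a b : List Bool) : leBits a b = decide (val a ≤ val b) := by
  -- the state `s` is the result of the comparison of the lower digits
  have key : ∀ (l : List (Bool × Bool)) (s : Bool),
      l.foldl (fun s x => if x.1 ^^ x.2 then x.2 else s) s =
        decide (val (l.map Prod.fst) + (!s).toNat ≤ val (l.map Prod.snd)) := by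
    intro l
    induction l with
    | nil => intro s; cases s <;> simp
    | cons x l ih =>
      intro s
      obtain ⟨x, y⟩ := x
      rw [List.foldl_cons, ih]
      cases x <;> cases y <;> cases s <;> simp <;> omega
  rw [leBits, key, val_zipPad_fst, val_zipPad_snd]; simp

section
variable {ε : Type} [TreeEnc ε] {O : Oracles}

theorem sz_bits (l : List Bool) : sz l = 2 * l.length + 1 := by
  induction l with
  | nil => rfl
  | cons b l ih => rw [sz_cons, ih, sz_bool, List.length_cons]; omega

@[fun_prop]
theorem PolyF.zeros {α : Type} [TreeEnc α] {f : ε → List α} (hf : PolyF O f) :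
    PolyF O fun e => zeros (f e) :=
  PolyF.map (f := fun _ _ => false) (by fun_prop) hf

@[fun_prop]
theorem PolyF.zipPad {f g : ε → List Bool} (hf : PolyF O f) (hg : PolyF O g) :
    PolyF O fun e => zipPad (f e) (g e) := by
  unfold SubgroupDiscovery.zipPad; fun_prop

@[fun_prop]
theorem PolyF.addBits {f g : ε → List Bool} (hf : PolyF O f) (hg : PolyF O g) :
    PolyF O fun e => addBits (f e) (g e) := by
  have : PolyF O fun e => (SubgroupDiscovery.zipPad (f e) (g e)).foldl addStep ([], false) := by
    refine PolyF.foldl (f := fun _ => addStep) (T := fun n => n + 5) ?_ (by fun_prop) (by fun_prop)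
      (PolyB.id.add (.const 5)) fun e s a => ?_
    · unfold addStep; fun_prop
    · simp [addStep]; omega
  unfold SubgroupDiscovery.addBits; fun_prop

@[fun_prop]
theorem PolyF.mulBits {f g : ε → List Bool} (hf : PolyF O f) (hg : PolyF O g) :
    PolyF O fun e => mulBits (f e) (g e) := by
  have : PolyF O fun x : List Bool × List Bool => SubgroupDiscovery.mulBits x.1 x.2 := by
    refine PolyF.foldr (f := fun (x : List Bool × List Bool) (y : Bool) (acc : List Bool) =>
        if y then SubgroupDiscovery.addBits x.2 (false :: acc) else false :: acc)
      (T := fun n => n + 5) (by fun_prop) (by fun_prop) (by fun_prop)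
      (PolyB.id.add (.const 5)) fun e s a => ?_
    split
    · have h1 := sz_bits (SubgroupDiscovery.addBits e.2 (false :: s))
      have h2 := sz_bits e.2
      have h3 := sz_bits s
      rw [length_addBits, List.length_cons] at h1
      simp only [sz_pair]
      omega
    · simp only [sz_cons, sz_bool]; omega
  exact this.comp₂ hf hg

@[fun_prop]
theorem PolyF.leBits {f g : ε → List Bool} (hf : PolyF O f) (hg : PolyF O g) :
    PolyF O fun e => leBits (f e) (g e) := by
  refine PolyF.foldl (f := fun _ s (x : Bool × Bool) => if x.1 ^^ x.2 then x.2 else s)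
    (T := fun n => 0) (by fun_prop) (by fun_prop) (by fun_prop) (.const 0) fun e s a => by simp

end

/-! ### Parsing -/

/-- Split a string at a separator. A final empty part is dropped, so that the separator may also
be used as a terminator. -/
def splitSep (sep : Symb) (x : List Symb) : List (List Symb) :=
  x.foldr (fun c acc => if decide (c = sep) then [] :: acc else
    match acc with
    | [] => [[c]]
    | h :: t => (c :: h) :: t) []

@[simp] theorem splitSep_nil (sep : Symb) : splitSep sep [] = [] := rfl

theorem splitSep_append {sep : Symb} {x : List Symb} (hx : sep ∉ x) (y : List Symb) :
    splitSep sep (x ++ sep :: y) = x :: splitSep sep y := by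
  induction x with
  | nil => simp [splitSep]
  | cons c x ih =>
    rw [List.mem_cons, not_or] at hx
    have := ih hx.2
    rw [splitSep] at this ⊢
    rw [List.cons_append, List.foldr_cons, this, if_neg (by simpa using Ne.symm hx.1)]

theorem splitSep_of_notMem {sep : Symb} {x : List Symb} (hx : sep ∉ x) (h : x ≠ []) :
    splitSep sep x = [x] := by
  induction x with
  | nil => exact absurd rfl h
  | cons c x ih =>
    rw [List.mem_cons, not_or] at hx
    rw [splitSep, List.foldr_cons, if_neg (by simpa using Ne.symm hx.1)]
    change (match splitSep sep x with
      | [] => [[c]]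
      | h :: t => (c :: h) :: t) = _
    cases x with
    | nil => rfl
    | cons d x => rw [ih hx.2 (by simp)]

theorem splitSep_headD_of_notMem {sep : Symb} {x : List Symb} (hx : sep ∉ x) :
    (splitSep sep x).headD [] = x := by
  by_cases h : x = []
  · simp [h]
  · rw [splitSep_of_notMem hx h]; rfl

theorem splitSep_flatten {sep : Symb} {l : List (List Symb)} (hl : ∀ x ∈ l, sep ∉ x) :
    splitSep sep (l.map fun x => x ++ [sep]).flatten = l := by
  induction l with
  | nil => rfl
  | cons x l ih =>
    rw [List.map_cons, List.flatten_cons, List.append_assoc, List.singleton_append,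
      splitSep_append (hl x (by simp)), ih fun y hy => hl y (by simp [hy])]

theorem notMem_encNat {s : Symb} (hs : ∀ b, s ≠ .bit b) (n : ℕ) : s ∉ encNat n := by
  simp only [encNat, List.mem_map, not_exists, not_and]
  exact fun b _ h => hs b h.symm

theorem notMem_encVec {s : Symb} (hs : ∀ b, s ≠ .bit b) {d : ℕ} (v : Fin d → Bool) :
    s ∉ encVec v := by
  simp only [encVec, List.mem_map, not_exists, not_and]
  exact fun b _ h => hs b h.symm

theorem notMem_encRat {s : Symb} (hs : ∀ b, s ≠ .bit b) (h1 : s ≠ .minus) (h2 : s ≠ .slash)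
    (q : ℚ) : s ∉ encRat q := by
  have h3 := notMem_encNat hs q.num.natAbs
  have h4 := notMem_encNat hs q.den
  rw [encRat]
  split <;> simp [h1, h2, h3, h4]

theorem notMem_encMatrix {s : Symb} (hs : ∀ b, s ≠ .bit b) (h1 : s ≠ .minus) (h2 : s ≠ .slash)
    (h3 : s ≠ .comma) (h4 : s ≠ .semicolon) {m n : ℕ} (X : Matrix (Fin m) (Fin n) ℚ) :
    s ∉ encMatrix X := by
  simp [encMatrix, List.mem_flatten, notMem_encRat hs h1 h2, h3, h4]

/-! ### Comparison of bounds -/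

/-- Does the string start with a minus sign? -/
def isNeg (x : List Symb) : Bool := (fun s => decide (s = Symb.minus)) (x.headD .comma)

/-- Remove a leading minus sign. -/
def dropSign (x : List Symb) : List Symb := if isNeg x then x.tail else x

/-- The digit denoted by a symbol. Infinity is treated as the fraction `1/0`. -/
def digit : Symb → Bool
  | .bit b => b
  | .infty => true
  | _ => false

/-- The digits of the numerator of an encoded bound. -/
def numDigits (x : List Symb) : List Bool := ((splitSep .slash (dropSign x)).headD []).map digit

/-- The digits of the denominator of an encoded bound. -/
def denDigits (x : List Symb) : List Bool :=
  ((splitSep .slash (dropSign x)).tail.headD []).map digit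

/-- Comparison of encoded bounds by cross-multiplication. -/
def leStr (x y : List Symb) : Bool :=
  if isNeg x then
    if isNeg y then
      leBits (mulBits (numDigits y) (denDigits x)) (mulBits (numDigits x) (denDigits y))
    else true
  else
    if isNeg y then false
    else leBits (mulBits (numDigits x) (denDigits y)) (mulBits (numDigits y) (denDigits x))

theorem isNeg_encRat (q : ℚ) : isNeg (encRat q) = decide (q < 0) := by
  rw [encRat]
  by_cases h : q < 0
  · simp [h, isNeg]
  · rw [if_neg h]
    have := notMem_encNat (s := .minus) (by simp) q.num.natAbs
    simp only [List.nil_append, h, decide_false, isNeg]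
    cases hk : encNat q.num.natAbs with
    | nil => simp
    | cons s l =>
      rw [hk] at this
      simp at this ⊢
      exact fun h => this.1 h.symm

theorem dropSign_encRat (q : ℚ) :
    dropSign (encRat q) = encNat q.num.natAbs ++ .slash :: encNat q.den := by
  rw [dropSign, isNeg_encRat]
  by_cases h : q < 0 <;> simp [h, encRat]

theorem map_digit_encNat (n : ℕ) : val ((encNat n).map digit) = n := by
  have : ∀ l : List Bool, (l.map Symb.bit).map digit = l := by
    intro l; simp [Function.comp_def, digit]
  rw [encNat, this, val_encodeNat]

theorem val_numDigits_encRat (q : ℚ) : val (numDigits (encRat q)) = q.num.natAbs := by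
  rw [numDigits, dropSign_encRat, splitSep_append (notMem_encNat (by simp) _)]
  exact map_digit_encNat _

theorem val_denDigits_encRat (q : ℚ) : val (denDigits (encRat q)) = q.den := by
  rw [denDigits, dropSign_encRat, splitSep_append (notMem_encNat (by simp) _), List.tail_cons,
    splitSep_headD_of_notMem (notMem_encNat (by simp) _)]
  exact map_digit_encNat _

theorem leStr_encRat (p q : ℚ) : leStr (encRat p) (encRat q) = decide (p ≤ q) := by
  simp only [leStr, leBits_eq, val_mulBits, isNeg_encRat, val_numDigits_encRat,
    val_denDigits_encRat]
  have hp := p.den_pos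
  have hq := q.den_pos
  have h0 := Rat.num_neg (a := p)
  have h1 := Rat.num_neg (a := q)
  have hle := Rat.le_iff p q
  have e1 : ((p.num.natAbs * q.den : ℕ) : ℤ) = |p.num| * q.den := by push_cast; rfl
  have e2 : ((q.num.natAbs * p.den : ℕ) : ℤ) = |q.num| * p.den := by push_cast; rfl
  by_cases hp0 : p < 0 <;> by_cases hq0 : q < 0
  · simp only [hp0, hq0, decide_true, if_true, decide_eq_decide]
    rw [← Int.ofNat_le, e1, e2, abs_of_neg (h0.2 hp0), abs_of_neg (h1.2 hq0), hle]
    constructor <;> intro h <;> linarith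
  · simp [hp0, hq0]; linarith
  · simp [hp0, hq0]; linarith
  · simp only [hp0, hq0, decide_false, Bool.false_eq_true, if_false, decide_eq_decide]
    rw [← Int.ofNat_le, e1, e2, abs_of_nonneg (by rw [← not_lt, h0]; exact hp0),
      abs_of_nonneg (by rw [← not_lt, h1]; exact hq0), hle]

/-- Comparison of bounds. -/
def Bound.le (x y : Bound) : Bool := leStr (encBound x) (encBound y)

theorem Bound.le_iff (x y : Bound) : x.le y = true ↔ x.toEReal ≤ y.toEReal := by
  have hn : ∀ q : ℚ, 0 < q.den := fun q => q.den_pos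
  have hinf1 : isNeg [Symb.infty] = false := rfl
  have hinf2 : val (numDigits [Symb.infty]) = 1 := rfl
  have hinf3 : val (denDigits [Symb.infty]) = 0 := rfl
  have hinf4 : isNeg [Symb.minus, Symb.infty] = true := rfl
  have hinf5 : val (numDigits [Symb.minus, Symb.infty]) = 1 := rfl
  have hinf6 : val (denDigits [Symb.minus, Symb.infty]) = 0 := rfl
  cases x with
  | negInf =>
    cases y with
    | negInf => simp [Bound.le, encBound, leStr, leBits_eq, val_mulBits, hinf4, hinf5, hinf6,
        Bound.toEReal]
    | rat q =>
      by_cases hq : q < 0 <;>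
        simp [Bound.le, encBound, leStr, leBits_eq, val_mulBits, hinf4, hinf5, hinf6, Bound.toEReal,
          isNeg_encRat, val_numDigits_encRat, val_denDigits_encRat, hq]
    | posInf => simp [Bound.le, encBound, leStr, hinf1, hinf4, Bound.toEReal]
  | rat p =>
    cases y with
    | negInf =>
      by_cases hp : p < 0 <;>
        simp [Bound.le, encBound, leStr, leBits_eq, val_mulBits, hinf4, hinf5, hinf6, Bound.toEReal,
          isNeg_encRat, val_numDigits_encRat, val_denDigits_encRat, hp, (hn p).ne']
    | rat q => simp [Bound.le, encBound, leStr_encRat, Bound.toEReal]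
    | posInf =>
      by_cases hp : p < 0 <;>
        simp [Bound.le, encBound, leStr, leBits_eq, val_mulBits, hinf1, hinf2, hinf3, Bound.toEReal,
          isNeg_encRat, val_numDigits_encRat, val_denDigits_encRat, hp]
  | posInf =>
    cases y with
    | negInf => simp [Bound.le, encBound, leStr, hinf1, hinf4, Bound.toEReal]
    | rat q =>
      by_cases hq : q < 0 <;>
        simp [Bound.le, encBound, leStr, leBits_eq, val_mulBits, hinf1, hinf2, hinf3, Bound.toEReal,
          isNeg_encRat, val_numDigits_encRat, val_denDigits_encRat, hq, (hn q).ne']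
    | posInf => simp [Bound.le, encBound, leStr, leBits_eq, val_mulBits, hinf1, hinf2, hinf3,
        Bound.toEReal]

/-- Bounds are represented by their encodings as strings. -/
instance : TreeEnc Bound := ⟨fun b => enc (encBound b)⟩

/-- Thresholds are represented by their encodings as strings. -/
instance : TreeEnc ℚ≥0 := ⟨fun q => enc (encRat q)⟩

section
variable {α β ε : Type} [TreeEnc α] [TreeEnc β] [TreeEnc ε] {O : Oracles}

theorem PolyF.encBound {f : ε → Bound} (hf : PolyF O f) : PolyF O fun e => encBound (f e) :=
  hf.congr_enc fun _ => rfl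

@[fun_prop]
theorem PolyF.splitSep (sep : Symb) {f : ε → List Symb} (hf : PolyF O f) :
    PolyF O fun e => splitSep sep (f e) := by
  refine PolyF.foldr (f := fun _ c (acc : List (List Symb)) =>
    if decide (c = sep) then [] :: acc else
    match acc with
    | [] => [[c]]
    | h :: t => (c :: h) :: t) (T := fun n => n + 5) ?_ hf (by fun_prop)
    (PolyB.id.add (.const 5)) fun e s a => ?_
  · refine PolyF.cond ((PolyF.ofSymb fun c => decide (c = sep)).comp (by fun_prop)) (by fun_prop) ?_
    refine (PolyF.listCases (O := O) (l := fun x : (ε × List (List Symb)) × Symb => x.1.2)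
      (f := fun x => [[x.2]]) (g := fun x h t => (x.2 :: h) :: t) (by fun_prop) (by fun_prop)
      (by fun_prop)).congr_enc fun x => ?_
    cases x.1.2 <;> rfl
  · split
    · simp only [sz_cons, sz_nil]; omega
    · cases s with
      | nil => simp only [sz_cons, sz_nil, sz_symb]; omega
      | cons h t => simp only [sz_cons, sz_symb]; omega

@[fun_prop]
theorem PolyF.isNeg {f : ε → List Symb} (hf : PolyF O f) : PolyF O fun e => isNeg (f e) :=
  (PolyF.ofSymb fun s => decide (s = Symb.minus)).comp (by fun_prop)

@[fun_prop]
theorem PolyF.dropSign {f : ε → List Symb} (hf : PolyF O f) : PolyF O fun e => dropSign (f e) := by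
  unfold SubgroupDiscovery.dropSign; fun_prop

@[fun_prop]
theorem PolyF.numDigits {f : ε → List Symb} (hf : PolyF O f) : PolyF O fun e => numDigits (f e) :=
  PolyF.map_symb digit (by fun_prop)

@[fun_prop]
theorem PolyF.denDigits {f : ε → List Symb} (hf : PolyF O f) : PolyF O fun e => denDigits (f e) :=
  PolyF.map_symb digit (by fun_prop)

@[fun_prop]
theorem PolyF.boundLe {f g : ε → Bound} (hf : PolyF O f) (hg : PolyF O g) :
    PolyF O fun e => (f e).le (g e) := by
  have h1 := hf.encBound
  have h2 := hg.encBound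
  unfold Bound.le leStr
  fun_prop

theorem enc_map {f : α → β} (hf : ∀ a, enc (f a) = enc a) (l : List α) :
    enc (l.map f) = enc l := by
  induction l with
  | nil => rfl
  | cons a l ih => exact congrArg₂ Tree.node (hf a) ih

theorem enc_encVec {d : ℕ} (v : Fin d → Bool) : enc (encVec v) = enc (List.ofFn v) :=
  enc_map (f := Symb.bit) (fun _ => rfl) _

end

/-! ### The search algorithm -/

/-- What the search needs to know about a pair of bounds for a feature: the bounds, and for each
data object whether they admit it. -/
abbrev Entry : Type := Bound × (Bound × List Bool)

/-- The entry for a pair of bounds for the feature with values `col`. -/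
def mkEntry (col : List Bound) (v v' : Bound) : Entry :=
  (v, (v', col.map fun x => v.le x && x.le v'))

/-- The entry that admits all data objects. -/
def trivialEntry (col : List Bound) : Entry := mkEntry col .negInf .posInf

/-- The entries for all pairs of bounds that are infinite or occur in the column. -/
def entries (col : List Bound) : List Entry :=
  (Bound.negInf :: .posInf :: col).flatMap fun v =>
    (Bound.negInf :: .posInf :: col).map fun v' => mkEntry col v v'

/-- Extend candidates for the features to the right by one feature. Each candidate comes with the
number (in unary) of features for which nontrivial bounds may still be chosen. -/
def extend (L : List (List Bool × List Entry)) (col : List Bound) :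
    List (List Bool × List Entry) :=
  L.flatMap fun x => (x.1, trivialEntry col :: x.2) ::
    (match x.1 with
    | [] => []
    | _ :: r => (entries col).map fun e => (r, e :: x.2))

/-- The feature-selection vector of a candidate. -/
def selVec (c : List Entry) : List Bool := c.map fun e => !(e.2.2.all fun b => b)

/-- The membership vector of a candidate; `ones` consists of as many ones as there are data
objects. -/
def memVec (ones : List Bool) (c : List Entry) : List Bool :=
  c.foldr (fun e acc => List.zipWith (fun x y => x && y) e.2.2 acc) ones

/-- The columns of a matrix that is given by its rows. The list `nv` has as many elements as there
are columns. -/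
def columns (rows : List (List Bound)) (nv : List Bool) : List (List Bound) :=
  rows.foldr (fun row acc => List.zipWith (fun x y => x :: y) row acc) (nv.map fun _ => [])

/-- A list whose length is the smaller one of the lengths of `nv` and `l`; only its length
matters. -/
def truncTo (nv l : List Bool) : List Bool := (nv.zip l).map Prod.fst

/-- The unary representation of the minimum of a binary number and the length of `nv`. The result
is truncated after each doubling, because the number itself may be exponentially large. -/
def unaryMin (nv digits : List Bool) : List Bool :=
  digits.foldr (fun d acc => truncTo nv (acc ++ acc ++ if d then [true] else [])) []

/-- The vector of the first `d` entries of a list. -/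
def vec (d : ℕ) (l : List Bool) : Fin d → Bool := fun i => l.getD i false

theorem ofFn_vec {d : ℕ} {l : List Bool} (h : l.length = d) : List.ofFn (vec d l) = l := by
  subst h
  refine List.ext_getElem (by simp) fun i h1 h2 => ?_
  simp [vec, h2]

theorem vec_ofFn {d : ℕ} (v : Fin d → Bool) : vec d (List.ofFn v) = v := by
  funext i
  simp [vec]

/-- `l` padded or truncated to the length of `l'`. -/
def fit (l l' : List Bool) : List Bool := ((l ++ zeros l').zip l').map Prod.fst

theorem length_fit (l l' : List Bool) : (fit l l').length = l'.length := by
  simp [fit, zeros]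

theorem fit_eq {l l' : List Bool} (h : l.length = l'.length) : fit l l' = l := by
  have : (l ++ zeros l').zip l' = l.zip l' := by
    have := List.zip_append (l₁ := l) (r₁ := zeros l') (l₂ := l') (r₂ := []) h
    simpa using this
  rw [fit, this, List.map_fst_zip h.le]

/-- The question to the dissimilarity measure for vectors given as lists. The lengths are forced to
agree, so that every input gives a legitimate question. -/
def mkDis (s s' : List Bool) (τ : ℚ≥0) : DisQuery where
  d := s'.length
  s := vec _ (fit s s')
  s' := vec _ s'
  τ := τ
  τ_nonneg := τ.2

theorem mkDis_eq {d : ℕ} (v v' : Fin d → Bool) (τ : ℚ≥0) :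
    mkDis (List.ofFn v) (List.ofFn v') τ = ⟨d, v, v', τ, τ.2⟩ := by
  have key : ∀ s s' : List Bool, s.length = d → s'.length = d →
      mkDis s s' τ = ⟨d, vec d s, vec d s', τ, τ.2⟩ := by
    intro s s' h h'
    subst h'
    rw [mkDis, fit_eq h]
  rw [key _ _ (by simp) (by simp), vec_ofFn, vec_ofFn]

/-- The question to the similarity measure for vectors given as lists. The lengths are forced to
agree, so that every input gives a legitimate question. -/
def mkSim (b b' b₀ : List Bool) : SimQuery where
  d := b₀.length
  b := vec _ (fit b b₀)
  b' := vec _ (fit b' b₀)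
  b₀ := vec _ b₀

theorem mkSim_eq {d : ℕ} (v v' v₀ : Fin d → Bool) :
    mkSim (List.ofFn v) (List.ofFn v') (List.ofFn v₀) = ⟨d, v, v', v₀⟩ := by
  have key : ∀ s s' s₀ : List Bool, s.length = d → s'.length = d → s₀.length = d →
      mkSim s s' s₀ = ⟨d, vec d s, vec d s', vec d s₀⟩ := by
    intro s s' s₀ h h' h₀
    subst h₀
    rw [mkSim, fit_eq h, fit_eq h']
  rw [key _ _ _ (by simp) (by simp) (by simp), vec_ofFn, vec_ofFn, vec_ofFn]

/-- The data needed to evaluate candidates: the original membership vector, the existing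
feature-selection vectors, the threshold, and as many ones as there are data objects. -/
abbrev Context : Type := List Bool × (List (List Bool) × (ℚ≥0 × List Bool))

section
variable (simT : SimQuery → Bool) (disT : DisQuery → Bool)

/-- Is the candidate dissimilar to all existing subgroups? -/
def feasible (x : Context) (c : List Entry) : Bool :=
  x.2.1.all fun s => disT (mkDis (selVec c) s x.2.2.1)

/-- Compare a candidate with the best candidate so far (if there is one). -/
def better (x : Context) (s : List (List Entry)) (c : List Entry) : List (List Entry) :=
  match s with
  | [] => [c]
  | c' :: _ =>
    if simT (mkSim (memVec x.2.2.2 c') (memVec x.2.2.2 c) x.1) then [c] else s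

/-- A best feasible candidate, if there is one. -/
def bestOf (x : Context) (L : List (List Bool × List Entry)) : List (List Entry) :=
  ((L.map Prod.snd).filter (feasible disT x)).foldl (better simT x) []

/-- The encoded answer. -/
def printAnswer : List (List Entry) → List Symb
  | [] => [.bar]
  | c :: _ => (c.map fun e =>
      encBound e.1 ++ [Symb.comma] ++ encBound e.2.1 ++ [Symb.semicolon]).flatten

end

/-! ### The search algorithm runs in polynomial time -/

/-- Questions are represented by their encodings as strings. -/
instance : TreeEnc DisQuery := ⟨fun Q => enc (encDisQuery Q)⟩

/-- Questions are represented by their encodings as strings. -/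
instance : TreeEnc SimQuery := ⟨fun Q => enc (encSimQuery Q)⟩

section
variable {ε : Type} [TreeEnc ε] {O : Oracles}

@[fun_prop]
theorem PolyF.mkEntry {f : ε → List Bound} {g h : ε → Bound} (hf : PolyF O f) (hg : PolyF O g)
    (hh : PolyF O h) : PolyF O fun e => mkEntry (f e) (g e) (h e) := by
  have : PolyF O fun e => (f e).map fun x => (g e).le x && x.le (h e) :=
    PolyF.map (f := fun e x => (g e).le x && x.le (h e)) (by fun_prop) hf
  unfold SubgroupDiscovery.mkEntry; fun_prop

@[fun_prop]
theorem PolyF.trivialEntry {f : ε → List Bound} (hf : PolyF O f) :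
    PolyF O fun e => trivialEntry (f e) := by
  unfold SubgroupDiscovery.trivialEntry; fun_prop

@[fun_prop]
theorem PolyF.entries {f : ε → List Bound} (hf : PolyF O f) :
    PolyF O fun e => entries (f e) := by
  refine PolyF.flatMap (f := fun e v => (Bound.negInf :: .posInf :: f e).map fun v' =>
    SubgroupDiscovery.mkEntry (f e) v v') ?_ (by fun_prop)
  exact PolyF.map (f := fun (x : ε × Bound) v' => SubgroupDiscovery.mkEntry (f x.1) x.2 v')
    (by fun_prop) (by fun_prop)

@[fun_prop]
theorem PolyF.extend {f : ε → List (List Bool × List Entry)} {g : ε → List Bound}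
    (hf : PolyF O f) (hg : PolyF O g) : PolyF O fun e => extend (f e) (g e) := by
  refine PolyF.flatMap (f := fun e x => (x.1, SubgroupDiscovery.trivialEntry (g e) :: x.2) ::
    (match x.1 with
    | [] => []
    | _ :: r => (SubgroupDiscovery.entries (g e)).map fun e => (r, e :: x.2))) ?_ hf
  refine PolyF.cons (by fun_prop) ((PolyF.listCases (O := O)
    (l := fun x : ε × (List Bool × List Entry) => x.2.1) (f := fun _ => [])
    (g := fun x _ r => (SubgroupDiscovery.entries (g x.1)).map fun e => (r, e :: x.2.2))
    (by fun_prop) (by fun_prop) ?_).congr_enc fun x => by cases x.2.1 <;> rfl)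
  exact PolyF.map (f := fun (x : (ε × (List Bool × List Entry)) × (Bool × List Bool)) e =>
    (x.2.2, e :: x.1.2.2)) (by fun_prop) (by fun_prop)

@[fun_prop]
theorem PolyF.selVec {f : ε → List Entry} (hf : PolyF O f) : PolyF O fun e => selVec (f e) := by
  refine PolyF.map (f := fun _ (e : Entry) => !(e.2.2.all fun b => b)) ?_ hf
  exact (PolyF.all (f := fun _ b => b) (by fun_prop) (by fun_prop)).not

@[fun_prop]
theorem PolyF.memVec {g : ε → List Bool} {f : ε → List Entry} (hg : PolyF O g) (hf : PolyF O f) :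
    PolyF O fun e => memVec (g e) (f e) := by
  refine PolyF.foldr (f := fun _ (e : Entry) acc => List.zipWith (fun x y => x && y) e.2.2 acc)
    (T := fun _ => 0) ?_ hf hg (.const 0) fun e s a => ?_
  · exact PolyF.zipWith (f := fun _ x y => x && y) (by fun_prop) (by fun_prop) (by fun_prop)
  · rw [sz_bits, sz_bits, List.length_zipWith]; omega

@[fun_prop]
theorem PolyF.columns {f : ε → List (List Bound)} {g : ε → List Bool} (hf : PolyF O f)
    (hg : PolyF O g) : PolyF O fun e => columns (f e) (g e) := by
  have h0 : PolyF O fun e => (g e).map fun _ => ([] : List Bound) :=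
    PolyF.map (f := fun _ _ => []) (by fun_prop) hg
  refine PolyF.foldr (f := fun _ (row : List Bound) acc => List.zipWith (fun x y => x :: y) row acc)
    (T := fun n => n) ?_ hf h0 PolyB.id fun e s a => ?_
  · exact PolyF.zipWith (f := fun _ x y => x :: y) (by fun_prop) (by fun_prop) (by fun_prop)
  · suffices sz (List.zipWith (fun x y => x :: y) a s) ≤ sz s + sz a by omega
    induction a generalizing s with
    | nil => simp
    | cons x a ih =>
      cases s with
      | nil => simp
      | cons y s =>
        have := ih s
        simp only [List.zipWith_cons_cons, sz_cons]
        omega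

@[fun_prop]
theorem PolyF.truncTo {f g : ε → List Bool} (hf : PolyF O f) (hg : PolyF O g) :
    PolyF O fun e => truncTo (f e) (g e) :=
  PolyF.map (f := fun _ (x : Bool × Bool) => x.1) (by fun_prop) (by fun_prop)

@[fun_prop]
theorem PolyF.unaryMin {f g : ε → List Bool} (hf : PolyF O f) (hg : PolyF O g) :
    PolyF O fun e => unaryMin (f e) (g e) := by
  have : PolyF O fun x : List Bool × List Bool => SubgroupDiscovery.unaryMin x.1 x.2 := by
    refine PolyF.foldr (f := fun (x : List Bool × List Bool) (d : Bool) (acc : List Bool) =>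
      SubgroupDiscovery.truncTo x.1 (acc ++ acc ++ if d then [true] else []))
      (T := fun n => n) (by fun_prop) (by fun_prop) (by fun_prop) PolyB.id fun e s a => ?_
    have h1 := sz_bits (SubgroupDiscovery.truncTo e.1 (s ++ s ++ if a then [true] else []))
    have h2 := sz_bits e.1
    have h3 : (SubgroupDiscovery.truncTo e.1 (s ++ s ++ if a then [true] else [])).length ≤
        e.1.length := by simp [SubgroupDiscovery.truncTo]
    rw [sz_pair]
    omega
  exact this.comp₂ hf hg

@[fun_prop]
theorem PolyF.fit {f g : ε → List Bool} (hf : PolyF O f) (hg : PolyF O g) :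
    PolyF O fun e => fit (f e) (g e) :=
  PolyF.map (f := fun _ (x : Bool × Bool) => x.1) (by fun_prop) (by fun_prop)

theorem PolyF.mapBit {f : ε → List Bool} (hf : PolyF O f) :
    PolyF O fun e => (f e).map Symb.bit :=
  hf.congr_enc fun _ => enc_map (f := Symb.bit) (fun _ => rfl) _

theorem PolyF.mkDis {s s' : ε → List Bool} {τ : ε → ℚ≥0} (hs : PolyF O s) (hs' : PolyF O s')
    (hτ : PolyF O τ) : PolyF O fun e => mkDis (s e) (s' e) (τ e) := by
  have h1 := (hs.fit hs').mapBit
  have h2 := hs'.mapBit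
  have h3 : PolyF O fun e => encRat (τ e) := hτ.congr_enc fun _ => rfl
  have : PolyF O fun e => (SubgroupDiscovery.fit (s e) (s' e)).map Symb.bit ++ [Symb.comma] ++
    (s' e).map Symb.bit ++ [Symb.comma] ++ encRat (τ e) := by fun_prop
  refine this.congr_enc fun e => ?_
  refine congrArg (TreeEnc.enc : List Symb → Tree)
    (a₁ := encDisQuery (SubgroupDiscovery.mkDis (s e) (s' e) (τ e))) ?_
  simp only [encDisQuery, SubgroupDiscovery.mkDis, encVec, ofFn_vec (length_fit _ _), ofFn_vec rfl]

theorem PolyF.mkSim {b b' b₀ : ε → List Bool} (hb : PolyF O b) (hb' : PolyF O b')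
    (hb₀ : PolyF O b₀) : PolyF O fun e => mkSim (b e) (b' e) (b₀ e) := by
  have h1 := (hb.fit hb₀).mapBit
  have h2 := (hb'.fit hb₀).mapBit
  have h3 := hb₀.mapBit
  have : PolyF O fun e => (SubgroupDiscovery.fit (b e) (b₀ e)).map Symb.bit ++ [Symb.comma] ++
    (SubgroupDiscovery.fit (b' e) (b₀ e)).map Symb.bit ++ [Symb.comma] ++
    (b₀ e).map Symb.bit := by fun_prop
  refine this.congr_enc fun e => ?_
  refine congrArg (TreeEnc.enc : List Symb → Tree)
    (a₁ := encSimQuery (SubgroupDiscovery.mkSim (b e) (b' e) (b₀ e))) ?_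
  simp only [encSimQuery, SubgroupDiscovery.mkSim, encVec, ofFn_vec (length_fit _ _), ofFn_vec rfl]

variable {simT : SimQuery → Bool} {disT : DisQuery → Bool}

theorem PolyF.feasible (hdis : PolyF O disT) {x : ε → Context} {c : ε → List Entry}
    (hx : PolyF O x) (hc : PolyF O c) : PolyF O fun e => feasible disT (x e) (c e) := by
  refine PolyF.all (f := fun e s => disT (SubgroupDiscovery.mkDis
    (SubgroupDiscovery.selVec (c e)) s (x e).2.2.1)) ?_ (by fun_prop)
  exact hdis.comp (PolyF.mkDis (by fun_prop) (by fun_prop) (by fun_prop))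

theorem PolyF.bestOf (hsim : PolyF O simT) (hdis : PolyF O disT) :
    PolyF O fun x : Context × List (List Bool × List Entry) => bestOf simT disT x.1 x.2 := by
  have h1 : PolyF O fun x : Context × List (List Bool × List Entry) =>
      (x.2.map Prod.snd).filter (SubgroupDiscovery.feasible disT x.1) := by
    refine PolyF.filter (f := fun (x : Context × List (List Bool × List Entry)) c =>
      SubgroupDiscovery.feasible disT x.1 c) (PolyF.feasible hdis (by fun_prop) (by fun_prop)) ?_
    exact PolyF.map (f := fun _ (x : List Bool × List Entry) => x.2) (by fun_prop) (by fun_prop)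
  refine PolyF.foldl (f := fun (x : Context × List (List Bool × List Entry)) s c =>
    better simT x.1 s c) (T := fun n => n + 2) ?_ h1 (by fun_prop) (PolyB.id.add (.const 2))
    fun e s c => ?_
  · have h2 : PolyF O fun x : ((((Context × List (List Bool × List Entry)) × List (List Entry)) ×
        List Entry) × (List Entry × List (List Entry))) =>
        simT (SubgroupDiscovery.mkSim (SubgroupDiscovery.memVec x.1.1.1.1.2.2.2 x.2.1)
          (SubgroupDiscovery.memVec x.1.1.1.1.2.2.2 x.1.2) x.1.1.1.1.1) :=
      hsim.comp (PolyF.mkSim (by fun_prop) (by fun_prop) (by fun_prop))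
    refine (PolyF.listCases (O := O)
      (l := fun x : (((Context × List (List Bool × List Entry)) × List (List Entry)) ×
        List Entry) => x.1.2) (f := fun x => [x.2]) (g := fun x c' _ =>
          if simT (SubgroupDiscovery.mkSim (SubgroupDiscovery.memVec x.1.1.1.2.2.2 c')
          (SubgroupDiscovery.memVec x.1.1.1.2.2.2 x.2) x.1.1.1.1) then [x.2] else x.1.2)
      (by fun_prop) (by fun_prop) (h2.cond (by fun_prop) (by fun_prop))).congr_enc fun x => ?_
    obtain ⟨⟨x, s⟩, c⟩ := x
    cases s <;> rfl
  · have h3 := sz_pos s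
    cases s with
    | nil => simp only [better, sz_cons, sz_nil]; omega
    | cons c' s =>
      simp only [better]
      split
      · simp only [sz_cons, sz_nil] at h3 ⊢; omega
      · omega

theorem PolyF.printAnswer {f : ε → List (List Entry)} (hf : PolyF O f) :
    PolyF O fun e => printAnswer (f e) := by
  refine (PolyF.listCases (f := fun _ => [Symb.bar]) (g := fun _ c _ => (c.map fun e : Entry =>
      SubgroupDiscovery.encBound e.1 ++ [Symb.comma] ++ SubgroupDiscovery.encBound e.2.1 ++
        [Symb.semicolon]).flatten) hf (by fun_prop)
      (PolyF.flatten ?_)).congr_enc fun x => by cases f x <;> rfl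
  refine PolyF.map (f := fun _ (e : Entry) =>
    SubgroupDiscovery.encBound e.1 ++ [Symb.comma] ++ SubgroupDiscovery.encBound e.2.1 ++
      [Symb.semicolon]) ?_ (by fun_prop)
  have h1 : PolyF O fun x : (ε × (List Entry × List (List Entry))) × Entry =>
      SubgroupDiscovery.encBound x.2.1 :=
    PolyF.encBound (by fun_prop)
  have h2 : PolyF O fun x : (ε × (List Entry × List (List Entry))) × Entry =>
      SubgroupDiscovery.encBound x.2.2.1 :=
    PolyF.encBound (by fun_prop)
  fun_prop

end

/-! ### Questions to the measures are answered by the oracle machines -/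

theorem PolyB.eval (p : Polynomial ℕ) : PolyB fun n => p.eval n := by
  induction p using Polynomial.induction_on' with
  | add p q hp hq => simpa using hp.add hq
  | monomial d a =>
    refine ((PolyB.const a).mul (PolyB.pow d)).mono fun n => ?_
    rw [Polynomial.eval_monomial]
    exact Nat.mul_le_mul_left _ (Nat.pow_le_pow_left (by omega) _)

/-- A predicate that is decided by an oracle machine in polynomial time is computable. -/
theorem PolyF.oracle {O : Oracles} {Q : Type} [TreeEnc Q] {ea : Q → List Symb}
    (henc : ∀ q, enc q = enc (ea q)) (o : Bool) {f : Q → Bool} (time : Polynomial ℕ)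
    (h : ∀ q, Nonempty (TM2OutputsInTime (O.ask o).tm ((ea q).map (O.ask o).inputAlphabet.symm)
      (some ([f q].map (O.ask o).outputAlphabet.symm)) (time.eval (ea q).length))) :
    PolyF O f := by
  obtain ⟨c, hc⟩ := PolyB.eval time
  refine .intro (callOracle o) (fun n => 8 * n + (n + 2) ^ c * (maxCost O o + 2) + 10)
    ((((PolyB.const 8).mul .id).add ((PolyB.pow c).mul (.const _))).add (.const _)) fun q m => ?_
  have h1 := runsIn_callOracle o m (ea q) (f q) _ (h q)
  rw [henc, enc_list_symb]
  refine h1.mono ?_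
  have h2 : sz q = 2 * (ea q).length + 1 := by
    rw [sz, henc, enc_list_symb, size_strTree]
  have h3 : time.eval (ea q).length ≤ (sz q + 2) ^ c :=
    (hc _).trans (Nat.pow_le_pow_left (by omega) _)
  have h4 := Nat.mul_le_mul_right (maxCost O o + 2) h3
  omega

open Classical in
/-- The answers to the questions to a similarity measure. -/
noncomputable def simTest (sim : VectorMeasure) (Q : SimQuery) : Bool :=
  decide (sim Q.d Q.b Q.b₀ ≤ sim Q.d Q.b' Q.b₀)

open Classical in
/-- The answers to the questions to a dissimilarity measure. -/
noncomputable def disTest (dis : VectorMeasure) (Q : DisQuery) : Bool :=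
  decide ((Q.τ : ℝ) ≤ dis Q.d Q.s Q.s')

/-- Both tests are computable with the machines from the hypotheses as oracles. -/
theorem exists_oracles {sim dis : VectorMeasure} (hsim : PolyTimeComparable sim)
    (hdis : PolyTimeThreshold dis) :
    ∃ O : Oracles, PolyF O (simTest sim) ∧ PolyF O (disTest dis) := by
  obtain ⟨A⟩ := hsim
  obtain ⟨B⟩ := hdis
  refine ⟨⟨fun o => match o with
    | true => A.toTM2ComputableAux
    | false => B.toTM2ComputableAux⟩, ?_, ?_⟩
  · exact PolyF.oracle (ea := encSimQuery) (fun _ => rfl) true A.time fun Q => ⟨A.outputsFun Q⟩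
  · exact PolyF.oracle (ea := encDisQuery) (fun _ => rfl) false B.time fun Q => ⟨B.outputsFun Q⟩

/-! ### Reading an instance -/

/-- The rows of the dataset. -/
def Instance.rows (I : Instance) : List (List Bound) :=
  List.ofFn fun i => List.ofFn fun j => Bound.rat (I.X i j)

/-- The feature-selection vectors of the existing subgroups. -/
def Instance.selections (I : Instance) : List (List Bool) := List.ofFn fun l => List.ofFn (I.s l)

/-- The threshold as a nonnegative rational number. -/
def Instance.threshold (I : Instance) : ℚ≥0 := ⟨I.τ, I.τ_nonneg⟩

/-- The data of the instance that are needed to evaluate candidates. -/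
def Instance.context (I : Instance) : Context :=
  (List.ofFn I.original, (I.selections, (I.threshold, (List.ofFn I.original).map fun _ => true)))

/-- A list with as many elements as there are features. -/
def Instance.units (I : Instance) : List Bool := I.selections.headD []

/-- The columns of the dataset. -/
def Instance.cols (I : Instance) : List (List Bound) := columns I.rows I.units

theorem headD_ofFn {α : Type} {a : ℕ} (h : 0 < a) (g : Fin a → α) (d : α) :
    (List.ofFn g).headD d = g ⟨0, h⟩ := by
  cases a with
  | zero => omega
  | succ a => simp

theorem Instance.enc_rows (I : Instance) :
    enc I.rows = enc ((splitSep .semicolon (encMatrix I.X)).map (splitSep .comma)) := by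
  have h1 : splitSep .semicolon (encMatrix I.X) =
      List.ofFn fun i => (List.ofFn fun j => encRat (I.X i j) ++ [Symb.comma]).flatten := by
    rw [← splitSep_flatten (sep := .semicolon) (l := List.ofFn fun i =>
      (List.ofFn fun j => encRat (I.X i j) ++ [Symb.comma]).flatten), List.map_ofFn]
    · rfl
    · intro x hx
      obtain ⟨i, rfl⟩ := (List.mem_ofFn' _ _).1 hx
      simp [List.mem_flatten, notMem_encRat]
  have h2 : ∀ i, splitSep .comma (List.ofFn fun j => encRat (I.X i j) ++ [Symb.comma]).flatten =
      List.ofFn fun j => encRat (I.X i j) := by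
    intro i
    rw [← splitSep_flatten (sep := .comma) (l := List.ofFn fun j => encRat (I.X i j)),
      List.map_ofFn]
    · rfl
    · intro x hx
      obtain ⟨j, rfl⟩ := (List.mem_ofFn' _ _).1 hx
      simp [notMem_encRat]
  have h3 : ((splitSep .semicolon (encMatrix I.X)).map (splitSep .comma)) =
      I.rows.map (List.map encBound) := by
    rw [h1, List.map_ofFn, rows, List.map_ofFn]
    congr 1
    funext i
    simp only [Function.comp, h2, List.map_ofFn]
    rfl
  rw [h3, enc_map (f := List.map encBound) (enc_map (f := encBound) fun _ => rfl)]

/-- The part of the encoding of an instance that describes the existing subgroups. -/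
def encSubs (I : Instance) : List Symb :=
  (List.ofFn fun l =>
    encVec (I.b l) ++ [Symb.comma] ++ encVec (I.s l) ++ [Symb.semicolon]).flatten

theorem notMem_encSubs (I : Instance) : Symb.bar ∉ encSubs I := by
  simp [encSubs, List.mem_flatten, notMem_encVec]

theorem encInstance_eq (I : Instance) :
    encInstance I = encMatrix I.X ++ Symb.bar :: (encSubs I ++ Symb.bar :: encRat I.τ) := by
  simp [encInstance, encSubs]

theorem Instance.splitSep_subs (I : Instance) :
    splitSep .semicolon (encSubs I) =
    List.ofFn fun l => encVec (I.b l) ++ Symb.comma :: encVec (I.s l) := by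
  rw [← splitSep_flatten (sep := .semicolon) (l := List.ofFn fun l =>
      encVec (I.b l) ++ Symb.comma :: encVec (I.s l)), List.map_ofFn]
  · rw [encSubs]
    congr 3
    funext l
    simp
  · intro x hx
    obtain ⟨i, rfl⟩ := (List.mem_ofFn' _ _).1 hx
    simp [notMem_encVec]

theorem splitSep_pair {d d' : ℕ} (v : Fin d → Bool) (v' : Fin d' → Bool) :
    splitSep .comma (encVec v ++ Symb.comma :: encVec v') =
      encVec v :: splitSep .comma (encVec v') :=
  splitSep_append (notMem_encVec (by simp) _) _

section
variable {ι : Type} [TreeEnc ι] {O : Oracles} {toI : ι → Instance}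

/-- The strings between the bars can be computed from `ι`; the first three of them encode an
instance. -/
def ReadsInstance (O : Oracles) (toI : ι → Instance) : Prop :=
  ∃ str : ι → List Symb, PolyF O str ∧ ∀ x, ∃ t, splitSep .bar (str x) =
    encMatrix (toI x).X :: encSubs (toI x) :: encRat (toI x).τ :: t

theorem splitSep_encInstance_append (I : Instance) (r : List Symb) :
    splitSep .bar (encInstance I ++ Symb.bar :: r) =
    encMatrix I.X :: encSubs I :: encRat I.τ :: splitSep .bar r := by
  simp only [encInstance_eq, List.append_assoc, List.cons_append]
  rw [splitSep_append (notMem_encMatrix (by simp) (by simp) (by simp) (by simp) (by simp) _),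
    splitSep_append (notMem_encSubs I),
    splitSep_append (notMem_encRat (by simp) (by simp) (by simp) _)]

theorem encRat_ne_nil (q : ℚ) : encRat q ≠ [] := by simp [encRat]

theorem splitSep_encInstance (I : Instance) :
    splitSep .bar (encInstance I) =
    [encMatrix I.X, encSubs I, encRat I.τ] := by
  rw [encInstance_eq]
  rw [splitSep_append (notMem_encMatrix (by simp) (by simp) (by simp) (by simp) (by simp) _),
    splitSep_append (notMem_encSubs I),
    splitSep_of_notMem (notMem_encRat (by simp) (by simp) (by simp) _)
      (encRat_ne_nil _)]

theorem ReadsInstance.rows (h : ReadsInstance O toI) : PolyF O fun x => (toI x).rows := by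
  obtain ⟨str, h1, h2⟩ := h
  have h3 : PolyF O fun x => (splitSep .semicolon ((splitSep .bar (str x)).headD [])).map
      (splitSep .comma) := PolyF.map (f := fun _ y => splitSep .comma y) (by fun_prop) (by fun_prop)
  refine h3.congr_enc fun x => ?_
  obtain ⟨t, ht⟩ := h2 x
  rw [ht]
  exact (toI x).enc_rows

theorem ReadsInstance.original (h : ReadsInstance O toI) :
    PolyF O fun x => List.ofFn (toI x).original := by
  obtain ⟨str, h1, h2⟩ := h
  have h3 : PolyF O fun x => (splitSep .comma ((splitSep .semicolon
      ((splitSep .bar (str x)).tail.headD [])).headD [])).headD [] := by fun_prop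
  refine h3.congr_enc fun x => ?_
  obtain ⟨t, ht⟩ := h2 x
  rw [ht]
  simp only [List.tail_cons, List.headD_cons, (toI x).splitSep_subs, headD_ofFn (toI x).a_pos,
    splitSep_pair, enc_encVec]
  rfl

theorem ReadsInstance.selections (h : ReadsInstance O toI) :
    PolyF O fun x => (toI x).selections := by
  obtain ⟨str, h1, h2⟩ := h
  have h3 : PolyF O fun x => (splitSep .semicolon
      ((splitSep .bar (str x)).tail.headD [])).map fun y => (splitSep .comma y).tail.headD [] :=
    PolyF.map (f := fun _ y => (splitSep .comma y).tail.headD []) (by fun_prop) (by fun_prop)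
  refine h3.congr_enc fun x => ?_
  obtain ⟨t, ht⟩ := h2 x
  rw [ht]
  simp only [List.tail_cons, List.headD_cons, (toI x).splitSep_subs, List.map_ofFn,
    Function.comp_def, splitSep_pair,
    splitSep_headD_of_notMem (notMem_encVec (s := .comma) (by simp) _)]
  rw [Instance.selections, ← enc_map (f := List.map Symb.bit) (enc_map fun _ => rfl),
    List.map_ofFn]
  rfl

theorem ReadsInstance.threshold (h : ReadsInstance O toI) :
    PolyF O fun x => (toI x).threshold := by
  obtain ⟨str, h1, h2⟩ := h
  have h3 : PolyF O fun x => (splitSep .bar (str x)).tail.tail.headD [] := by fun_prop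
  refine h3.congr_enc fun x => ?_
  obtain ⟨t, ht⟩ := h2 x
  rw [ht]
  rfl

theorem ReadsInstance.units (h : ReadsInstance O toI) : PolyF O fun x => (toI x).units := by
  have := h.selections
  unfold Instance.units; fun_prop

theorem ReadsInstance.context (h : ReadsInstance O toI) : PolyF O fun x => (toI x).context := by
  have h1 := h.original
  have h2 := h.selections
  have h3 := h.threshold
  have h4 : PolyF O fun x => (List.ofFn (toI x).original).map fun _ => true :=
    PolyF.map (f := fun _ _ => true) (by fun_prop) h1
  unfold Instance.context; fun_prop

theorem ReadsInstance.cols (h : ReadsInstance O toI) : PolyF O fun x => (toI x).cols := by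
  have h1 := h.rows
  have h2 := h.units
  unfold Instance.cols; fun_prop

end

/-- Instances are represented by their encodings as strings. -/
instance : TreeEnc Instance := ⟨fun I => enc (encInstance I)⟩

/-- Instances are represented by their encodings as strings. -/
instance : TreeEnc CardInstance := ⟨fun I => enc (encCardInstance I)⟩

theorem readsInstance_id (O : Oracles) : ReadsInstance O fun I : Instance => I :=
  ⟨encInstance, PolyF.id.congr_enc fun _ => rfl, fun I => ⟨[], splitSep_encInstance I⟩⟩

theorem polyF_encCardInstance (O : Oracles) : PolyF O encCardInstance :=
  PolyF.id.congr_enc fun _ => rfl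

theorem splitSep_encCardInstance (I : CardInstance) :
    splitSep .bar (encCardInstance I) =
    encMatrix I.X :: encSubs I.toInstance :: encRat I.τ ::
      splitSep .bar (encNat I.k) := by
  rw [encCardInstance, List.append_assoc, List.singleton_append, splitSep_encInstance_append]

theorem readsInstance_card (O : Oracles) : ReadsInstance O CardInstance.toInstance :=
  ⟨encCardInstance, polyF_encCardInstance O, fun I => ⟨_, splitSep_encCardInstance I⟩⟩

/-- The minimum of the cardinality threshold and the number of features in unary. -/
def CardInstance.kUnits (I : CardInstance) : List Bool :=
  unaryMin I.units ((encNat I.k).map digit)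

theorem CardInstance.polyF_kUnits (O : Oracles) : PolyF O CardInstance.kUnits := by
  have h1 := (readsInstance_card O).units
  have h2 : PolyF O fun I => (splitSep .bar (encCardInstance I)).tail.tail.tail.headD [] := by
    have := polyF_encCardInstance O
    fun_prop
  have h3 : PolyF O fun I => encNat (CardInstance.k I) := by
    refine h2.congr_enc fun I => ?_
    rw [splitSep_encCardInstance]
    simp only [List.tail_cons, splitSep_headD_of_notMem (notMem_encNat (s := .bar) (by simp) _)]
  exact h1.unaryMin (h3.map_symb digit)

/-! ### The candidates -/

/-- All candidates for the given columns with at most as many nontrivial entries as `ku` has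
elements. -/
def candidates (ku : List Bool) (cols : List (List Bound)) : List (List Bool × List Entry) :=
  cols.foldr (fun col L => extend L col) [(ku, [])]

/-- Does the entry exclude a data object? -/
def excludes (e : Entry) : Bool := !(e.2.2.all fun b => b)

theorem excludes_trivialEntry (col : List Bound) : excludes (trivialEntry col) = false := by
  simp [excludes, trivialEntry, mkEntry, Bound.le_iff, Bound.toEReal]

theorem mem_entries {col : List Bound} {e : Entry} :
    e ∈ entries col ↔ ∃ v ∈ (Bound.negInf :: .posInf :: col),
      ∃ v' ∈ (Bound.negInf :: .posInf :: col), mkEntry col v v' = e := by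
  simp only [entries, List.mem_flatMap, List.mem_map]

theorem trivialEntry_mem_entries (col : List Bound) : trivialEntry col ∈ entries col :=
  mem_entries.2 ⟨_, by simp, _, by simp, rfl⟩

theorem mem_extend {L : List (List Bool × List Entry)} {col : List Bound} {r : List Bool}
    {c : List Entry} : (r, c) ∈ extend L col ↔
      (∃ c', (r, c') ∈ L ∧ c = trivialEntry col :: c') ∨
      ∃ b c', ∃ e ∈ entries col, (b :: r, c') ∈ L ∧ c = e :: c' := by
  simp only [extend, List.mem_flatMap, List.mem_cons, Prod.mk.injEq]
  constructor
  · rintro ⟨⟨r', c'⟩, h, (⟨rfl, rfl⟩ | h')⟩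
    · exact .inl ⟨c', h, rfl⟩
    · cases r' with
      | nil => simp at h'
      | cons b r' =>
        obtain ⟨e, he, h'⟩ := List.mem_map.1 h'
        cases h'
        exact .inr ⟨b, c', e, he, h, rfl⟩
  · rintro (⟨c', h, rfl⟩ | ⟨b, c', e, he, h, rfl⟩)
    · exact ⟨(r, c'), h, .inl ⟨rfl, rfl⟩⟩
    · exact ⟨(b :: r, c'), h, .inr (List.mem_map.2 ⟨e, he, rfl⟩)⟩

theorem selVec_cons (e : Entry) (c : List Entry) : selVec (e :: c) = excludes e :: selVec c := rfl

/-- Candidates consist of entries of the columns and stay within the budget `ku`. -/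
theorem of_mem_candidates {ku : List Bool} {cols : List (List Bound)} {r : List Bool}
    {c : List Entry} (h : (r, c) ∈ candidates ku cols) :
    List.Forall₂ (fun e col => e ∈ entries col) c cols ∧
      (selVec c).count true + r.length ≤ ku.length := by
  induction cols generalizing r c with
  | nil =>
    simp only [candidates, List.foldr_nil, List.mem_singleton, Prod.mk.injEq] at h
    obtain ⟨rfl, rfl⟩ := h
    simp [selVec]
  | cons col cols ih =>
    rcases mem_extend.1 h with ⟨c', h', rfl⟩ | ⟨b, c', e, he, h', rfl⟩
    · obtain ⟨h1, h2⟩ := ih h'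
      refine ⟨.cons (trivialEntry_mem_entries _) h1, ?_⟩
      rw [selVec_cons, excludes_trivialEntry]
      simpa using h2
    · obtain ⟨h1, h2⟩ := ih h'
      refine ⟨.cons he h1, ?_⟩
      rw [List.length_cons] at h2
      rw [selVec_cons, List.count_cons]
      split <;> omega

/-- Every choice of entries that stays within the budget `ku` is a candidate, provided that the
entries without effect are the trivial ones. -/
theorem mem_candidates {ku : List Bool} {cols : List (List Bound)} {c : List Entry}
    (h : List.Forall₂ (fun e col => e = trivialEntry col ∨ e ∈ entries col ∧ excludes e = true)
      c cols) (hk : (selVec c).count true ≤ ku.length) :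
    ∃ r, (r, c) ∈ candidates ku cols ∧ (selVec c).count true + r.length = ku.length := by
  induction h with
  | nil => exact ⟨ku, by simp [candidates, selVec]⟩
  | @cons e col c cols he _ ih =>
    rw [selVec_cons] at hk ⊢
    rcases he with rfl | ⟨he, hs⟩
    · rw [excludes_trivialEntry] at hk ⊢
      simp only [Bool.false_eq_true, not_false_eq_true, List.count_cons_of_ne,
        ne_eq] at hk ⊢
      obtain ⟨r, h1, h2⟩ := ih hk
      exact ⟨r, mem_extend.2 (.inl ⟨c, h1, rfl⟩), h2⟩
    · rw [hs, List.count_cons_self] at hk ⊢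
      obtain ⟨r, h1, h2⟩ := ih (by omega)
      cases r with
      | nil => simp only [List.length_nil] at h2; omega
      | cons b r =>
        exact ⟨r, mem_extend.2 (.inr ⟨b, c, e, he, h1, rfl⟩), by
          rw [List.length_cons] at h2; omega⟩

/-! ### The number of candidates -/

/-- The sum of `y ^ r`, where `r` runs over the numbers of choices left to the candidates. -/
def weight (y : ℕ) (L : List (List Bool × List Entry)) : ℕ :=
  (L.map fun x => y ^ x.1.length).sum

theorem weight_append (y : ℕ) (L L' : List (List Bool × List Entry)) :
    weight y (L ++ L') = weight y L + weight y L' := by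
  simp [weight]

/-- A candidate with `r` choices left gives rise to one candidate with `r` choices left and at most
`T` candidates with `r - 1` choices left, and `y ^ r + T * y ^ (r - 1) ≤ (y + T) ^ r`. -/
theorem weight_extend_le (L : List (List Bool × List Entry)) (col : List Bound) {T : ℕ}
    (hT : (entries col).length ≤ T) (y : ℕ) : weight y (extend L col) ≤ weight (y + T) L := by
  induction L with
  | nil => rfl
  | cons x L ih =>
    obtain ⟨r, c⟩ := x
    have h1 : extend ((r, c) :: L) col = ((r, trivialEntry col :: c) ::
      (match r with
      | [] => []
      | _ :: r => (entries col).map fun e => (r, e :: c))) ++ extend L col := rfl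
    rw [h1, weight_append]
    refine Nat.add_le_add ?_ ih
    cases r with
    | nil => simp [weight]
    | cons b r =>
      have h2 := Nat.pow_le_pow_left (Nat.le_add_right y T) r.length
      have h3 := Nat.mul_le_mul_right (y ^ r.length) hT
      have h4 : (y + T) ^ (r.length + 1) = y * (y + T) ^ r.length + T * (y + T) ^ r.length := by
        ring
      have h5 := Nat.mul_le_mul_left y h2
      have h6 := Nat.mul_le_mul_left T h2
      simp only [weight, List.map_cons, List.map_map, Function.comp_def, List.map_const',
        List.sum_cons, List.sum_replicate, smul_eq_mul, List.length_cons, h4]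
      rw [pow_succ, mul_comm (y ^ _) y]
      omega

theorem weight_candidates_le (ku : List Bool) (cols : List (List Bound)) {T : ℕ}
    (hT : ∀ col ∈ cols, (entries col).length ≤ T) (y : ℕ) :
    weight y (candidates ku cols) ≤ (y + cols.length * T) ^ ku.length := by
  induction cols generalizing y with
  | nil => simp [weight, candidates]
  | cons col cols ih =>
    refine (weight_extend_le _ col (hT col (by simp)) y).trans
      ((ih (fun col h => hT col (by simp [h])) _).trans_eq ?_)
    rw [List.length_cons]
    ring

/-- There are at most `(1 + n * T) ^ k` candidates for `n` columns with at most `T` entries each. -/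
theorem length_candidates_le (ku : List Bool) (cols : List (List Bound)) {T : ℕ}
    (hT : ∀ col ∈ cols, (entries col).length ≤ T) :
    (candidates ku cols).length ≤ (1 + cols.length * T) ^ ku.length := by
  simpa [weight] using weight_candidates_le ku cols hT 1

theorem sz_list_le {α : Type} [TreeEnc α] {l : List α} {S : ℕ} (h : ∀ a ∈ l, sz a ≤ S) :
    sz l ≤ l.length * (S + 1) + 1 := by
  induction l with
  | nil => simp
  | cons a l ih =>
    have h1 := h a (by simp)
    have h2 := ih fun b hb => h b (by simp [hb])
    rw [sz_cons, List.length_cons, Nat.succ_mul]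
    omega

theorem sz_candidates_le (ku : List Bool) (cols : List (List Bound)) {S : ℕ}
    (hS : ∀ col ∈ cols, sz (entries col) ≤ S) :
    sz (candidates ku cols) ≤
      (1 + cols.length * S) ^ ku.length * (sz ku + cols.length * (S + 1) + 3) + 1 := by
  have h1 : ∀ x ∈ candidates ku cols, sz x ≤ sz ku + cols.length * (S + 1) + 2 := by
    rintro ⟨r, c⟩ hx
    obtain ⟨h1, h2⟩ := of_mem_candidates hx
    have h3 : sz c ≤ c.length * (S + 1) + 1 := by
      refine sz_list_le fun e he => ?_
      obtain ⟨i, hi, rfl⟩ := List.getElem_of_mem he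
      have h4 := (List.forall₂_iff_get.1 h1).2 i hi (by rw [← h1.length_eq]; exact hi)
      exact (sz_le_of_mem h4).le.trans (hS _ (by simp))
    rw [h1.length_eq] at h3
    have h4 := sz_bits r
    have h5 := sz_bits ku
    change sz r + sz c + 1 ≤ _
    omega
  refine (sz_list_le h1).trans (Nat.add_le_add_right (Nat.mul_le_mul_right _ ?_) _)
  exact length_candidates_le ku cols fun col h => (length_lt_sz _).le.trans (hS col h)

/-! ### Candidates and subgroups -/

section
open Classical

/-- The entry `e` for a feature with values `x` describes the effect of the bounds `lb`, `ub`. -/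
def Fits {m : ℕ} (x : Fin m → ℚ) (e : Entry) (lb ub : EReal) : Prop :=
  e.2.2 = List.ofFn fun i => decide (lb ≤ ((x i : ℝ) : EReal) ∧ ((x i : ℝ) : EReal) ≤ ub)

theorem fits_mkEntry {m : ℕ} (x : Fin m → ℚ) (v v' : Bound) :
    Fits x (mkEntry (List.ofFn fun i => Bound.rat (x i)) v v') v.toEReal v'.toEReal := by
  simp only [Fits, mkEntry, List.map_ofFn]
  congr 1
  funext i
  rw [Bool.eq_iff_iff]
  simp only [Function.comp, Bool.and_eq_true, Bound.le_iff, decide_eq_true_eq]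
  rfl

theorem Fits.excludes_eq {m : ℕ} {x : Fin m → ℚ} {e : Entry} {lb ub : EReal} (h : Fits x e lb ub) :
    excludes e = decide (∃ i, ((x i : ℝ) : EReal) < lb ∨ ub < ((x i : ℝ) : EReal)) := by
  rw [excludes, h, Bool.eq_iff_iff]
  simp only [Bool.not_eq_true', decide_eq_true_eq, ← Bool.not_eq_true, List.all_eq_true,
    List.mem_ofFn', Set.mem_range, forall_exists_index, forall_apply_eq_imp_iff, not_forall,
    not_and_or, not_le]

/-- Arbitrary bounds for a feature have the same effect as bounds that are infinite or occur in the
column: the smallest and the largest admitted value will do. -/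
theorem exists_entry {m : ℕ} (x : Fin m → ℚ) (lb ub : EReal) :
    ∃ e, (e = trivialEntry (List.ofFn fun i => Bound.rat (x i)) ∨
      e ∈ entries (List.ofFn fun i => Bound.rat (x i)) ∧ excludes e = true) ∧ Fits x e lb ub := by
  by_cases h : ∃ i, ((x i : ℝ) : EReal) < lb ∨ ub < ((x i : ℝ) : EReal)
  · suffices ∃ e, e ∈ entries (List.ofFn fun i => Bound.rat (x i)) ∧ Fits x e lb ub by
      obtain ⟨e, h1, h2⟩ := this
      exact ⟨e, .inr ⟨h1, by rw [h2.excludes_eq]; simpa using h⟩, h2⟩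
    let s := Finset.univ.filter fun i => lb ≤ ((x i : ℝ) : EReal) ∧ ((x i : ℝ) : EReal) ≤ ub
    have hs : ∀ i, i ∈ s ↔ lb ≤ ((x i : ℝ) : EReal) ∧ ((x i : ℝ) : EReal) ≤ ub := by simp [s]
    have key : ∀ v ∈ Bound.negInf :: .posInf :: List.ofFn fun i => Bound.rat (x i),
        ∀ v' ∈ Bound.negInf :: .posInf :: List.ofFn fun i => Bound.rat (x i),
        (∀ i, (v.toEReal ≤ ((x i : ℝ) : EReal) ∧ ((x i : ℝ) : EReal) ≤ v'.toEReal) ↔ i ∈ s) →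
        ∃ e, e ∈ entries (List.ofFn fun i => Bound.rat (x i)) ∧ Fits x e lb ub := by
      intro v hv v' hv' h
      refine ⟨_, mem_entries.2 ⟨v, hv, v', hv', rfl⟩, (fits_mkEntry x v v').trans ?_⟩
      simp only [h, hs]
    rcases s.eq_empty_or_nonempty with h0 | h0
    · refine key .posInf (by simp) .negInf (by simp) fun i => ?_
      simp [h0, Bound.toEReal]
    · obtain ⟨i, hi, hi'⟩ := s.exists_min_image x h0
      obtain ⟨j, hj, hj'⟩ := s.exists_max_image x h0
      refine key (.rat (x i)) (by simp) (.rat (x j)) (by simp) fun a => ?_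
      simp only [Bound.toEReal, EReal.coe_le_coe_iff, Rat.cast_le]
      refine ⟨fun h => (hs a).2 ⟨((hs i).1 hi).1.trans ?_, le_trans ?_ ((hs j).1 hj).2⟩,
        fun h => ⟨hi' a h, hj' a h⟩⟩
      · exact_mod_cast h.1
      · exact_mod_cast h.2
  · refine ⟨_, .inl rfl, (fits_mkEntry x _ _).trans ?_⟩
    push Not at h
    simp [h, Bound.toEReal]

theorem zipWith_ofFn {α β γ : Type} (f : α → β → γ) {d : ℕ} (a : Fin d → α) (b : Fin d → β) :
    List.zipWith f (List.ofFn a) (List.ofFn b) = List.ofFn fun i => f (a i) (b i) :=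
  List.ext_getElem (by simp) fun i _ _ => by simp

theorem memVec_ofFn {m n : ℕ} (E : Fin n → Entry) (B : Fin n → Fin m → Bool)
    (h : ∀ j, (E j).2.2 = List.ofFn (B j)) :
    memVec (List.ofFn fun _ : Fin m => true) (List.ofFn E) =
      List.ofFn fun i => decide (∀ j, B j i = true) := by
  induction n with
  | zero => simp [memVec]
  | succ n ih =>
    have := ih (fun j => E j.succ) (fun j => B j.succ) fun j => h _
    rw [memVec] at this ⊢
    rw [List.ofFn_succ, List.foldr_cons, this, h, zipWith_ofFn]
    congr 1
    funext i
    rw [Bool.eq_iff_iff]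
    simp [Fin.forall_fin_succ]

theorem columns_ofFn {m n : ℕ} (B : Fin m → Fin n → Bound) (v : Fin n → Bool) :
    columns (List.ofFn fun i => List.ofFn (B i)) (List.ofFn v) =
      List.ofFn fun j => List.ofFn fun i => B i j := by
  induction m with
  | zero => simp [columns, List.map_ofFn, Function.comp_def]
  | succ m ih =>
    have := ih fun i => B i.succ
    rw [columns] at this ⊢
    rw [List.ofFn_succ, List.foldr_cons, this, zipWith_ofFn]
    simp [List.ofFn_succ]

theorem count_ofFn {n : ℕ} (v : Fin n → Bool) :
    (List.ofFn v).count true = (Finset.univ.filter fun j => v j = true).card := by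
  induction n with
  | zero => simp
  | succ n ih =>
    rw [List.ofFn_succ, List.count_cons, ih, Fin.card_filter_univ_succ]
    cases v 0 <;> simp [Nat.add_comm]

theorem Instance.units_eq (I : Instance) : I.units = List.ofFn (I.s ⟨0, I.a_pos⟩) :=
  headD_ofFn I.a_pos _ _

theorem Instance.cols_eq (I : Instance) :
    I.cols = List.ofFn fun j => List.ofFn fun i => Bound.rat (I.X i j) := by
  rw [cols, rows, units_eq]
  exact columns_ofFn (fun i j => Bound.rat (I.X i j)) _

theorem Instance.selVec_eq (I : Instance) {E : Fin I.n → Entry} {lb ub : Fin I.n → EReal}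
    (h : ∀ j, Fits (fun i => I.X i j) (E j) (lb j) (ub j)) :
    selVec (List.ofFn E) = List.ofFn (selection I.data lb ub) := by
  rw [selVec, List.map_ofFn]
  congr 1
  funext j
  change excludes (E j) = _
  rw [(h j).excludes_eq, Bool.eq_iff_iff]
  simp only [selection, decide_eq_true_eq]
  exact Iff.rfl

theorem Instance.memVec_eq (I : Instance) {E : Fin I.n → Entry} {lb ub : Fin I.n → EReal}
    (h : ∀ j, Fits (fun i => I.X i j) (E j) (lb j) (ub j)) :
    memVec I.context.2.2.2 (List.ofFn E) = List.ofFn (membership I.data lb ub) := by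
  have h1 : I.context.2.2.2 = List.ofFn fun _ : Fin I.m => true := by
    simp [context, List.map_ofFn, Function.comp_def]
  rw [h1, memVec_ofFn E _ h]
  congr 1
  funext i
  rw [Bool.eq_iff_iff]
  simp only [membership, decide_eq_true_eq]
  exact Iff.rfl

/-! ### The search finds a best subgroup -/

variable {sim dis : VectorMeasure}

theorem feasible_eq (I : Instance) {E : Fin I.n → Entry} {lb ub : Fin I.n → EReal}
    (h : ∀ j, Fits (fun i => I.X i j) (E j) (lb j) (ub j)) :
    feasible (disTest dis) I.context (List.ofFn E) = true ↔
      IsDissimilar dis I.data I.s I.τ lb ub := by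
  simp only [feasible, I.selVec_eq h, List.all_eq_true, Instance.context, Instance.selections,
    List.mem_ofFn', Set.mem_range, forall_exists_index, forall_apply_eq_imp_iff, mkDis_eq,
    IsDissimilar]
  simp [disTest, Instance.threshold]

/-- The fold finds a maximum with respect to a score `v` if the comparisons are correct. -/
theorem foldl_better {simT : SimQuery → Bool} {x : Context} {F : List (List Entry)}
    {v : List Entry → ℝ} (h : ∀ c ∈ F, ∀ c' ∈ F,
      simT (mkSim (memVec x.2.2.2 c') (memVec x.2.2.2 c) x.1) = decide (v c' ≤ v c)) :
    (F = [] ∧ F.foldl (better simT x) [] = []) ∨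
      ∃ c ∈ F, F.foldl (better simT x) [] = [c] ∧ ∀ c' ∈ F, v c' ≤ v c := by
  induction F using List.reverseRecOn with
  | nil => simp
  | append_singleton F c ih =>
    right
    rw [List.foldl_append, List.foldl_cons, List.foldl_nil]
    rcases ih fun c hc c' hc' => h c (by simp [hc]) c' (by simp [hc']) with
      ⟨rfl, h1⟩ | ⟨c', h1, h2, h3⟩
    · exact ⟨c, by simp [better]⟩
    · rw [h2, better, h c (by simp) c' (by simp [h1])]
      by_cases hv : v c' ≤ v c
      · refine ⟨c, by simp, by simp [hv], fun d hd => ?_⟩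
        rcases List.mem_append.1 hd with hd | hd
        · exact (h3 d hd).trans hv
        · rw [List.mem_singleton.1 hd]
      · refine ⟨c', by simp [h1], by simp [hv], fun d hd => ?_⟩
        rcases List.mem_append.1 hd with hd | hd
        · exact h3 d hd
        · rw [List.mem_singleton.1 hd]
          exact (not_le.1 hv).le

theorem featureCardinality_eq (I : Instance) {E : Fin I.n → Entry} {lb ub : Fin I.n → EReal}
    (h : ∀ j, Fits (fun i => I.X i j) (E j) (lb j) (ub j)) :
    (selVec (List.ofFn E)).count true = featureCardinality I.data lb ub := by
  rw [I.selVec_eq h, count_ofFn, featureCardinality]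

/-- The search returns a correct answer, with the bound on the feature cardinality given in
unary. -/
theorem exists_isOptimal (I : Instance) (ku : List Bool) :
    ∃ A : Answer I.n, IsOptimal (fun lb ub => IsDissimilar dis I.data I.s I.τ lb ub ∧
        featureCardinality I.data lb ub ≤ ku.length) (similarity sim I.data I.original) A ∧
      printAnswer (bestOf (simTest sim) (disTest dis) I.context (candidates ku I.cols)) =
        encAnswer A := by
  set F := ((candidates ku I.cols).map Prod.snd).filter (feasible (disTest dis) I.context) with hF
  -- candidates are subgroups
  have sound : ∀ c ∈ F, ∃ E : Fin I.n → Entry, c = List.ofFn E ∧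
      (∀ j, Fits (fun i => I.X i j) (E j) (E j).1.toEReal (E j).2.1.toEReal) ∧
      featureCardinality I.data (fun j => (E j).1.toEReal) (fun j => (E j).2.1.toEReal) ≤
        ku.length := by
    intro c hc
    obtain ⟨⟨r, c⟩, hrc, rfl⟩ := List.mem_map.1 (List.mem_filter.1 hc).1
    obtain ⟨h1, h2⟩ := of_mem_candidates hrc
    rw [I.cols_eq] at h1
    have h3 : c.length = I.n := by simpa using h1.length_eq
    let E : Fin I.n → Entry := fun j => c.get (Fin.cast h3.symm j)
    have h4 : c = List.ofFn E := List.ext_getElem (by simp [h3]) fun i _ _ => by simp [E]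
    have h5 : ∀ j, Fits (fun i => I.X i j) (E j) (E j).1.toEReal (E j).2.1.toEReal := by
      intro j
      have := (List.forall₂_iff_get.1 h1).2 j (by omega) (by simp)
      simp only [List.get_ofFn] at this
      obtain ⟨v, _, v', _, h⟩ := mem_entries.1 this
      have h6 := fits_mkEntry (fun i => I.X i j) v v'
      have h7 : mkEntry (List.ofFn fun i => Bound.rat (I.X i j)) v v' = E j := h
      rw [← h7]
      exact h6
    refine ⟨E, h4, h5, ?_⟩
    rw [← featureCardinality_eq I h5, ← h4]
    omega
  -- all feasible subgroups are represented by candidates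
  have complete : ∀ lb ub, IsDissimilar dis I.data I.s I.τ lb ub →
      featureCardinality I.data lb ub ≤ ku.length → ∃ E : Fin I.n → Entry, List.ofFn E ∈ F ∧
      ∀ j, Fits (fun i => I.X i j) (E j) (lb j) (ub j) := by
    intro lb ub h1 h2
    choose E h3 h4 using fun j => exists_entry (fun i => I.X i j) (lb j) (ub j)
    rw [← featureCardinality_eq I h4] at h2
    obtain ⟨r, hr, _⟩ := mem_candidates (cols := I.cols) (c := List.ofFn E) (by
      rw [I.cols_eq, List.forall₂_iff_get]
      refine ⟨by simp, fun i hi hi' => ?_⟩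
      simpa using h3 ⟨i, by simpa using hi⟩) h2
    exact ⟨E, List.mem_filter.2 ⟨List.mem_map_of_mem hr, (feasible_eq I h4).2 h1⟩, h4⟩
  let v : List Entry → ℝ := fun c => sim I.m (vec I.m (memVec I.context.2.2.2 c)) I.original
  have hv : ∀ {E : Fin I.n → Entry} {lb ub}, (∀ j, Fits (fun i => I.X i j) (E j) (lb j) (ub j)) →
      v (List.ofFn E) = similarity sim I.data I.original lb ub := by
    intro E lb ub h
    simp only [v, I.memVec_eq h, vec_ofFn]
    rfl
  have hcmp : ∀ c ∈ F, ∀ c' ∈ F, simTest sim (mkSim (memVec I.context.2.2.2 c')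
      (memVec I.context.2.2.2 c) I.context.1) = decide (v c' ≤ v c) := by
    intro c hc c' hc'
    obtain ⟨E, rfl, hE, _⟩ := sound c hc
    obtain ⟨E', rfl, hE', _⟩ := sound c' hc'
    simp only [v, I.memVec_eq hE, I.memVec_eq hE', vec_ofFn]
    simp only [Instance.context, mkSim_eq]
    rfl
  change ∃ A, _ ∧ printAnswer (F.foldl (better (simTest sim) I.context) []) = _
  rcases foldl_better hcmp with ⟨h1, h2⟩ | ⟨c, h1, h2, h3⟩
  · refine ⟨none, fun lb ub h => ?_, by rw [h2]; rfl⟩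
    obtain ⟨E, hE, _⟩ := complete lb ub h.1 h.2
    rw [h1] at hE
    simp at hE
  · obtain ⟨E, rfl, hE, hk⟩ := sound c h1
    refine ⟨some (fun j => (E j).1, fun j => (E j).2.1), ⟨⟨?_, hk⟩, fun lb ub h => ?_⟩, ?_⟩
    · exact (feasible_eq I hE).1 (List.mem_filter.1 h1).2
    · obtain ⟨E', hE', hE''⟩ := complete lb ub h.1 h.2
      rw [← hv hE, ← hv hE'']
      exact h3 _ hE'
    · rw [h2, printAnswer, encAnswer, List.map_ofFn]
      rfl

end

theorem Instance.length_units (I : Instance) : I.units.length = I.n := by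
  rw [units_eq, List.length_ofFn]

theorem length_unaryMin (nv digits : List Bool) :
    (unaryMin nv digits).length = min nv.length (val digits) := by
  induction digits with
  | nil => simp [unaryMin]
  | cons d digits ih =>
    rw [unaryMin] at ih ⊢
    rw [List.foldr_cons, val_cons, truncTo, List.length_map, List.length_zip, List.length_append,
      List.length_append, ih]
    cases d <;> simp <;> omega

theorem CardInstance.length_kUnits (I : CardInstance) : I.kUnits.length = min I.n I.k := by
  rw [kUnits, length_unaryMin, map_digit_encNat, Instance.length_units]

theorem featureCardinality_le {m n : ℕ} (X : Matrix (Fin m) (Fin n) ℝ) (lb ub : Fin n → EReal) :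
    featureCardinality X lb ub ≤ n :=
  (Finset.card_filter_le _ _).trans_eq (by simp)

/-! ### Membership in XP -/

section
variable {ι α σ : Type} [TreeEnc ι] [TreeEnc α] [TreeEnc σ] {O : Oracles}

/-- A left fold with polynomial-time steps yields an XP algorithm if the sizes of all intermediate
states are at most `N ^ (c * (p + 1))`, where `N` is the size of the input and `p` the
parameter. -/
theorem exists_machine {encI : ι → List Symb} (henc : ∀ x, enc x = enc (encI x))
    (hlen : ∀ x, 2 ≤ (encI x).length) (param : ι → ℕ) {f : σ → α → σ} {l : ι → List α} {s : ι → σ}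
    {fin : σ → List Symb} (hf : PolyF O fun x : σ × α => f x.1 x.2) (hl : PolyF O l)
    (hs : PolyF O s) (hfin : PolyF O fin)
    (hsz : ∃ c, ∀ x l₁ l₂, l x = l₁ ++ l₂ →
      sz (l₁.foldl f (s x)) ≤ (sz x + 2) ^ (c * (param x + 1))) :
    ∃ (M : TM2ComputableAux Symb Symb) (f' g : Polynomial ℕ), ∀ x,
      Nonempty (TM2OutputsInTime M.tm ((encI x).map M.inputAlphabet.symm)
        (some ((fin ((l x).foldl f (s x))).map M.outputAlphabet.symm))
        (f'.eval (param x) * (encI x).length ^ (g.eval (param x)))) := by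
  obtain ⟨a, ha⟩ := hl.sz_le
  obtain ⟨c, hc⟩ := hsz
  obtain ⟨c₄, hc₄⟩ := hfin.sz_le
  -- the fold runs in a dummy environment
  obtain ⟨p₁, c₁, h₁⟩ := hl.pair ((PolyF.const Symb.bar).pair hs)
  obtain ⟨p₂, c₂, h₂⟩ := PolyF.foldStep (O := O) (f := fun (_ : Symb) s a => f s a)
    (hf.comp (f := fun x : (Symb × σ) × α => (x.1.2, x.2)) (by fun_prop))
  obtain ⟨p₃, c₃, h₃⟩ := hfin
  let prog : OProg O := .seq readInput (.seq p₁ (.seq (foldProg p₂) (.seq p₃ writeOutput)))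
  -- bounds in terms of `(N + 2) ^ (p + 1)`
  let B : ℕ → ℕ := fun n => (n + 2) ^ a + (n + 2) ^ c + 3
  have hB : PolyB B := ((PolyB.pow a).add (.pow c)).add (.const 3)
  obtain ⟨C, hC⟩ : PolyB fun n => (8 * n + 5) + ((n + 2) ^ c₁ +
      ((B n * ((B n + 2) ^ c₂ + 5) + 10 * B n + 20) + ((B n + 2) ^ c₃ +
        (8 * (B n + 2) ^ c₄ + 5)))) + 1 :=
    ((PolyB.linear 8 5).add ((PolyB.pow c₁).add ((((hB.mul ((hB.powAdd c₂).add (.const 5))).add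
      ((PolyB.const 10).mul hB)).add (.const 20)).add ((hB.powAdd c₃).add
        (((PolyB.const 8).mul (hB.powAdd c₄)).add (.const 5)))))).add (.const 1)
  refine ⟨⟨prog.toFinTM2 (.inr (.inl ())), Equiv.refl Symb, Equiv.refl Symb⟩, 1,
    .C (8 * C) * (.X + 1), fun x => ?_⟩
  set n := (encI x).length with hn
  set q := param x
  have hz : sz x = 2 * n + 1 := by rw [sz, henc, enc_list_symb, size_strTree]
  set Z := (sz x + 2) ^ (q + 1) with hZ
  have hzZ : sz x + 2 ≤ Z := Nat.le_self_pow (by omega) _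
  have hpow : ∀ d, (sz x + 2) ^ d ≤ (Z + 2) ^ d := fun d => Nat.pow_le_pow_left (by omega) d
  have hM : ∀ l₁ l₂, l x = l₁ ++ l₂ → sz (l₂, (Symb.bar, l₁.foldl f (s x))) ≤ B Z := by
    intro l₁ l₂ h
    have e1 := ha x
    rw [h] at e1
    have e2 : _ ≤ (sz x + 2) ^ (c * (q + 1)) := hc x l₁ l₂ h
    have e3 := sz_append l₁ l₂
    have e4 := sz_pos l₁
    have e5 : (sz x + 2) ^ (c * (q + 1)) ≤ (Z + 2) ^ c := by
      rw [mul_comm, pow_mul]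
      exact Nat.pow_le_pow_left (by omega) c
    have e6 := hpow a
    change sz l₂ + (1 + sz (l₁.foldl f (s x)) + 1) + 1 ≤ (Z + 2) ^ a + (Z + 2) ^ c + 3
    omega
  have hM0 := hM [] (l x) rfl
  have hM1 := hM (l x) [] (by simp)
  simp only [sz_pair] at hM0 hM1
  set r := (l x).foldl f (s x)
  have r1 := runsIn_readInput (O := O) (encI x)
  have r2 := h₁ x []
  have r3 := runsIn_foldProg (f := fun _ s a => f s a) h₂ (l x) Symb.bar (s x) (B Z) hM []
  have r4 := h₃ r []
  have r5 := runsIn_writeOutput (O := O) (fin r)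
  rw [henc, enc_list_symb, List.append_nil (strTree (encI x)).code] at r2
  rw [enc_list_symb, List.append_nil (strTree (fin r)).code] at r4
  obtain ⟨t, ht, hrun⟩ := r1.seq (r2.seq (r3.seq (r4.seq r5)))
  have hio : ∀ y : List Symb, st (wk [] [] [] []) y (fun _ => []) (fun _ _ => []) =
      Function.update (β := fun k : Stack O => List (Alphabet O k)) (fun _ => [])
        (.inr (.inl ())) (y.map (Equiv.refl Symb).symm) := by
    intro y
    rw [show y.map (Equiv.refl Symb).symm = y from List.map_id y]
    rw [← update_st_io _ []]
    congr 1
    funext k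
    rcases k with k | k | k | ⟨o, k⟩
    · cases k <;> rfl
    all_goals rfl
  rw [ws, hio, hio] at hrun
  have key := Runs.outputsInTime (T := n ^ (8 * C * (q + 1))) hrun ?_
  · have hT : (1 : Polynomial ℕ).eval q * n ^ ((.C (8 * C) * (.X + 1) : Polynomial ℕ).eval q) =
        n ^ (8 * C * (q + 1)) := by simp
    rw [hT]
    exact key
  have t1 : (l x).length * ((B Z + 2) ^ c₂ + 5) ≤ B Z * ((B Z + 2) ^ c₂ + 5) :=
    Nat.mul_le_mul_right _ (by have := length_lt_sz (l x); omega)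
  have t2 : (sz r + 2) ^ c₃ ≤ (B Z + 2) ^ c₃ := Nat.pow_le_pow_left (by omega) _
  have t3 : (sz r + 2) ^ c₄ ≤ (B Z + 2) ^ c₄ := Nat.pow_le_pow_left (by omega) _
  have t4 := hc₄ r
  have t5 := length_lt_sz (fin r)
  have t6 := hpow c₁
  have t7 : t + 1 ≤ (Z + 2) ^ C := by
    refine le_trans ?_ (hC Z)
    change t + 1 ≤ (8 * Z + 5) + ((Z + 2) ^ c₁ +
      ((B Z * ((B Z + 2) ^ c₂ + 5) + 10 * B Z + 20) + ((B Z + 2) ^ c₃ +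
        (8 * (B Z + 2) ^ c₄ + 5)))) + 1
    omega
  -- `2 * n + 3 ≤ n ^ 4` and `Z + 2 ≤ Z ^ 2`
  have hn2 : 2 ≤ n := hlen x
  have t8 : sz x + 2 ≤ n ^ 4 := by
    have : 2 ^ 3 * n ≤ n ^ 3 * n := Nat.mul_le_mul_right n (Nat.pow_le_pow_left hn2 3)
    have e : n ^ 4 = n ^ 3 * n := by ring
    omega
  have t9 : Z + 2 ≤ (n ^ (4 * (q + 1))) ^ 2 := by
    have e1 : Z ≤ n ^ (4 * (q + 1)) := by
      rw [pow_mul]; exact Nat.pow_le_pow_left t8 _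
    have e2 := Nat.pow_le_pow_left e1 2
    nlinarith
  refine (t7.trans (Nat.pow_le_pow_left t9 C)).trans_eq ?_
  rw [← pow_mul, ← pow_mul]
  congr 1
  ring

end

/-- The state of the fold carries the context along, which is needed for the evaluation of the
candidates. The columns are processed from right to left. -/
theorem foldl_extend (ku : List Bool) (x : Context) (l : List (List Bound)) :
    l.foldl (fun (s : Context × List (List Bool × List Entry)) col => (s.1, extend s.2 col))
      (x, [(ku, [])]) = (x, candidates ku l.reverse) := by
  induction l using List.reverseRecOn with
  | nil => rfl
  | append_singleton l col ih =>
    rw [List.foldl_append, ih, List.reverse_append]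
    rfl

/-- The search with a bound on the feature cardinality that can be computed in unary from the input.
-/
theorem exists_search_machine {ι : Type} [TreeEnc ι] {O : Oracles} {sim dis : VectorMeasure}
    (hsim : PolyF O (simTest sim)) (hdis : PolyF O (disTest dis)) {toI : ι → Instance}
    (hI : ReadsInstance O toI) {ku : ι → List Bool} (hku : PolyF O ku) {encI : ι → List Symb}
    (henc : ∀ x, enc x = enc (encI x)) (hlen : ∀ x, 2 ≤ (encI x).length) {param : ι → ℕ}
    (hparam : ∀ x, (ku x).length ≤ param x) :
    ∃ (M : TM2ComputableAux Symb Symb) (f g : Polynomial ℕ), ∀ x, ∃ A : Answer (toI x).n,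
      IsOptimal (fun lb ub => IsDissimilar dis (toI x).data (toI x).s (toI x).τ lb ub ∧
        featureCardinality (toI x).data lb ub ≤ (ku x).length)
        (similarity sim (toI x).data (toI x).original) A ∧
      Nonempty (TM2OutputsInTime M.tm ((encI x).map M.inputAlphabet.symm)
        (some ((encAnswer A).map M.outputAlphabet.symm))
        (f.eval (param x) * (encI x).length ^ (g.eval (param x)))) := by
  have hcols := hI.cols
  have hctx := hI.context
  have hbest := PolyF.bestOf hsim hdis
  obtain ⟨a, ha⟩ := hcols.sz_le
  obtain ⟨b, hb⟩ := hctx.sz_le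
  obtain ⟨c, hc⟩ := hku.sz_le
  obtain ⟨d, hd⟩ := (PolyF.entries (O := O) (PolyF.id (α := List Bound))).sz_le
  -- a polynomial bound for the sizes of the lists of entries
  let S : ℕ → ℕ := fun n => ((n + 2) ^ a + 2) ^ d
  have hS : PolyB S := (PolyB.pow a).powAdd d
  obtain ⟨c₁, h₁⟩ : PolyB fun n => 1 + (n + 2) ^ a * S n :=
    (PolyB.const 1).add ((PolyB.pow a).mul hS)
  obtain ⟨c₂, h₂⟩ : PolyB fun n =>
      (n + 2) ^ c + (n + 2) ^ a * (S n + 1) + 3 + ((n + 2) ^ b + 2) :=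
    (((PolyB.pow c).add ((PolyB.pow a).mul (hS.add (.const 1)))).add (.const 3)).add
      ((PolyB.pow b).add (.const 2))
  obtain ⟨M, f, g, h⟩ := exists_machine (O := O) henc hlen param
    (f := fun (s : Context × List (List Bool × List Entry)) col => (s.1, extend s.2 col))
    (l := fun x => (toI x).cols.reverse) (s := fun x => ((toI x).context, [(ku x, [])]))
    (fin := fun s => printAnswer (bestOf (simTest sim) (disTest dis) s.1 s.2))
    (by fun_prop) (by fun_prop) (by fun_prop) (PolyF.printAnswer hbest)
    ⟨c₁ + c₂, fun x l₁ l₂ hx => by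
      rw [foldl_extend]
      have e1 : ∀ col ∈ l₁.reverse, col ∈ (toI x).cols := by
        intro col hcol
        rw [← List.mem_reverse, hx]
        simp_all
      have e2 : l₁.reverse.length ≤ (sz x + 2) ^ a := by
        have := congrArg List.length hx
        rw [List.length_reverse, List.length_append] at this
        have := length_lt_sz (toI x).cols
        have := ha x
        rw [List.length_reverse]
        omega
      have e3 : ∀ col ∈ l₁.reverse, sz (entries col) ≤ S (sz x) := fun col hcol =>
        (hd col).trans (Nat.pow_le_pow_left
          (by have := sz_le_of_mem (e1 col hcol); have := ha x; omega) _)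
      have e4 := sz_candidates_le (ku x) l₁.reverse e3
      have e5 : (1 + l₁.reverse.length * S (sz x)) ^ (ku x).length ≤
          ((sz x + 2) ^ c₁) ^ param x :=
        (Nat.pow_le_pow_left ((Nat.add_le_add_left (Nat.mul_le_mul_right _ e2) _).trans
          (h₁ _)) _).trans (Nat.pow_le_pow_right (by positivity) (hparam x))
      have e6 := Nat.mul_le_mul_right (S (sz x) + 1) e2
      have e7 := hc x
      have e8 := hb x
      have e9 : (sz x + 2) ^ c + (sz x + 2) ^ a * (S (sz x) + 1) + 3 + ((sz x + 2) ^ b + 2) ≤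
          (sz x + 2) ^ c₂ := h₂ (sz x)
      rw [sz_pair]
      have e10 : (sz x + 2) ^ c₂ * ((sz x + 2) ^ c₁) ^ param x ≤
          (sz x + 2) ^ ((c₁ + c₂) * (param x + 1)) := by
        rw [← pow_mul, ← pow_add]
        exact Nat.pow_le_pow_right (by omega) (by nlinarith)
      -- (number of candidates) * (size of a candidate) + (size of the context)
      refine le_trans ?_ e10
      set P := ((sz x + 2) ^ c₁) ^ param x
      set Q := sz (ku x) + l₁.reverse.length * (S (sz x) + 1) + 3
      have e11 : 1 ≤ P := Nat.one_le_iff_ne_zero.2 (by positivity)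
      have e12 := Nat.mul_le_mul_right Q e5
      have e13 : Q + ((sz x + 2) ^ b + 2) ≤ (sz x + 2) ^ c₂ := by omega
      have e14 := Nat.mul_le_mul_right P e13
      have e15 := Nat.mul_le_mul_left ((sz x + 2) ^ b + 2) e11
      rw [Nat.add_mul, mul_comm Q] at e14
      change sz (toI x).context + sz (candidates (ku x) l₁.reverse) + 1 ≤ _
      omega⟩
  refine ⟨M, f, g, fun x => ?_⟩
  obtain ⟨A, h1, h2⟩ := exists_isOptimal (sim := sim) (dis := dis) (toI x) (ku x)
  refine ⟨A, h1, ?_⟩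
  have := h x
  rw [foldl_extend, List.reverse_reverse, h2] at this
  exact this

theorem two_le_length_encInstance (I : Instance) : 2 ≤ (encInstance I).length := by
  simp only [encInstance_eq, List.length_append, List.length_cons]
  omega

end SubgroupDiscovery

theorem mainTheorem12 (sim dis : SubgroupDiscovery.VectorMeasure)
    (hsim : SubgroupDiscovery.PolyTimeComparable sim)
    (hdis : SubgroupDiscovery.PolyTimeThreshold dis) :
    (SubgroupDiscovery.alternativeDiscovery sim dis).InXP ∧
      (SubgroupDiscovery.alternativeDiscoveryCard sim dis).InXP := by
  open SubgroupDiscovery in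
  obtain ⟨O, h1, h2⟩ := exists_oracles hsim hdis
  constructor
  · obtain ⟨M, f, g, h⟩ := exists_search_machine h1 h2 (readsInstance_id O)
      (readsInstance_id O).units (encI := encInstance) (fun _ => rfl) two_le_length_encInstance
      (param := fun I => I.n) fun I => I.length_units.le
    refine ⟨M, f, g, fun I => ?_⟩
    obtain ⟨A, hA, hM⟩ := h I
    refine ⟨A, ?_, hM⟩
    -- at most `n` features are selected anyway
    have : ∀ lb ub, featureCardinality I.data lb ub ≤ I.units.length := fun lb ub =>
      (featureCardinality_le _ _ _).trans_eq I.length_units.symm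
    simp only [this, and_true] at hA
    exact hA
  · obtain ⟨M, f, g, h⟩ := exists_search_machine h1 h2 (readsInstance_card O)
      (CardInstance.polyF_kUnits O) (encI := encCardInstance) (fun _ => rfl)
      (fun I => (two_le_length_encInstance I.toInstance).trans (by simp [encCardInstance]))
      (param := fun I => I.k) fun I => I.length_kUnits.trans_le (min_le_right _ _)
    refine ⟨M, f, g, fun I => ?_⟩
    obtain ⟨A, hA, hM⟩ := h I
    refine ⟨A, ?_, hM⟩
    have : ∀ lb ub, featureCardinality I.data lb ub ≤ I.kUnits.length ↔
        featureCardinality I.data lb ub ≤ I.k := fun lb ub => by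
      rw [I.length_kUnits, le_min_iff]
      exact and_iff_right (featureCardinality_le _ _ _)
    simp only [this] at hA
    exact hA
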